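/- Let $\mathfrak h$ be a (finite-dimensional) real semisimple Lie algebra and let $V$ be a finite-dimensional real representation of $\mathfrak h$ that is orthogonal, i.e. preserves a nondegenerate symmetric bilinear form. For $v\in V$ let $\mathfrak h_v=\{X\in\mathfrak h: X\cdot v=0\}$. Definitions. For a finite-dimensional real representation $W$ of $\mathfrak h$ and $Y\in\mathfrak h$, let $\rho_W^+(Y)$ be the real part of the trace of $Y$ on the sum of its generalized eigenspaces in $W_{\mathbb C}$ with eigenvalues of positive real part, and put $\rho_W(Y)=\frac12(\rho_W^+(Y)+\rho_W^+(-Y))$; $\rho_{\mathfrak h}$ is this function for the adjoint representation. A subalgebra of $\mathfrak h$ is *split abelian* if it is abelian and $\operatorname{ad}_{\mathfrak h}Y$ is diagonalizable over $\mathbb R$ for each of its elements $Y$. Let $\mathfrak a$ be a maximal split abelian subalgebra of $\mathfrak h$; $\rho_{\mathfrak h}\le\rho_V$ means $\rho_{\mathfrak h}(Y)\le\rho_V(Y)$ for all $Y\in\mathfrak a$. The *real rank* of a subalgebra $\mathfrak l\subset\mathfrak h$ is the largest dimension of a split abelian subalgebra of $\mathfrak h$ contained in $\mathfrak l$. A subalgebra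 $\mathfrak l\subset\mathfrak h$ is *reductive* if its adjoint action on $\mathfrak h$ is semisimple, and *amenable reductive* if moreover the Killing form of $\mathfrak h$ is negative definite on $[\mathfrak l,\mathfrak l]$. $V$ *has AmGS in* $\mathfrak h$ if $\{v\in V:\mathfrak h_v\text{ is amenable reductive}\}$ is dense in $V$. A *generic stabilizer* of $V$ is a member of a finite family of reductive subalgebras $\mathfrak m_1,\dots,\mathfrak m_r$ of $\mathfrak h$ such that the set of $v\in V$ whose stabilizer $\mathfrak h_v$ is conjugate, under the adjoint group of $\mathfrak h$, to one of the $\mathfrak m_i$ contains a non-empty Zariski open subset of $V$, and such that no $\mathfrak m_i$ can be removed from the family. Proposition. 1. If $\rho_{\mathfrak h}\le\rho_V$, then $V$ has AmGS in $\mathfrak h$. 2. If one of the generic stabilizers $\mathfrak m$ of $V$ has the same real rank as $\mathfrak h$, then the converse is true: if $V$ has AmGS in $\mathfrak h$, then $\rho_{\mathfrak h}\le\rho_V$. -/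

import Mathlib

open scoped TensorProduct

namespace LieRep

noncomputable section

/-! ### Traces of positive parts and the function `ρ` -/

/-- The sum of the generalized eigenspaces of a complex endomorphism belonging to the
eigenvalues with positive real part. -/
def posSpace {W : Type*} [AddCommGroup W] [Module ℂ W] (f : Module.End ℂ W) :
    Submodule ℂ W :=
  ⨆ μ : {μ : ℂ // 0 < μ.re}, f.maxGenEigenspace μ

theorem mapsTo_posSpace {W : Type*} [AddCommGroup W] [Module ℂ W] (f : Module.End ℂ W) :
    ∀ x ∈ posSpace f, f x ∈ posSpace f := by
  intro x hx
  have h : posSpace f ≤ (posSpace f).comap f := by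
    refine iSup_le fun μ y hy => ?_
    have h1 : f y ∈ f.maxGenEigenspace μ :=
      Module.End.mapsTo_maxGenEigenspace_of_comm (Commute.refl f) (μ : ℂ) hy
    exact (le_iSup (fun μ : {μ : ℂ // 0 < μ.re} => f.maxGenEigenspace (μ : ℂ)) μ) h1
  exact h hx

/-- The real part of the trace of a real endomorphism on the subspace of the complexified
space where its eigenvalues have positive real part. -/
def posTrace {V : Type*} [AddCommGroup V] [Module ℝ V] (f : Module.End ℝ V) : ℝ :=
  (LinearMap.trace ℂ (posSpace (LinearMap.baseChange ℂ f))
    ((LinearMap.baseChange ℂ f).restrict (mapsTo_posSpace (LinearMap.baseChange ℂ f)))).re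

/-- `ρ_V(Y) = (ρ_V⁺(Y) + ρ_V⁺(-Y)) / 2` for a representation `V` of a real Lie algebra. -/
def rho (L : Type*) (V : Type*) [LieRing L] [LieAlgebra ℝ L] [AddCommGroup V] [Module ℝ V]
    [LieRingModule L V] [LieModule ℝ L V] (Y : L) : ℝ :=
  (posTrace (LieModule.toEnd ℝ L V Y) + posTrace (LieModule.toEnd ℝ L V (-Y))) / 2

/-! ### Split abelian subalgebras and the real rank -/

section Algebra

variable {L : Type*} [LieRing L] [LieAlgebra ℝ L]

/-- A subalgebra is split abelian if it is abelian and all its elements act on the ambient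
Lie algebra, by the adjoint representation, diagonalizably over `ℝ`. -/
def IsSplitAbelian (a : LieSubalgebra ℝ L) : Prop :=
  IsLieAbelian a ∧
    ∀ Y ∈ a, (⨆ μ : ℝ, Module.End.eigenspace (LieAlgebra.ad ℝ L Y) μ) = ⊤

/-- The real rank of a subalgebra `l`: the largest dimension of a split abelian subalgebra
(of the ambient Lie algebra) contained in `l`. -/
def realRank (l : LieSubalgebra ℝ L) : ℕ :=
  sSup {n : ℕ | ∃ a : LieSubalgebra ℝ L, a ≤ l ∧ IsSplitAbelian a ∧ Module.finrank ℝ a = n}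

/-! ### Reductive and amenable reductive subalgebras -/

/-- A subalgebra is reductive in the ambient Lie algebra if its adjoint action on the ambient
Lie algebra is semisimple (every invariant subspace has an invariant complement). -/
def IsReductiveIn (l : LieSubalgebra ℝ L) : Prop :=
  ComplementedLattice (LieSubmodule ℝ l L)

/-- A subalgebra `l` is amenable reductive if it is reductive and if the Killing form of the
ambient Lie algebra is negative definite on `[l, l]`. -/
def IsAmenableReductive (l : LieSubalgebra ℝ L) : Prop :=
  IsReductiveIn l ∧
    ∀ Z ∈ Submodule.span ℝ {Z : L | ∃ X ∈ l, ∃ Y ∈ l, ⁅X, Y⁆ = Z}, Z ≠ 0 →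
      killingForm ℝ L Z Z < 0

/-! ### The adjoint group -/

/-- The exponential of an endomorphism of a finite-dimensional real vector space. -/
def expEnd {E : Type*} [AddCommGroup E] [Module ℝ E] [FiniteDimensional ℝ E]
    (f : Module.End ℝ E) : Module.End ℝ E :=
  Matrix.toLin (Module.finBasis ℝ E) (Module.finBasis ℝ E)
    (NormedSpace.exp (LinearMap.toMatrix (Module.finBasis ℝ E) (Module.finBasis ℝ E) f))

/-- The adjoint group of `L`, generated by the `exp (ad X)`. -/
def adjointGroup (L : Type*) [LieRing L] [LieAlgebra ℝ L] [FiniteDimensional ℝ L] :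
    Subgroup (L ≃ₗ[ℝ] L) :=
  Subgroup.closure {g | ∃ X : L, (g : L →ₗ[ℝ] L) = expEnd (LieAlgebra.ad ℝ L X)}

/-- Two subalgebras are conjugate if an element of the adjoint group maps one onto the other. -/
def AreConjugate [FiniteDimensional ℝ L] (k l : LieSubalgebra ℝ L) : Prop :=
  ∃ g ∈ adjointGroup L, k.toSubmodule.map (g : L →ₗ[ℝ] L) = l.toSubmodule

end Algebra

/-! ### Zariski open subsets -/

/-- The Zariski open subsets of a finite-dimensional real vector space: complements of
common zero sets of families of polynomials in the coordinates. -/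
def IsZariskiOpen {V : Type*} [AddCommGroup V] [Module ℝ V] [FiniteDimensional ℝ V]
    (U : Set V) : Prop :=
  ∃ P : Set (MvPolynomial (Fin (Module.finrank ℝ V)) ℝ),
    U = {v | ∃ p ∈ P, MvPolynomial.eval (fun i => (Module.finBasis ℝ V).repr v i) p ≠ 0}

/-! ### Stabilizers -/

section Rep

variable (L V : Type*) [LieRing L] [LieAlgebra ℝ L]

/-- The stabilizer of a vector in a representation. -/
def stab {V : Type*} [AddCommGroup V] [Module ℝ V] [LieRingModule L V] [LieModule ℝ L V]
    (v : V) : LieSubalgebra ℝ L where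
  carrier := {X | ⁅X, v⁆ = 0}
  add_mem' := by
    intro X Y (hX : ⁅X, v⁆ = 0) (hY : ⁅Y, v⁆ = 0)
    change ⁅X + Y, v⁆ = 0
    rw [add_lie, hX, hY, add_zero]
  zero_mem' := zero_lie v
  smul_mem' := by
    intro c X (hX : ⁅X, v⁆ = 0)
    change ⁅c • X, v⁆ = 0
    rw [smul_lie, hX, smul_zero]
  lie_mem' := by
    intro X Y (hX : ⁅X, v⁆ = 0) (hY : ⁅Y, v⁆ = 0)
    change ⁅⁅X, Y⁆, v⁆ = 0
    rw [lie_lie, hX, hY, lie_zero, lie_zero, sub_zero]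

/-- A representation is orthogonal if it preserves a nondegenerate symmetric bilinear form. -/
def IsOrthogonalRep [AddCommGroup V] [Module ℝ V] [LieRingModule L V] [LieModule ℝ L V] :
    Prop :=
  ∃ B : LinearMap.BilinForm ℝ V, B.Nondegenerate ∧ B.IsSymm ∧ B.lieInvariant L

/-- `V` has amenable reductive generic stabilizer. -/
def HasAmGS [NormedAddCommGroup V] [NormedSpace ℝ V] [LieRingModule L V] [LieModule ℝ L V] :
    Prop :=
  Dense {v : V | IsAmenableReductive (stab L v)}

variable [FiniteDimensional ℝ L] [AddCommGroup V] [Module ℝ V] [FiniteDimensional ℝ V]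
  [LieRingModule L V] [LieModule ℝ L V]

/-- The vectors whose stabilizer is conjugate to a member of the family `S` contain a
non-empty Zariski open set. -/
def CoversGenerically (S : Set (LieSubalgebra ℝ L)) : Prop :=
  ∃ U : Set V, IsZariskiOpen U ∧ U.Nonempty ∧
    ∀ v ∈ U, ∃ m ∈ S, AreConjugate (stab L v) m

/-- `m` is a generic stabilizer of `V`: it is a member of a finite family of reductive
subalgebras such that the vectors with stabilizer conjugate to a member of the family contain
a non-empty Zariski open set, and such that no member can be removed from the family. -/
def IsGenericStabilizer (m : LieSubalgebra ℝ L) : Prop :=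
  ∃ S : Set (LieSubalgebra ℝ L), S.Finite ∧ (∀ k ∈ S, IsReductiveIn k) ∧
    CoversGenerically L V S ∧ (∀ k ∈ S, ¬ CoversGenerically L V (S \ {k})) ∧ m ∈ S

end Rep

end

end LieRep

namespace LieRep

noncomputable section

set_option linter.unusedSectionVars false

open Module Module.End

/-! ### Functional calculus on generalized eigenspaces -/

section SpectralMap

variable {W W' : Type*} [AddCommGroup W] [Module ℂ W] [FiniteDimensional ℂ W]
  [AddCommGroup W'] [Module ℂ W'] [FiniteDimensional ℂ W']

/-! Let B be an invariant form on V and κ the Killing form of 𝔥. The whole argument takes place at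
vectors v whose orbit has maximal dimension r and on whose stabilizer κ is nondegenerate. Such
vectors contain the set where one nonzero polynomial does not vanish (`exists_generic_polynomial`),
so they are dense.

If 𝔥v has maximal dimension, then 𝔥_v acts trivially on V/𝔥v, since otherwise some perturbation v +
tw would have a larger orbit. As 𝔥v ≅ 𝔥/𝔥_v, the characteristic polynomials of X ∈ 𝔥_v satisfy χ_V ·
χ_{𝔥_v} = χ_𝔥 · T^(dim V − r). Hence the sum of |Re λ| over the spectrum of X on 𝔥_v is 2ρ_𝔥(X) −
2ρ_V(X) (`charpoly_stab`, `absReRoots_stab`).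

Part 1. Every X ∈ 𝔥 has the same ρ-values as some element of 𝔞 (`exists_mem_rho_eq`), so ρ_𝔥 ≤ ρ_V
holds on all of 𝔥. The sum above is then zero and 𝔥_v has imaginary spectrum on itself. Since 𝔥_v
also contains the Jordan components of its elements and carries a nondegenerate κ, it is amenable
reductive (`IsAnisotropic.isAmenableReductive`).

Part 2. As 𝔪 cannot be removed from its family, some w in the good open set has stabilizer conjugate
to 𝔪; by the rank hypothesis 𝔥_w contains a maximal split abelian 𝔟. Under AmGS, w is a limit of
vectors with amenable reductive stabilizers. Those have imaginary spectrum, which gives the closed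
condition |ν|^d ≤ |χ(ν)| for real ν, and this survives the limit (`eq_zero_of_mem_closure`). So 𝔟
centralizes 𝔥_w, the sum vanishes on 𝔟, and ρ_𝔥 = ρ_V on 𝔟, hence on 𝔞 by `exists_mem_rho_eq`.

Generic nondegeneracy rests on the operator φ_v of 𝔥 with κ(φ_v X, Y) = B(Xv, Yv). If φ_v² has rank
r, its kernel is 𝔥_v and κ is nondegenerate on 𝔥_v. Rank at least r is the nonvanishing of a minor,
so one complex vector suffices. A compact conjugation θ of 𝔥_ℂ, built on Chevalley generators, has a
compatible conjugation c of V_ℂ with Re B(v, cv) > 0. The vectors fixed by c form a real form, so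
one of them has an r-dimensional orbit, and there positivity gives ker φ² = stabilizer. The
conjugation c is the sign of Re B relative to an inner product invariant under the compact form;
that inner product comes from a Perron eigenvector of a positive operator on the cone of
semidefinite forms, without integration over a group. -/

open Classical in
theorem isInternal_maxGenEigenspace (T : End ℂ W) :
    DirectSum.IsInternal (fun μ : ℂ => T.maxGenEigenspace μ) :=
  DirectSum.isInternal_submodule_of_iSupIndep_of_iSup_eq_top T.independent_maxGenEigenspace
    T.iSup_maxGenEigenspace_eq_top

open Classical in
theorem bijective_coeLinearMap_maxGenEigenspace (T : End ℂ W) :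
    Function.Bijective (DirectSum.coeLinearMap fun μ : ℂ => T.maxGenEigenspace μ) :=
  isInternal_maxGenEigenspace T

open Classical in
/-- The operator acting as multiplication by `f μ` on the generalized `μ`-eigenspace of `T`. -/
def spectralMap (f : ℂ → ℂ) (T : End ℂ W) : End ℂ W :=
  (DirectSum.toModule ℂ ℂ W fun μ => f μ • (T.maxGenEigenspace μ).subtype) ∘ₗ
    (LinearEquiv.ofBijective _ (bijective_coeLinearMap_maxGenEigenspace T)).symm.toLinearMap

theorem spectralMap_apply (f : ℂ → ℂ) {T : End ℂ W} {μ : ℂ} {x : W}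
    (hx : x ∈ T.maxGenEigenspace μ) : spectralMap f T x = f μ • x := by
  classical
  have h : (LinearEquiv.ofBijective _ (bijective_coeLinearMap_maxGenEigenspace T)).symm x =
      DirectSum.lof ℂ ℂ (fun μ : ℂ => T.maxGenEigenspace μ) μ ⟨x, hx⟩ := by
    rw [LinearEquiv.symm_apply_eq]
    exact (DirectSum.coeLinearMap_lof (fun μ : ℂ => T.maxGenEigenspace μ) μ ⟨x, hx⟩).symm
  simp [spectralMap, h]

theorem induction_maxGenEigenspace (T : End ℂ W) {p : W → Prop}
    (h : ∀ μ, ∀ x ∈ T.maxGenEigenspace μ, p x) (h0 : p 0) (hadd : ∀ x y, p x → p y → p (x + y))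
    (x : W) : p x := by
  have hx : x ∈ ⨆ μ, T.maxGenEigenspace μ := by
    rw [T.iSup_maxGenEigenspace_eq_top]; trivial
  exact Submodule.iSup_induction _ (motive := p) hx h h0 hadd

theorem eq_spectralMap_of_forall (f : ℂ → ℂ) {T S : End ℂ W}
    (h : ∀ μ, ∀ x ∈ T.maxGenEigenspace μ, S x = f μ • x) : S = spectralMap f T := by
  ext x
  refine induction_maxGenEigenspace T (p := fun x => S x = spectralMap f T x)
    (fun μ x hx => ?_) (by simp) (fun x y hx hy => by rw [map_add, map_add, hx, hy]) x
  rw [h μ x hx, spectralMap_apply f hx]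

theorem map_mem_maxGenEigenspace {T : End ℂ W} {T' : End ℂ W'} (A : W →ₗ[ℂ] W')
    (h : ∀ x, A (T x) = T' (A x)) {μ : ℂ} {x : W} (hx : x ∈ T.maxGenEigenspace μ) :
    A x ∈ T'.maxGenEigenspace μ := by
  rw [mem_maxGenEigenspace] at hx ⊢
  obtain ⟨k, hk⟩ := hx
  refine ⟨k, ?_⟩
  have : ∀ (k : ℕ) (x : W), ((T' - μ • (1 : End ℂ W')) ^ k) (A x) =
      A (((T - μ • (1 : End ℂ W)) ^ k) x) := by
    intro k
    induction k with
    | zero => simp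
    | succ k ih =>
      intro x
      rw [pow_succ, pow_succ, Module.End.mul_apply, Module.End.mul_apply, ← ih]
      congr 1
      simp [h]
  rw [this, hk, map_zero]

/-- Naturality of `spectralMap`. -/
theorem spectralMap_comm (f : ℂ → ℂ) {T : End ℂ W} {T' : End ℂ W'} (A : W →ₗ[ℂ] W')
    (h : ∀ x, A (T x) = T' (A x)) (x : W) :
    A (spectralMap f T x) = spectralMap f T' (A x) := by
  refine induction_maxGenEigenspace T
    (p := fun x => A (spectralMap f T x) = spectralMap f T' (A x))
    (fun μ x hx => ?_) (by simp) (fun x y hx hy => by simp [hx, hy]) x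
  rw [spectralMap_apply f hx, spectralMap_apply f (map_mem_maxGenEigenspace A h hx), map_smul]

theorem mapsTo_spectralMap (f : ℂ → ℂ) {T : End ℂ W} (p : Submodule ℂ W)
    (hp : ∀ x ∈ p, T x ∈ p) : ∀ x ∈ p, spectralMap f T x ∈ p := by
  intro x hx
  have := spectralMap_comm f (T := T.restrict hp) (T' := T) p.subtype (fun _ => rfl) ⟨x, hx⟩
  simp only [Submodule.subtype_apply] at this
  rw [← this]
  exact Subtype.prop _

theorem maxGenEigenspace_le_spectralMap (f : ℂ → ℂ) (T : End ℂ W) (μ : ℂ) :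
    T.maxGenEigenspace μ ≤ (spectralMap f T).maxGenEigenspace (f μ) := by
  intro x hx
  apply Module.End.eigenspace_le_maxGenEigenspace
  rw [Module.End.mem_eigenspace_iff]
  exact spectralMap_apply f hx

theorem spectralMap_spectralMap (f g : ℂ → ℂ) (T : End ℂ W) :
    spectralMap g (spectralMap f T) = spectralMap (g ∘ f) T :=
  eq_spectralMap_of_forall _ fun μ _ hx =>
    spectralMap_apply g (maxGenEigenspace_le_spectralMap f T μ hx)

theorem spectralMap_mul (f g : ℂ → ℂ) (T : End ℂ W) :
    spectralMap f T * spectralMap g T = spectralMap (fun z => f z * g z) T :=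
  eq_spectralMap_of_forall _ fun μ x hx => by
    rw [Module.End.mul_apply, spectralMap_apply g hx, map_smul, spectralMap_apply f hx,
      smul_smul, mul_comm]

theorem spectralMap_neg (f : ℂ → ℂ) (T : End ℂ W) :
    spectralMap f (-T) = spectralMap (fun z => f (-z)) T := by
  refine eq_spectralMap_of_forall _ fun μ x hx => spectralMap_apply f ?_
  rw [mem_maxGenEigenspace] at hx ⊢
  obtain ⟨k, hk⟩ := hx
  refine ⟨k, ?_⟩
  rw [show (-T - -μ • 1 : End ℂ W) = (-1 : ℂ) • (T - μ • 1) by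
    rw [neg_one_smul, neg_sub, neg_smul]; abel, smul_pow]
  simp [hk]

theorem isNilpotent_sub_spectralMap (T : End ℂ W) : IsNilpotent (T - spectralMap id T) := by
  refine ⟨finrank ℂ W, ?_⟩
  ext x
  refine induction_maxGenEigenspace T
    (p := fun x => ((T - spectralMap id T) ^ finrank ℂ W) x = (0 : End ℂ W) x)
    (fun μ x hx => ?_) (by simp) (fun x y hx hy => by simp_all) x
  have h1 : ∀ k, ∀ y ∈ T.maxGenEigenspace μ,
      ((T - spectralMap id T) ^ k) y = ((T - μ • 1) ^ k) y := by
    intro k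
    induction k with
    | zero => simp
    | succ k ih =>
      intro y hy
      have h2 : (T - spectralMap id T) y = (T - μ • 1) y := by
        simp [spectralMap_apply id hy]
      rw [pow_succ, pow_succ, Module.End.mul_apply, Module.End.mul_apply, h2, ih]
      exact Module.End.mapsTo_maxGenEigenspace_of_comm
        ((Commute.refl T).sub_right ((Commute.one_right T).smul_right μ)) μ hy
  rw [h1 _ x hx]
  rw [maxGenEigenspace_eq_genEigenspace_finrank, Module.End.mem_genEigenspace_nat] at hx
  simpa using hx

theorem commute_spectralMap_of_commute (f : ℂ → ℂ) {T A : End ℂ W} (h : Commute A T) :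
    Commute A (spectralMap f T) := by
  ext x
  exact spectralMap_comm f A (fun x => LinearMap.congr_fun h.eq x) x

theorem trace_spectralMap (f : ℂ → ℂ) (T : End ℂ W) :
    LinearMap.trace ℂ W (spectralMap f T) = (T.charpoly.roots.map f).sum := by
  classical
  have h_fin : {μ | T.maxGenEigenspace μ ≠ ⊥}.Finite :=
    WellFoundedGT.finite_ne_bot_of_iSupIndep T.independent_maxGenEigenspace
  have hm : ∀ μ, Set.MapsTo (spectralMap f T) (T.maxGenEigenspace μ) (T.maxGenEigenspace μ) :=
    fun μ x hx => by
      rw [spectralMap_apply f hx]; exact Submodule.smul_mem _ _ hx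
  rw [LinearMap.trace_eq_sum_trace_restrict' (isInternal_maxGenEigenspace T) h_fin hm]
  have h1 : ∀ μ, LinearMap.trace ℂ _ ((spectralMap f T).restrict (hm μ)) =
      T.charpoly.rootMultiplicity μ * f μ := by
    intro μ
    have : (spectralMap f T).restrict (hm μ) = f μ • LinearMap.id := by
      ext ⟨x, hx⟩
      exact spectralMap_apply f hx
    rw [this, map_smul, LinearMap.trace_id, LinearMap.finrank_maxGenEigenspace_eq, smul_eq_mul, mul_comm]
  simp_rw [h1]
  rw [Finset.sum_multiset_map_count]
  have hmem : ∀ μ, μ ∈ h_fin.toFinset ↔ μ ∈ T.charpoly.roots.toFinset := by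
    intro μ
    rw [Set.Finite.mem_toFinset, Multiset.mem_toFinset, Set.mem_ofPred_eq, ne_eq,
      ← Submodule.finrank_eq_zero, LinearMap.finrank_maxGenEigenspace_eq, ← Polynomial.count_roots,
      Multiset.count_eq_zero, not_not]
  rw [Finset.ext hmem]
  refine Finset.sum_congr rfl fun μ _ => ?_
  rw [nsmul_eq_mul, Polynomial.count_roots]

/-- `T` differs from its semisimple part `spectralMap id T` by a nilpotent commuting with
`spectralMap f T`, and this contributes nothing to the trace. -/
theorem trace_spectralMap_mul (f : ℂ → ℂ) (T : End ℂ W) :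
    LinearMap.trace ℂ W (spectralMap f T * T) = (T.charpoly.roots.map fun z => f z * z).sum := by
  have h : spectralMap f T * T = spectralMap (fun z => f z * z) T +
      spectralMap f T * (T - spectralMap id T) := by
    rw [mul_sub, spectralMap_mul]; simp
  have hc : Commute (spectralMap f T) (T - spectralMap id T) :=
    ((commute_spectralMap_of_commute f (Commute.refl T)).symm).sub_right
      (by
        show spectralMap f T * spectralMap id T = spectralMap id T * spectralMap f T
        rw [spectralMap_mul, spectralMap_mul]; congr 1; ext z; ring)
  rw [h, map_add, trace_spectralMap,
    (LinearMap.isNilpotent_trace_of_isNilpotent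
      (hc.isNilpotent_mul_left (isNilpotent_sub_spectralMap T))).eq_zero, add_zero]

end SpectralMap

/-! ### The function `ρ` in terms of the roots of the characteristic polynomial -/

/-- The sum of the absolute values of the real parts of the complex roots. -/
def absReRoots (p : Polynomial ℝ) : ℝ :=
  ((p.map (algebraMap ℝ ℂ)).roots.map fun z => |z.re|).sum

theorem absReRoots_mul {p q : Polynomial ℝ} (hp : p ≠ 0) (hq : q ≠ 0) :
    absReRoots (p * q) = absReRoots p + absReRoots q := by
  rw [absReRoots, Polynomial.map_mul, Polynomial.roots_mul, Multiset.map_add, Multiset.sum_add]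
  · rfl
  · rw [← Polynomial.map_mul]
    exact (Polynomial.map_ne_zero_iff (algebraMap ℝ ℂ).injective).2 (mul_ne_zero hp hq)

theorem absReRoots_nonneg (p : Polynomial ℝ) : 0 ≤ absReRoots p :=
  Multiset.sum_nonneg fun x hx => by
    obtain ⟨z, -, rfl⟩ := Multiset.mem_map.1 hx
    exact abs_nonneg _

theorem absReRoots_X_pow (k : ℕ) : absReRoots (Polynomial.X ^ k) = 0 := by
  rw [absReRoots, Polynomial.map_pow, Polynomial.map_X, Polynomial.roots_X_pow,
    Multiset.map_nsmul, Multiset.sum_nsmul]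
  simp

theorem absReRoots_eq_zero_iff {p : Polynomial ℝ} :
    absReRoots p = 0 ↔ ∀ z ∈ (p.map (algebraMap ℝ ℂ)).roots, z.re = 0 := by
  rw [absReRoots]
  induction (p.map (algebraMap ℝ ℂ)).roots using Multiset.induction_on with
  | empty => simp
  | cons a s ih =>
    have h : 0 ≤ (s.map fun z : ℂ => |z.re|).sum := Multiset.sum_nonneg fun x hx => by
      obtain ⟨z, -, rfl⟩ := Multiset.mem_map.1 hx
      exact abs_nonneg _
    rw [Multiset.map_cons, Multiset.sum_cons, add_eq_zero_iff_of_nonneg (abs_nonneg _) h, ih]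
    simp

theorem re_multiset_sum (s : Multiset ℂ) (f : ℂ → ℂ) :
    (s.map f).sum.re = (s.map fun z => (f z).re).sum := by
  induction s using Multiset.induction_on with
  | empty => simp
  | cons a s ih => simp [ih]

/-- The cut-off operator has its range in `posSpace`, so its trace can be taken there; on that
subspace it is the semisimple part of the operator, and the nilpotent part is traceless. -/
theorem posTrace_eq {V : Type*} [AddCommGroup V] [Module ℝ V] [FiniteDimensional ℝ V]
    (f : End ℝ V) :
    posTrace f = (LinearMap.trace ℂ _
      (spectralMap (fun z => if 0 < z.re then z else 0) (LinearMap.baseChange ℂ f))).re := by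
  set T := LinearMap.baseChange ℂ f
  set g : ℂ → ℂ := fun z => if 0 < z.re then z else 0
  have hS : ∀ x, spectralMap g T x ∈ posSpace T := by
    refine induction_maxGenEigenspace T (fun μ x hx => ?_) (by simp)
      (fun x y hx hy => by rw [map_add]; exact add_mem hx hy)
    rw [spectralMap_apply g hx]
    by_cases h : 0 < μ.re
    · exact Submodule.smul_mem _ _
        (Submodule.mem_iSup_of_mem (⟨μ, h⟩ : {μ : ℂ // 0 < μ.re}) hx)
    · simp [g, h]
  have hpos : ∀ x ∈ posSpace T, spectralMap g T x = spectralMap id T x := by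
    intro x hx
    refine Submodule.iSup_induction _
      (motive := fun x => spectralMap g T x = spectralMap id T x) hx
      (fun μ x hx => ?_) (by simp) (fun x y hx hy => by simp [hx, hy])
    rw [spectralMap_apply g hx, spectralMap_apply id hx]
    simp [g, μ.2]
  rw [posTrace, ← LinearMap.trace_restrict_eq_of_forall_mem (posSpace T) (spectralMap g T) hS]
  congr 1
  have hid := mapsTo_spectralMap id (posSpace T) (mapsTo_posSpace T)
  have h1 : (spectralMap g T).restrict (fun x _ => hS x) = (spectralMap id T).restrict hid := by
    ext ⟨x, hx⟩
    simp [hpos x hx]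
  have h2 : T.restrict (mapsTo_posSpace T) = (spectralMap id T).restrict hid +
      (T - spectralMap id T).restrict (fun x hx => sub_mem (mapsTo_posSpace T x hx) (hid x hx)) := by
    ext ⟨x, hx⟩
    simp
  have h3 := (LinearMap.isNilpotent_trace_of_isNilpotent (Module.End.isNilpotent.restrict
    (fun x hx => sub_mem (mapsTo_posSpace T x hx) (hid x hx))
    (isNilpotent_sub_spectralMap T))).eq_zero
  rw [h1, h2, map_add]
  exact (add_eq_left).2 h3

/-- `ρ_V(Y)` is half the sum of the `|Re λ|`, for `λ` in the roots of the characteristic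
polynomial of `Y` on `V`. -/
theorem rho_eq {L V : Type*} [LieRing L] [LieAlgebra ℝ L] [AddCommGroup V] [Module ℝ V]
    [FiniteDimensional ℝ V] [LieRingModule L V] [LieModule ℝ L V] (Y : L) :
    rho L V Y = absReRoots (LieModule.toEnd ℝ L V Y).charpoly / 2 := by
  rw [rho, posTrace_eq, posTrace_eq, map_neg, LinearMap.baseChange_neg, spectralMap_neg,
    trace_spectralMap, trace_spectralMap, re_multiset_sum, re_multiset_sum,
    ← Multiset.sum_map_add, absReRoots, LinearMap.charpoly_baseChange]
  congr 3
  funext z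
  rcases lt_trichotomy 0 z.re with h | h | h
  · simp [h, abs_of_pos h, not_lt.2 h.le]
  · simp [← h]
  · simp [h, abs_of_neg h, not_lt.2 h.le]

/-! ### Characteristic polynomials and invariant subspaces -/

/-- Over an infinite field it is enough to compare values at each `z`, where the identity is the
multiplicativity of the determinant of `z - f` along `p`. -/
theorem charpoly_eq_restrict_mul_mapQ {K W : Type*} [Field K] [Infinite K] [AddCommGroup W]
    [Module K W] [FiniteDimensional K W] (f : End K W) (p : Submodule K W)
    (hp : ∀ x ∈ p, f x ∈ p) :
    f.charpoly = (f.restrict hp).charpoly * LinearMap.charpoly (p.mapQ p f hp) := by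
  refine Polynomial.funext fun z => ?_
  rw [Polynomial.eval_mul, LinearMap.eval_charpoly, LinearMap.eval_charpoly,
    LinearMap.eval_charpoly]
  have hz : ∀ x ∈ p, (algebraMap K (End K W) z - f) x ∈ p := fun x hx =>
    sub_mem (p.smul_mem z hx) (hp x hx)
  have h1 : p.mapQ p (algebraMap K (End K W) z - f) hz =
      algebraMap K (End K (W ⧸ p)) z - p.mapQ p f hp := by
    refine LinearMap.ext fun x => ?_
    obtain ⟨x, rfl⟩ := Submodule.mkQ_surjective p x
    simp
  have h2 : (algebraMap K (End K W) z - f).restrict hz =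
      algebraMap K (End K p) z - f.restrict hp := by
    ext x
    simp
  rw [LinearMap.det_eq_det_mul_det p _ hz, h1, h2]

theorem charpoly_conj' {K W W' : Type*} [Field K] [AddCommGroup W] [Module K W]
    [FiniteDimensional K W] [AddCommGroup W'] [Module K W'] [FiniteDimensional K W']
    (e : W ≃ₗ[K] W') {f : End K W} {g : End K W'} (h : ∀ x, e (f x) = g (e x)) :
    f.charpoly = g.charpoly := by
  rw [← LinearEquiv.charpoly_conj e f]
  congr 1
  ext x
  simp [LinearEquiv.conj_apply, h]

/-! ### Complete reducibility -/

section Weyl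

attribute [local instance 100] LieRing.ofAssociativeRing

variable {K L : Type*} [Field K] [LieRing L] [LieAlgebra K L]

section actSpan

variable {M N : Type*} [AddCommGroup M] [Module K M] [LieRingModule L M] [LieModule K L M]
  [AddCommGroup N] [Module K N] [LieRingModule L N] [LieModule K L N]

variable (K L M) in
/-- The span of all `⁅x, m⁆`. -/
def actSpan : Submodule K M :=
  Submodule.span K {z | ∃ (x : L) (m : M), ⁅x, m⁆ = z}

theorem lie_mem_actSpan (x : L) (m : M) : ⁅x, m⁆ ∈ actSpan K L M :=
  Submodule.subset_span ⟨x, m, rfl⟩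

theorem map_mem_actSpan (f : M →ₗ[K] N) (hf : ∀ (x : L) m, f ⁅x, m⁆ = ⁅x, f m⁆) {m : M}
    (hm : m ∈ actSpan K L M) : f m ∈ actSpan K L N := by
  have : actSpan K L M ≤ (actSpan K L N).comap f := by
    refine Submodule.span_le.2 ?_
    rintro _ ⟨x, m, rfl⟩
    change f _ ∈ actSpan K L N
    rw [hf]
    exact lie_mem_actSpan _ _
  exact this hm

end actSpan

variable [CharZero K] [FiniteDimensional K L]

/-- Cartan's criterion. The derived algebra acts nilpotently on `M`; as `M` is faithful, its
elements are then ad-nilpotent, and Engel's theorem makes the derived algebra nilpotent. -/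
theorem isSolvable_of_traceForm_eq_zero {M : Type*} [AddCommGroup M] [Module K M]
    [LieRingModule L M] [LieModule K L M] [FiniteDimensional K M] [LieModule.IsFaithful K L M]
    (h : LieModule.traceForm K L M = 0) : LieAlgebra.IsSolvable L := by
  have h1 := LieModule.isNilpotent_derivedSeries_of_traceForm_eq_zero h
  rw [LieModule.isNilpotent_iff_forall' (R := K)] at h1
  set D := LieAlgebra.derivedSeries K L 1
  have hD : LieRing.IsNilpotent D := by
    rw [LieAlgebra.isNilpotent_iff_forall (R := K)]
    intro x
    have h2 := LieAlgebra.ad_nilpotent_of_nilpotent (R := K) (h1 x)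
    obtain ⟨n, hn⟩ := h2
    refine ⟨n, ?_⟩
    ext y
    have key : ∀ k : ℕ, LieModule.toEnd K L M (((LieAlgebra.ad K D x) ^ k) y : D) =
        ((LieAlgebra.ad K (Module.End K M) (LieModule.toEnd K D M x)) ^ k)
          (LieModule.toEnd K L M y) := by
      intro k
      induction k with
      | zero => rfl
      | succ k ih =>
        rw [pow_succ', pow_succ', Module.End.mul_apply, Module.End.mul_apply, ← ih]
        exact LieHom.map_lie _ _ _
    have h3 := key n
    rw [hn] at h3
    rw [LinearMap.zero_apply] at h3
    have := (LieModule.toEnd_eq_zero_iff K L M).1 h3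
    simpa using this
  obtain ⟨k, hk⟩ := LieAlgebra.IsSolvable.solvable K D
  rw [LieIdeal.derivedSeries_eq_bot_iff] at hk
  refine LieAlgebra.IsSolvable.mk (R := K) (k := k + 1) ?_
  rw [LieAlgebra.derivedSeries_def, LieAlgebra.derivedSeriesOfIdeal_add]
  exact hk

variable [LieAlgebra.IsKilling K L]

section

variable {M : Type*} [AddCommGroup M] [Module K M]
    [LieRingModule L M] [LieModule K L M] [FiniteDimensional K M]

/-- The radical of the trace form on this ideal is again an ideal. It acts faithfully with zero
trace form, so it is solvable by Cartan's criterion and therefore zero. -/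
theorem traceForm_eq_zero_of_ideal (x : L) (hx : x ∈ (LieModule.ker K L M).killingCompl)
    (h : ∀ y ∈ (LieModule.ker K L M).killingCompl, LieModule.traceForm K L M x y = 0) :
    x = 0 := by
  set I := (LieModule.ker K L M).killingCompl
  have hc := LieIdeal.isCompl_killingCompl (LieModule.ker K L M)
  let N : LieIdeal K L :=
    { I.toSubmodule ⊓ (LinearMap.ker ((LieModule.traceForm K L M).domRestrict₂ I.toSubmodule)) with
      lie_mem := by
        intro z x hx
        have hx1 : x ∈ I := hx.1
        have hx2 : (LieModule.traceForm K L M).domRestrict₂ I.toSubmodule x = 0 := hx.2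
        refine ⟨I.lie_mem hx1, ?_⟩
        change (LieModule.traceForm K L M).domRestrict₂ I.toSubmodule ⁅z, x⁆ = 0
        ext ⟨y, hy⟩
        have := LinearMap.congr_fun hx2 ⟨⁅z, y⁆, I.lie_mem hy⟩
        simp only [LinearMap.domRestrict₂_apply, LinearMap.zero_apply] at this ⊢
        rw [← lie_skew, map_neg, LinearMap.neg_apply, LieModule.traceForm_apply_lie_apply, this,
          neg_zero] }
  have hN : ∀ x, x ∈ N ↔ x ∈ I ∧ ∀ y ∈ I, LieModule.traceForm K L M x y = 0 := by
    intro x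
    constructor
    · rintro ⟨h1, h2⟩
      exact ⟨h1, fun y hy => LinearMap.congr_fun h2 ⟨y, hy⟩⟩
    · rintro ⟨h1, h2⟩
      exact ⟨h1, LinearMap.ext fun y => h2 y y.2⟩
  have hNI : N ≤ I := fun x hx => ((hN x).1 hx).1
  have hf : LieModule.IsFaithful K N M := by
    rw [LieModule.isFaithful_iff']
    intro x hx
    have : (x : L) ∈ LieModule.ker K L M ⊓ I := ⟨(LieModule.mem_ker K L M _).2 hx, hNI x.2⟩
    rw [hc.inf_eq_bot] at this
    exact Subtype.ext this
  have hs := isSolvable_of_traceForm_eq_zero (K := K) (L := N) (M := M) (by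
    ext x y
    exact ((hN x).1 x.2).2 y (hNI y.2))
  have hb := LieAlgebra.HasTrivialRadical.eq_bot_of_isSolvable N
  have : x ∈ N := (hN x).2 ⟨hx, h⟩
  rw [hb] at this
  exact this

/-- The Casimir operator of `I` commutes with `L`: invariance makes the matrices of `ad x` in the
two dual bases negative transposes of each other, so the correction terms cancel. -/
theorem sum_dual_commute {ι : Type*} [Fintype ι] [DecidableEq ι] (I : LieIdeal K L)
    (B : LinearMap.BilinForm K I)
    (hB : B.Nondegenerate) (hs : B.IsSymm) (hinv : ∀ (x : L) (y z : I), B ⁅x, y⁆ z = - B y ⁅x, z⁆)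
    (b : Basis ι K I) (x : L) (m : M) :
    ∑ i, ⁅x, ⁅(b i : L), ⁅(B.dualBasis hB b i : L), m⁆⁆⁆ =
      ∑ i, ⁅(b i : L), ⁅(B.dualBasis hB b i : L), ⁅x, m⁆⁆⁆ := by
  set d := B.dualBasis hB b
  have e1 : ∀ y : I, y = ∑ j, B y (d j) • b j := by
    intro y
    conv_lhs => rw [← b.sum_repr y]
    refine Finset.sum_congr rfl fun j _ => ?_
    congr 1
    have := LinearMap.BilinForm.dualBasis_repr_apply hB d y j
    rw [LinearMap.BilinForm.dualBasis_dualBasis hB hs] at this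
    exact this
  have e2 : ∀ y : I, y = ∑ j, B y (b j) • d j := by
    intro y
    conv_lhs => rw [← d.sum_repr y]
    exact Finset.sum_congr rfl fun j _ => by rw [LinearMap.BilinForm.dualBasis_repr_apply]
  have c1 : ∀ i, ⁅x, (b i : L)⁆ = ∑ j, B ⁅x, b i⁆ (d j) • (b j : L) := by
    intro i
    have := congrArg (Subtype.val) (e1 ⁅x, b i⁆)
    simpa using this
  have c2 : ∀ i, ⁅x, (d i : L)⁆ = ∑ j, B ⁅x, d i⁆ (b j) • (d j : L) := by
    intro i
    have := congrArg (Subtype.val) (e2 ⁅x, d i⁆)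
    simpa using this
  have : ∀ i, ⁅x, ⁅(b i : L), ⁅(d i : L), m⁆⁆⁆ = ⁅(b i : L), ⁅(d i : L), ⁅x, m⁆⁆⁆ +
      (⁅⁅x, (b i : L)⁆, ⁅(d i : L), m⁆⁆ + ⁅(b i : L), ⁅⁅x, (d i : L)⁆, m⁆⁆) := by
    intro i
    rw [leibniz_lie x (b i : L), leibniz_lie x (d i : L), lie_add]
    abel
  rw [Finset.sum_congr rfl fun i _ => this i, Finset.sum_add_distrib, Finset.sum_add_distrib,
    add_eq_left]
  simp only [c1, c2, sum_lie, lie_sum, smul_lie, lie_smul]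
  rw [Finset.sum_comm, ← Finset.sum_add_distrib]
  refine Finset.sum_eq_zero fun i _ => ?_
  rw [← Finset.sum_add_distrib]
  refine Finset.sum_eq_zero fun j _ => ?_
  have := hs.eq (b j) ⁅x, d i⁆
  rw [← add_smul, hinv, this, neg_add_cancel, zero_smul]

end

/-- A representation of a Killing Lie algebra in characteristic zero is the direct sum of its
invariants and the span of all `⁅x, m⁆`. -/
theorem isCompl_maxTrivSubmodule_actSpan (M : Type*) [AddCommGroup M] [Module K M]
    [LieRingModule L M] [LieModule K L M] [FiniteDimensional K M] :
    IsCompl (LieModule.maxTrivSubmodule K L M).toSubmodule (actSpan K L M) := by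
  induction hn : finrank K M using Nat.strong_induction_on generalizing M with
  | _ n ih =>
  subst hn
  by_cases ht : LieModule.ker K L M = ⊤
  · have h1 : ∀ (x : L) (m : M), ⁅x, m⁆ = 0 := fun x =>
      (LieModule.mem_ker K L M x).1 (ht ▸ LieSubmodule.mem_top x)
    have h2 : (LieModule.maxTrivSubmodule K L M).toSubmodule = ⊤ := by
      rw [eq_top_iff]
      exact fun m _ x => h1 x m
    have h3 : actSpan K L M = ⊥ := by
      rw [actSpan, Submodule.span_eq_bot]
      rintro _ ⟨x, m, rfl⟩
      exact h1 x m
    rw [h2, h3]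
    exact isCompl_top_bot
  -- The Casimir operator `C` of the ideal complementary to the kernel, formed with the trace form
  -- of `M`, has trace `dim I ≠ 0` and is not nilpotent. Its Fitting decomposition leaves a proper
  -- submodule for the induction and a range that consists of sums of brackets.
  set I := (LieModule.ker K L M).killingCompl with hI
  let B : LinearMap.BilinForm K I := (LieModule.traceForm K L M).restrict I.toSubmodule
  have hs : B.IsSymm := ⟨fun x y => LieModule.traceForm_comm K L M x y⟩
  have hB : B.Nondegenerate := by
    refine (LinearMap.IsRefl.nondegenerate_iff_separatingLeft hs.isRefl).2 ?_
    intro x hx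
    exact Subtype.ext (traceForm_eq_zero_of_ideal (K := K) (M := M) (x : L) x.2
      fun y hy => hx ⟨y, hy⟩)
  have hinv : ∀ (x : L) (y z : I), B ⁅x, y⁆ z = - B y ⁅x, z⁆ := by
    intro x y z
    change LieModule.traceForm K L M ⁅x, (y : L)⁆ z = - LieModule.traceForm K L M y ⁅x, (z : L)⁆
    rw [← lie_skew, map_neg, LinearMap.neg_apply, LieModule.traceForm_apply_lie_apply]
  let b := finBasis K I
  let d := B.dualBasis hB b
  let C : Module.End K M :=
    ∑ i, LieModule.toEnd K L M (b i) * LieModule.toEnd K L M (d i)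
  have hCa : ∀ m, C m = ∑ i, ⁅(b i : L), ⁅(d i : L), m⁆⁆ := by
    intro m
    simp [C, LinearMap.sum_apply]
  have hC : ∀ (x : L) m, C ⁅x, m⁆ = ⁅x, C m⁆ := by
    intro x m
    rw [hCa, hCa, lie_sum]
    exact (sum_dual_commute I B hB hs hinv b x m).symm
  have hCn : ¬ IsNilpotent C := by
    intro h
    have h1 := (LinearMap.isNilpotent_trace_of_isNilpotent h).eq_zero
    have h2 : LinearMap.trace K M C = finrank K I := by
      simp only [C, map_sum]
      have : ∀ i, LinearMap.trace K M (LieModule.toEnd K L M (b i) * LieModule.toEnd K L M (d i)) =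
          1 := by
        intro i
        have := LinearMap.BilinForm.apply_dualBasis_right hB hs b i i
        rwa [if_pos rfl] at this
      rw [Finset.sum_congr rfl fun i _ => this i]
      simp
    rw [h1] at h2
    have h3 : finrank K I = 0 := by exact_mod_cast h2.symm
    have h4 : I = ⊥ := by
      have := Submodule.finrank_eq_zero.1 h3
      exact (LieSubmodule.toSubmodule_eq_bot I).1 this
    have hc := (LieIdeal.isCompl_killingCompl (LieModule.ker K L M)).sup_eq_top
    rw [← hI, h4, sup_bot_eq] at hc
    exact ht hc
  obtain ⟨k, hk⟩ := (LinearMap.eventually_isCompl_ker_pow_range_pow C).exists_forall_of_atTop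
  have hfit := hk (k + 1) (Nat.le_succ k)
  have hCp : ∀ (j : ℕ) (x : L) m, (C ^ j) ⁅x, m⁆ = ⁅x, (C ^ j) m⁆ := by
    intro j x m
    induction j with
    | zero => rfl
    | succ j ih => rw [pow_succ', Module.End.mul_apply, Module.End.mul_apply, ih, hC]
  let N : LieSubmodule K L M :=
    { LinearMap.ker (C ^ (k + 1)) with
      lie_mem := by
        intro x m hm
        change (C ^ (k + 1)) _ = 0
        rw [hCp, show (C ^ (k + 1)) m = 0 from hm, lie_zero] }
  have hNt : (N.toSubmodule) < ⊤ := by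
    rw [lt_top_iff_ne_top]
    intro h
    exact hCn ⟨k + 1, LinearMap.ker_eq_top.1 h⟩
  have ihN := ih (finrank K N) (by
    have := Submodule.finrank_lt_finrank_of_lt hNt
    rwa [finrank_top] at this) N rfl
  have hrange : LinearMap.range (C ^ (k + 1)) ≤ actSpan K L M := by
    rintro _ ⟨m, rfl⟩
    rw [pow_succ', Module.End.mul_apply, hCa]
    exact Submodule.sum_mem _ fun i _ => lie_mem_actSpan _ _
  let π : M →ₗ[K] N := Submodule.projectionOnto _ _ hfit
  have hπ1 : ∀ m : N, π m = m := fun m => Submodule.projectionOnto_apply_left hfit m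
  have hπ2 : ∀ m ∈ LinearMap.range (C ^ (k + 1)), π m = 0 := fun m hm =>
    (Submodule.projectionOnto_apply_eq_zero_iff hfit).2 hm
  have hπ : ∀ (x : L) m, π ⁅x, m⁆ = ⁅x, π m⁆ := by
    intro x m
    have hm : m ∈ LinearMap.ker (C ^ (k + 1)) ⊔ LinearMap.range (C ^ (k + 1)) := by
      rw [hfit.sup_eq_top]; trivial
    obtain ⟨u, hu, v, hv, rfl⟩ := Submodule.mem_sup.1 hm
    have hxv : ⁅x, v⁆ ∈ LinearMap.range (C ^ (k + 1)) := by
      obtain ⟨w, rfl⟩ := hv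
      exact ⟨⁅x, w⁆, hCp _ _ _⟩
    rw [lie_add, map_add, map_add, hπ2 _ hxv, hπ2 v hv, add_zero, add_zero]
    have h1 := hπ1 ⟨u, hu⟩
    have h2 := hπ1 ⟨⁅x, u⁆, N.lie_mem hu⟩
    simp only at h1 h2
    rw [h1, h2]
    rfl
  refine ⟨?_, ?_⟩
  · rw [Submodule.disjoint_def]
    intro m hm1 hm2
    have hmN : m ∈ N := by
      change (C ^ (k + 1)) m = 0
      rw [pow_succ, Module.End.mul_apply, hCa]
      have : ∀ x : L, ⁅x, m⁆ = 0 := hm1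
      simp [this]
    have h1 := map_mem_actSpan π hπ hm2
    rw [hπ1 ⟨m, hmN⟩] at h1
    have h2 := Submodule.disjoint_def.1 ihN.disjoint ⟨m, hmN⟩
      (fun x => Subtype.ext (hm1 x)) h1
    exact congrArg Subtype.val h2
  · rw [codisjoint_iff, eq_top_iff, ← hfit.sup_eq_top]
    refine sup_le ?_ (hrange.trans le_sup_right)
    intro m hm
    have h1 : (⟨m, hm⟩ : N) ∈ (LieModule.maxTrivSubmodule K L N).toSubmodule ⊔ actSpan K L N := by
      rw [ihN.sup_eq_top]; trivial
    obtain ⟨u, hu, v, hv, huv⟩ := Submodule.mem_sup.1 h1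
    have h2 : m = (u : M) + v := congrArg Subtype.val huv.symm
    rw [h2]
    refine Submodule.add_mem_sup (fun x => congrArg Subtype.val (hu x)) ?_
    exact map_mem_actSpan (N := M) (M := N) (N.incl : N →ₗ[K] M) (fun x m => rfl) hv

/-- **Weyl's theorem**: an invariant subspace is the image of an equivariant projection. -/
theorem exists_equivariant_projection {M : Type*} [AddCommGroup M] [Module K M]
    [LieRingModule L M] [LieModule K L M] [FiniteDimensional K M] (U : LieSubmodule K L M) :
    ∃ p : M →ₗ⁅K, L⁆ U, ∀ u : U, p u = u := by
  -- Restriction to `U` is equivariant. A linear retraction decomposes into an invariant map `g` and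
  -- a sum of brackets `v`; the restriction of `v` is both invariant and a sum of brackets, hence
  -- zero, so `g` is still a retraction.
  let Φ : (M →ₗ[K] U) →ₗ[K] (U →ₗ[K] U) := LinearMap.lcomp K U (U.incl : U →ₗ[K] M)
  have hΦ : ∀ (x : L) (f : M →ₗ[K] U), Φ ⁅x, f⁆ = ⁅x, Φ f⁆ := by
    intro x f
    ext u
    rfl
  obtain ⟨f, hf⟩ : ∃ f : M →ₗ[K] U, f ∘ₗ (U.incl : U →ₗ[K] M) = LinearMap.id :=
    LinearMap.exists_leftInverse_of_injective _
    (Submodule.ker_subtype _)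
  have hf' : Φ f = LinearMap.id := hf
  have h1 : f ∈ (LieModule.maxTrivSubmodule K L (M →ₗ[K] U)).toSubmodule ⊔ actSpan K L _ := by
    rw [(isCompl_maxTrivSubmodule_actSpan _).sup_eq_top]; trivial
  obtain ⟨g, hg, v, hv, rfl⟩ := Submodule.mem_sup.1 h1
  have h2 := map_mem_actSpan Φ hΦ hv
  have h3 : Φ v ∈ LieModule.maxTrivSubmodule K L (U →ₗ[K] U) := by
    have h4 : Φ v = LinearMap.id - Φ g := by rw [← hf', map_add]; abel
    rw [LieModule.mem_maxTrivSubmodule, h4]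
    intro x
    rw [lie_sub, ← hΦ, (LieModule.mem_maxTrivSubmodule K L _ g).1 hg, map_zero, sub_zero]
    ext u
    simp [LieHom.lie_apply]
  have h5 := Submodule.disjoint_def.1 (isCompl_maxTrivSubmodule_actSpan (K := K) (L := L)
    (U →ₗ[K] U)).disjoint _ h3 h2
  refine ⟨LieModule.maxTrivLinearMapEquivLieModuleHom (M := M) (N := U) ⟨g, hg⟩, fun u => ?_⟩
  rw [map_add, h5, add_zero] at hf'
  exact LinearMap.congr_fun hf' u

/-- Invariant subspaces have invariant complements. -/
theorem exists_isCompl_lieSubmodule {M : Type*} [AddCommGroup M] [Module K M]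
    [LieRingModule L M] [LieModule K L M] [FiniteDimensional K M] (U : LieSubmodule K L M) :
    ∃ U' : LieSubmodule K L M, IsCompl U U' := by
  obtain ⟨p, hp⟩ := exists_equivariant_projection U
  refine ⟨p.ker, ?_⟩
  rw [← LieSubmodule.isCompl_toSubmodule]
  have := LinearMap.isCompl_of_proj (p := U.toSubmodule) (f := (p : M →ₗ[K] U)) hp
  convert this
  ext m
  simp

end Weyl

/-! ### Inner derivations given by functional calculus -/

section Perfect

attribute [local instance 100] LieRing.ofAssociativeRing

variable {K L : Type*} [Field K] [CharZero K] [LieRing L] [LieAlgebra K L] [FiniteDimensional K L]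
  [LieAlgebra.IsKilling K L]

variable (K L) in
theorem actSpan_self_eq_top : actSpan K L L = ⊤ := by
  have h := isCompl_maxTrivSubmodule_actSpan (K := K) (L := L) L
  have h1 : LieModule.maxTrivSubmodule K L L = ⊥ := LieAlgebra.center_eq_bot (R := K) (L := L)
  rw [h1, LieSubmodule.bot_toSubmodule] at h
  exact eq_top_of_bot_isCompl h

theorem induction_lie {p : L → Prop} (h : ∀ x y : L, p ⁅x, y⁆) (h0 : p 0)
    (hadd : ∀ x y, p x → p y → p (x + y)) (hs : ∀ (c : K) x, p x → p (c • x)) (x : L) : p x := by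
  have hx : x ∈ actSpan K L L := by rw [actSpan_self_eq_top]; trivial
  refine Submodule.span_induction (p := fun x _ => p x) ?_ h0 (fun x y _ _ => hadd x y)
    (fun c x _ => hs c x) hx
  rintro _ ⟨x, y, rfl⟩
  exact h x y

theorem trace_toEnd_eq_zero {M : Type*} [AddCommGroup M] [Module K M]
    [LieRingModule L M] [LieModule K L M] (x : L) :
    LinearMap.trace K M (LieModule.toEnd K L M x) = 0 := by
  refine induction_lie (K := K) (p := fun x => LinearMap.trace K M (LieModule.toEnd K L M x) = 0)
    (fun x y => ?_) (by simp) (fun x y hx hy => by simp [hx, hy]) (fun c x hx => by simp [hx]) x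
  rw [LieHom.map_lie, Ring.lie_def, map_sub, LinearMap.trace_mul_comm, sub_self]

theorem eq_of_ad_eq (K : Type*) {L : Type*} [Field K] [CharZero K] [LieRing L] [LieAlgebra K L]
    [FiniteDimensional K L] [LieAlgebra.IsKilling K L] {x y : L} (h : ∀ z : L, ⁅x, z⁆ = ⁅y, z⁆) : x = y :=
  LieModule.ext_of_isFaithful (R := K) (M := L) h

end Perfect

section Complex

variable {L M : Type*} [LieRing L] [LieAlgebra ℂ L] [FiniteDimensional ℂ L]
  [AddCommGroup M] [Module ℂ M] [FiniteDimensional ℂ M] [LieRingModule L M] [LieModule ℂ L M]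

/-- Generalized eigenvalues add under the action, and an additive `f` turns this into a Leibniz
rule. This is why only additive functions are used on Lie algebra elements. -/
theorem spectralMap_lie (f : ℂ →+ ℂ) (x y : L) (m : M) :
    spectralMap f (LieModule.toEnd ℂ L M x) ⁅y, m⁆ =
      ⁅spectralMap f (LieModule.toEnd ℂ L L x) y, m⁆ +
        ⁅y, spectralMap f (LieModule.toEnd ℂ L M x) m⁆ := by
  refine induction_maxGenEigenspace (LieModule.toEnd ℂ L L x)
    (p := fun y => spectralMap f (LieModule.toEnd ℂ L M x) ⁅y, m⁆ =
      ⁅spectralMap f (LieModule.toEnd ℂ L L x) y, m⁆ +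
        ⁅y, spectralMap f (LieModule.toEnd ℂ L M x) m⁆) (fun μ y hy => ?_) (by simp)
    (fun y z hy hz => by rw [add_lie, map_add, hy, hz, map_add, add_lie, add_lie]; abel) y
  refine induction_maxGenEigenspace (LieModule.toEnd ℂ L M x)
    (p := fun m => spectralMap f (LieModule.toEnd ℂ L M x) ⁅y, m⁆ =
      ⁅spectralMap f (LieModule.toEnd ℂ L L x) y, m⁆ +
        ⁅y, spectralMap f (LieModule.toEnd ℂ L M x) m⁆) (fun ν m hm => ?_) (by simp)
    (fun y z hy hz => by rw [lie_add, map_add, hy, hz, map_add, lie_add, lie_add]; abel) m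
  rw [spectralMap_apply f hy, spectralMap_apply f hm,
    spectralMap_apply f (LieModule.lie_mem_maxGenEigenspace_toEnd hy hm), smul_lie, lie_smul,
    map_add, add_smul]

variable [LieAlgebra.IsKilling ℂ L]

/-- By the Leibniz rule the operator is a derivation, and derivations are inner. -/
theorem exists_toEnd_eq_spectralMap (f : ℂ →+ ℂ) (x : L) :
    ∃ H : L, LieModule.toEnd ℂ L L H = spectralMap f (LieModule.toEnd ℂ L L x) := by
  let D : LieDerivation ℂ L L :=
    { spectralMap f (LieModule.toEnd ℂ L L x) with
      leibniz' := by
        intro a b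
        change spectralMap f (LieModule.toEnd ℂ L L x) ⁅a, b⁆ = _
        rw [spectralMap_lie, ← lie_skew, add_comm, ← sub_eq_add_neg] }
  obtain ⟨H, hH⟩ := LieDerivation.IsKilling.exists_eq_ad D
  refine ⟨H, ?_⟩
  ext y
  have := LieDerivation.congr_fun hH y
  simpa using! this

/-- The difference `T` of the two operators commutes with `L` and has trace zero on every submodule,
because `L` is perfect. Its eigenspaces are submodules, so 0 is its only eigenvalue. A nonzero
invariant complement of `ker T` would contain an eigenvector for 0, so `T = 0`. -/
theorem toEnd_eq_spectralMap (f : ℂ →+ ℂ) {x H : L}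
    (hH : LieModule.toEnd ℂ L L H = spectralMap f (LieModule.toEnd ℂ L L x)) :
    LieModule.toEnd ℂ L M H = spectralMap f (LieModule.toEnd ℂ L M x) := by
  set S := spectralMap f (LieModule.toEnd ℂ L M x) with hS
  set T := S - LieModule.toEnd ℂ L M H with hT
  have hTc : ∀ (y : L) m, T ⁅y, m⁆ = ⁅y, T m⁆ := by
    intro y m
    rw [hT, LinearMap.sub_apply, LinearMap.sub_apply, spectralMap_lie, ← hH, lie_sub,
      LieModule.toEnd_apply_apply, LieModule.toEnd_apply_apply, LieModule.toEnd_apply_apply,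
      leibniz_lie H y m]
    abel
  have hsub : ∀ U : LieSubmodule ℂ L M, ∀ u ∈ U, T u ∈ U := by
    intro U u hu
    rw [hT, LinearMap.sub_apply]
    exact U.sub_mem (mapsTo_spectralMap f U.toSubmodule (fun u hu => U.lie_mem hu) u hu)
      (U.lie_mem hu)
  -- generalized eigenspaces of `T` are submodules, on which `T` has trace zero
  have htr : ∀ U : LieSubmodule ℂ L M, LinearMap.trace ℂ U (T.restrict (hsub U)) = 0 := by
    intro U
    have h1 : T.restrict (hsub U) =
        spectralMap f (LieModule.toEnd ℂ L U x) - LieModule.toEnd ℂ L U H := by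
      ext u
      have := spectralMap_comm f (T := LieModule.toEnd ℂ L U x) (T' := LieModule.toEnd ℂ L M x)
        (U.incl : U →ₗ[ℂ] M) (fun _ => rfl) u
      rw [LinearMap.coe_restrict_apply, hT, LinearMap.sub_apply, LinearMap.sub_apply, hS]
      erw [← this]
      rfl
    have h2 : LinearMap.trace ℂ U (spectralMap f (LieModule.toEnd ℂ L U x)) =
        f (LinearMap.trace ℂ U (LieModule.toEnd ℂ L U x)) := by
      have h3 : LinearMap.trace ℂ U (LieModule.toEnd ℂ L U x) =
          LinearMap.trace ℂ U (spectralMap id (LieModule.toEnd ℂ L U x)) := by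
        rw [← sub_eq_zero, ← map_sub]
        exact (LinearMap.isNilpotent_trace_of_isNilpotent (isNilpotent_sub_spectralMap _)).eq_zero
      rw [h3, trace_spectralMap, trace_spectralMap, Multiset.map_id, map_multiset_sum]
    rw [h1, map_sub, h2, trace_toEnd_eq_zero, trace_toEnd_eq_zero, map_zero, sub_zero]
  have hev : ∀ c, T.HasEigenvalue c → c = 0 := by
    intro c hc
    let U : LieSubmodule ℂ L M :=
      { T.eigenspace c with
        lie_mem := by
          intro y m hm
          have hm' : T m = c • m := Module.End.mem_eigenspace_iff.1 hm
          refine Module.End.mem_eigenspace_iff.2 ?_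
          rw [hTc, hm', lie_smul] }
    have h1 := htr U
    have h2 : T.restrict (hsub U) = c • LinearMap.id := by
      ext u
      exact Module.End.mem_eigenspace_iff.1 u.2
    rw [h2, map_smul, LinearMap.trace_id, smul_eq_mul, mul_eq_zero] at h1
    rcases h1 with h1 | h1
    · exact h1
    · exfalso
      have h3 : finrank ℂ U = 0 := by exact_mod_cast h1
      exact hc (Submodule.finrank_eq_zero.1 h3)
  let N : LieSubmodule ℂ L M :=
    { LinearMap.ker T with
      lie_mem := by
        intro y m hm
        change T ⁅y, m⁆ = 0
        rw [hTc, show T m = 0 from hm, lie_zero] }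
  obtain ⟨U, hU⟩ := exists_isCompl_lieSubmodule N
  have hU0 : U = ⊥ := by
    by_contra hne
    have : Nontrivial U := (LieSubmodule.nontrivial_iff_ne_bot ℂ L M).2 hne
    obtain ⟨c, hc⟩ := Module.End.exists_eigenvalue (T.restrict (hsub U))
    obtain ⟨u, hu⟩ := hc.exists_hasEigenvector
    have h1 : T (u : M) = c • (u : M) := congrArg Subtype.val hu.apply_eq_smul
    have hu0 : (u : M) ≠ 0 := fun h => hu.2 (Subtype.ext h)
    have h2 : c = 0 := hev c (Module.End.hasEigenvalue_of_hasEigenvector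
      ⟨Module.End.mem_eigenspace_iff.2 h1, hu0⟩)
    have h3 : (u : M) ∈ N ⊓ U := ⟨by rw [h2, zero_smul] at h1; exact h1, u.2⟩
    rw [hU.inf_eq_bot] at h3
    exact hu0 h3
  have hT0 : T = 0 := by
    have := hU.sup_eq_top
    rw [hU0, sup_bot_eq] at this
    exact LinearMap.ker_eq_top.1 ((LieSubmodule.toSubmodule_eq_top (N := N)).2 this)
  rw [hT, sub_eq_zero] at hT0
  exact hT0.symm

end Complex

/-! ### Complex conjugation on a complexification -/

section Conj

variable (V : Type*) [AddCommGroup V] [Module ℝ V]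

/-- The real part of an element of the complexification. -/
def rePart : ℂ ⊗[ℝ] V →ₗ[ℝ] V :=
  (TensorProduct.lid ℝ V).toLinearMap ∘ₗ LinearMap.rTensor V Complex.reLm

/-- The imaginary part of an element of the complexification. -/
def imPart : ℂ ⊗[ℝ] V →ₗ[ℝ] V :=
  (TensorProduct.lid ℝ V).toLinearMap ∘ₗ LinearMap.rTensor V Complex.imLm

/-- Complex conjugation on the complexification. -/
def conjC : ℂ ⊗[ℝ] V →ₗ[ℝ] ℂ ⊗[ℝ] V :=
  LinearMap.rTensor V Complex.conjAe.toLinearMap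

variable {V}

@[simp] theorem rePart_tmul (z : ℂ) (v : V) : rePart V (z ⊗ₜ v) = z.re • v := by
  simp [rePart]

@[simp] theorem imPart_tmul (z : ℂ) (v : V) : imPart V (z ⊗ₜ v) = z.im • v := by
  simp [imPart]

@[simp] theorem conjC_tmul (z : ℂ) (v : V) :
    conjC V (z ⊗ₜ v) = (starRingEnd ℂ z) ⊗ₜ v := by
  simp [conjC]

theorem eq_rePart_add_imPart (z : ℂ ⊗[ℝ] V) :
    z = 1 ⊗ₜ rePart V z + Complex.I ⊗ₜ imPart V z := by
  induction z with
  | zero => simp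
  | tmul z v =>
    rw [rePart_tmul, imPart_tmul, ← TensorProduct.smul_tmul, ← TensorProduct.smul_tmul,
      ← TensorProduct.add_tmul]
    congr 1
    apply Complex.ext <;> simp
  | add x y hx hy =>
    rw [map_add, map_add, TensorProduct.tmul_add, TensorProduct.tmul_add]
    nth_rewrite 1 [hx, hy]
    abel

theorem conjC_smul (c : ℂ) (z : ℂ ⊗[ℝ] V) : conjC V (c • z) = (starRingEnd ℂ c) • conjC V z := by
  induction z with
  | zero => simp
  | tmul z v => simp [TensorProduct.smul_tmul']
  | add x y hx hy => rw [smul_add, map_add, hx, hy, map_add, smul_add]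

@[simp] theorem conjC_conjC (z : ℂ ⊗[ℝ] V) : conjC V (conjC V z) = z := by
  induction z with
  | zero => simp
  | tmul z v => simp
  | add x y hx hy => rw [map_add, map_add, hx, hy]

theorem eq_tmul_of_conjC_eq {z : ℂ ⊗[ℝ] V} (hz : conjC V z = z) : z = 1 ⊗ₜ rePart V z := by
  have h1 := eq_rePart_add_imPart z
  have h2 : imPart V (conjC V z) = - imPart V z := by
    rw [h1]; simp
  rw [hz] at h2
  have h3 : imPart V z = 0 := by
    have h4 : (2 : ℝ) • imPart V z = 0 := by
      rw [two_smul]; nth_rewrite 1 [h2]; exact neg_add_cancel _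
    simpa using h4
  rw [h3, TensorProduct.tmul_zero, add_zero] at h1
  exact h1

theorem tmul_injective {v w : V} (h : (1 : ℂ) ⊗ₜ[ℝ] v = 1 ⊗ₜ w) : v = w := by
  simpa using congrArg (rePart V) h

theorem conjC_baseChange (T : Module.End ℝ V) (z : ℂ ⊗[ℝ] V) :
    conjC V (LinearMap.baseChange ℂ T z) = LinearMap.baseChange ℂ T (conjC V z) := by
  induction z with
  | zero => simp
  | tmul z v => simp
  | add x y hx hy => simp [hx, hy]

theorem conjC_lie {L : Type*} [LieRing L] [LieAlgebra ℝ L] [LieRingModule L V] [LieModule ℝ L V]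
    (x : ℂ ⊗[ℝ] L) (z : ℂ ⊗[ℝ] V) : conjC V ⁅x, z⁆ = ⁅conjC L x, conjC V z⁆ := by
  induction x with
  | zero => simp
  | add x y hx hy => simp [hx, hy]
  | tmul a x =>
    rw [eq_rePart_add_imPart z, lie_add (a ⊗ₜ[ℝ] x) _ _, map_add, map_add,
      lie_add (conjC L (a ⊗ₜ[ℝ] x)) _ _]
    simp only [LieAlgebra.ExtendScalars.bracket_tmul, conjC_tmul, map_mul]

variable [FiniteDimensional ℝ V]

theorem conjC_mem_maxGenEigenspace (T : Module.End ℝ V) {μ : ℂ} {z : ℂ ⊗[ℝ] V}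
    (hz : z ∈ Module.End.maxGenEigenspace (LinearMap.baseChange ℂ T) μ) :
    conjC V z ∈ Module.End.maxGenEigenspace (LinearMap.baseChange ℂ T) (starRingEnd ℂ μ) := by
  rw [mem_maxGenEigenspace] at hz ⊢
  obtain ⟨k, hk⟩ := hz
  refine ⟨k, ?_⟩
  have : ∀ (k : ℕ) z, ((LinearMap.baseChange ℂ T - (starRingEnd ℂ μ) • 1) ^ k) (conjC V z) =
      conjC V (((LinearMap.baseChange ℂ T - μ • 1) ^ k) z) := by
    intro k
    induction k with
    | zero => simp
    | succ k ih =>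
      intro z
      rw [pow_succ, pow_succ, Module.End.mul_apply, Module.End.mul_apply, ← ih]
      congr 1
      simp [conjC_smul, conjC_baseChange]
  rw [this, hk, map_zero]

theorem conjC_spectralMap {f : ℂ → ℂ} (hf : ∀ z, f (starRingEnd ℂ z) = starRingEnd ℂ (f z))
    (T : Module.End ℝ V) (z : ℂ ⊗[ℝ] V) :
    conjC V (spectralMap f (LinearMap.baseChange ℂ T) z) =
      spectralMap f (LinearMap.baseChange ℂ T) (conjC V z) := by
  refine induction_maxGenEigenspace (LinearMap.baseChange ℂ T)
    (p := fun z => conjC V (spectralMap f (LinearMap.baseChange ℂ T) z) =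
      spectralMap f (LinearMap.baseChange ℂ T) (conjC V z))
    (fun μ x hx => ?_) (by simp) (fun x y hx hy => by simp [hx, hy]) z
  rw [spectralMap_apply f hx, spectralMap_apply f (conjC_mem_maxGenEigenspace T hx),
    conjC_smul, hf]

end Conj

/-! ### Real Lie algebras -/

section Real

variable {L : Type*} [LieRing L] [LieAlgebra ℝ L] [FiniteDimensional ℝ L]
  [LieAlgebra.IsKilling ℝ L]

instance isKilling_complexification : LieAlgebra.IsKilling ℂ (ℂ ⊗[ℝ] L) where
  killingCompl_top_eq_bot := by
    rw [eq_bot_iff]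
    intro z hz
    have hz' : ∀ y : L, killingForm ℂ (ℂ ⊗[ℝ] L) z (1 ⊗ₜ y) = 0 := by
      intro y
      have := (LieIdeal.mem_killingCompl ℂ (ℂ ⊗[ℝ] L) ⊤).1 hz (1 ⊗ₜ y) trivial
      rwa [LieModule.traceForm_comm] at this
    have key : ∀ y, killingForm ℝ L (rePart L z) y = 0 ∧ killingForm ℝ L (imPart L z) y = 0 := by
      intro y
      have h1 := hz' y
      rw [eq_rePart_add_imPart z] at h1
      unfold killingForm at h1
      rw [LieModule.traceForm_baseChange] at h1
      simp only [map_add, LinearMap.add_apply, LinearMap.BilinForm.baseChange_tmul] at h1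
      have h2 := congrArg Complex.re h1
      have h3 := congrArg Complex.im h1
      simp at h2 h3
      exact ⟨h2, h3⟩
    have hnd := LieAlgebra.IsKilling.ker_killingForm_eq_bot ℝ L
    have e1 : rePart L z = 0 := by
      have : rePart L z ∈ LinearMap.ker (killingForm ℝ L) := LinearMap.ext fun y => (key y).1
      rwa [hnd] at this
    have e2 : imPart L z = 0 := by
      have : imPart L z ∈ LinearMap.ker (killingForm ℝ L) := LinearMap.ext fun y => (key y).2
      rwa [hnd] at this
    rw [eq_rePart_add_imPart z, e1, e2]
    simp

variable {V : Type*} [AddCommGroup V] [Module ℝ V] [FiniteDimensional ℝ V]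
  [LieRingModule L V] [LieModule ℝ L V]

/-- `H` acts on the complexification of `V` as `f` of the action of `X`. -/
def ActsAs (V : Type*) [AddCommGroup V] [Module ℝ V] [FiniteDimensional ℝ V]
    [LieRingModule L V] [LieModule ℝ L V] (f : ℂ →+ ℂ) (X H : L) : Prop :=
  LinearMap.baseChange ℂ (LieModule.toEnd ℝ L V H) =
    spectralMap f (LinearMap.baseChange ℂ (LieModule.toEnd ℝ L V X))

/-- The element obtained over `ℂ` is fixed by conjugation, since `f` commutes with conjugation and
the adjoint representation is faithful; hence it is real. -/
theorem exists_actsAs {f : ℂ →+ ℂ} (hf : ∀ z, f (starRingEnd ℂ z) = starRingEnd ℂ (f z)) (X : L) :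
    ∃ H : L, ActsAs L f X H := by
  obtain ⟨H, hH⟩ := exists_toEnd_eq_spectralMap f ((1 : ℂ) ⊗ₜ[ℝ] X)
  have h1 : conjC L H = H := by
    refine eq_of_ad_eq ℂ fun z => ?_
    have h2 : ∀ y, ⁅H, y⁆ =
        spectralMap f (LieModule.toEnd ℂ (ℂ ⊗[ℝ] L) (ℂ ⊗[ℝ] L) ((1 : ℂ) ⊗ₜ[ℝ] X)) y :=
      fun y => LinearMap.congr_fun hH y
    rw [h2, ← conjC_conjC ⁅conjC L H, z⁆, conjC_lie, conjC_conjC, h2, LieModule.toEnd_baseChange,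
      conjC_spectralMap hf, conjC_conjC]
  refine ⟨rePart L H, ?_⟩
  rw [ActsAs, ← LieModule.toEnd_baseChange, ← eq_tmul_of_conjC_eq h1, hH,
    LieModule.toEnd_baseChange]

theorem ActsAs.rep {f : ℂ →+ ℂ} {X H : L} (h : ActsAs L f X H) : ActsAs V f X H := by
  rw [ActsAs, ← LieModule.toEnd_baseChange, ← LieModule.toEnd_baseChange] at h ⊢
  exact toEnd_eq_spectralMap f h

end Real

/-! ### Diagonalizable operators -/

section Diag

variable {W : Type*} [AddCommGroup W] [Module ℝ W]

/-- Diagonalizability over the reals. -/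
def IsDiag (T : Module.End ℝ W) : Prop := (⨆ μ : ℝ, Module.End.eigenspace T μ) = ⊤

theorem exists_basis_subset [FiniteDimensional ℝ W] {s : Set W} (hs : Submodule.span ℝ s = ⊤) :
    ∃ b : Basis (Fin (finrank ℝ W)) ℝ W, ∀ i, b i ∈ s := by
  let b := Basis.ofSpan hs.ge
  have : Finite ((linearIndepOn_empty ℝ id).extend (Set.empty_subset s)) :=
    Module.Finite.finite_basis b
  have := Fintype.ofFinite ((linearIndepOn_empty ℝ id).extend (Set.empty_subset s))
  refine ⟨b.reindex (Fintype.equivFinOfCardEq (finrank_eq_card_basis b).symm), fun i => ?_⟩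
  rw [Basis.reindex_apply]
  exact Basis.ofSpan_subset hs.ge ⟨_, rfl⟩

theorem IsDiag.exists_basis [FiniteDimensional ℝ W] {T : Module.End ℝ W} (hT : IsDiag T) :
    ∃ (b : Basis (Fin (finrank ℝ W)) ℝ W) (d : Fin (finrank ℝ W) → ℝ), ∀ i, T (b i) = d i • b i := by
  have hs : Submodule.span ℝ {v | ∃ μ : ℝ, T v = μ • v} = ⊤ := by
    rw [eq_top_iff, ← hT]
    exact iSup_le fun μ x hx => Submodule.subset_span ⟨μ, mem_eigenspace_iff.1 hx⟩
  obtain ⟨b, hb⟩ := exists_basis_subset hs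
  choose d hd using hb
  exact ⟨b, d, hd⟩

theorem IsDiag.maxGenEigenspace_le [FiniteDimensional ℝ W] {T : Module.End ℝ W} (hT : IsDiag T)
    (μ : ℝ) : T.maxGenEigenspace μ ≤ T.eigenspace μ := by
  obtain ⟨b, d, hd⟩ := hT.exists_basis
  intro x hx
  obtain ⟨k, hk⟩ := (mem_maxGenEigenspace T μ x).1 hx
  have h1 : ∀ (k : ℕ) (i), ((T - μ • 1) ^ k) (b i) = (d i - μ) ^ k • b i := by
    intro k i
    induction k with
    | zero => simp
    | succ k ih =>
      rw [pow_succ, Module.End.mul_apply, LinearMap.sub_apply, hd, LinearMap.smul_apply,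
        Module.End.one_apply, ← sub_smul, map_smul, ih, smul_smul, pow_succ']
  have h2 : ∀ i, (d i - μ) * b.repr x i = 0 := by
    intro i
    have h3 : ((T - μ • 1) ^ k) x = ∑ i, (b.repr x i * (d i - μ) ^ k) • b i := by
      conv_lhs => rw [← b.sum_repr x, map_sum]
      exact Finset.sum_congr rfl fun i _ => by rw [map_smul, h1, smul_smul]
    rw [hk] at h3
    have h4 := congrArg (fun y => b.repr y i) h3
    simp only [map_zero, Finsupp.coe_zero, Pi.zero_apply] at h4
    rw [b.repr_sum_self] at h4
    rcases mul_eq_zero.1 h4.symm with h | h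
    · rw [h, mul_zero]
    · rw [eq_zero_of_pow_eq_zero h, zero_mul]
  rw [mem_eigenspace_iff, ← b.sum_repr x, map_sum, Finset.smul_sum]
  refine Finset.sum_congr rfl fun i _ => ?_
  rw [map_smul, hd, smul_smul, smul_smul]
  congr 1
  linear_combination h2 i

theorem IsDiag.add {S T : Module.End ℝ W} [FiniteDimensional ℝ W] (hS : IsDiag S) (hT : IsDiag T)
    (h : Commute S T) : IsDiag (S + T) := by
  rw [IsDiag, eq_top_iff, ← hS]
  refine iSup_le fun μ x hx => ?_
  have h1 : ∀ x ∈ S.eigenspace μ, T x ∈ S.eigenspace μ := by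
    intro x hx
    rw [mem_eigenspace_iff] at hx ⊢
    have := LinearMap.congr_fun h.eq x
    rw [Module.End.mul_apply, Module.End.mul_apply, hx, map_smul] at this
    exact this
  have h2 := Submodule.inf_iSup_genEigenspace (f := T) h1 1
  have h3 : x ∈ S.eigenspace μ ⊓ ⨆ ν, T.genEigenspace ν 1 := by
    refine ⟨hx, ?_⟩
    have : (⨆ ν, T.genEigenspace ν 1) = ⊤ := hT
    rw [this]; trivial
  rw [h2] at h3
  refine (iSup_le fun ν y hy => ?_ :
    (⨆ ν, S.eigenspace μ ⊓ T.genEigenspace ν 1) ≤ ⨆ μ, (S + T).eigenspace μ) h3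
  refine Submodule.mem_iSup_of_mem (μ + ν) ?_
  have hy1 := mem_eigenspace_iff.1 hy.1
  have hy2 : T y = ν • y := mem_eigenspace_iff.1 hy.2
  rw [mem_eigenspace_iff, LinearMap.add_apply, hy1, hy2, add_smul]

theorem IsDiag.smul {T : Module.End ℝ W} (hT : IsDiag T) (c : ℝ) : IsDiag (c • T) := by
  rw [IsDiag, eq_top_iff, ← hT]
  refine iSup_le fun μ x hx => Submodule.mem_iSup_of_mem (c * μ) ?_
  rw [mem_eigenspace_iff] at hx ⊢
  rw [LinearMap.smul_apply, hx, smul_smul]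

/-- An operator and its graded part have the same characteristic polynomial. -/
theorem charpoly_eq_of_eigenbasis [FiniteDimensional ℝ W] {n : ℕ} (b : Basis (Fin n) ℝ W) (d : Fin n → ℝ)
    {S S' : Module.End ℝ W} (hS : ∀ i j, d i < d j → b.repr (S (b j)) i = 0)
    (hS' : ∀ i j, d i < d j → b.repr (S' (b j)) i = 0)
    (h : ∀ i j, d i = d j → b.repr (S (b j)) i = b.repr (S' (b j)) i) :
    S.charpoly = S'.charpoly := by
  rw [← LinearMap.charpoly_toMatrix S b, ← LinearMap.charpoly_toMatrix S' b]
  -- Grouping the basis by the values of `d` makes the characteristic matrix block triangular, so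
  -- its determinant depends only on the diagonal blocks.
  have key : ∀ T : Module.End ℝ W, (∀ i j, d i < d j → b.repr (T (b j)) i = 0) →
      (LinearMap.toMatrix b b T).charmatrix.BlockTriangular (fun i => - d i) := by
    intro T hT i j hij
    have hij' : d i < d j := by simpa using hij
    have hne : i ≠ j := by rintro rfl; exact lt_irrefl _ hij'
    rw [Matrix.charmatrix_apply_ne _ _ _ hne, LinearMap.toMatrix_apply, hT i j hij', map_zero,
      neg_zero]
  rw [Matrix.charpoly, Matrix.charpoly, (key S hS).det, (key S' hS').det]
  refine Finset.prod_congr rfl fun a _ => ?_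
  congr 1
  ext1 ⟨i, hi⟩ ⟨j, hj⟩
  have hij : d i = d j := neg_injective (hi.trans hj.symm)
  rw [Matrix.toSquareBlock_def, Matrix.toSquareBlock_def, Matrix.of_apply, Matrix.of_apply,
    Matrix.charmatrix_apply, Matrix.charmatrix_apply,
    LinearMap.toMatrix_apply, LinearMap.toMatrix_apply, h i j hij]

end Diag

/-! ### The real part of an operator -/

section Hyperbolic

variable {V : Type*} [AddCommGroup V] [Module ℝ V] [FiniteDimensional ℝ V]

/-- The real part as an additive endomorphism of the complex numbers. -/
def reHom : ℂ →+ ℂ :=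
  Complex.ofRealHom.toAddMonoidHom.comp Complex.reAddGroupHom

@[simp] theorem reHom_apply (z : ℂ) : reHom z = (z.re : ℂ) := rfl

theorem reHom_conj (z : ℂ) : reHom (starRingEnd ℂ z) = starRingEnd ℂ (reHom z) := by simp

/-- The real part of a generalized eigenvector of `T` for `μ` is in the eigenspace of `S` for `Re
μ`, and these real parts span. -/
theorem isDiag_of_baseChange_eq {S T : Module.End ℝ V}
    (h : LinearMap.baseChange ℂ S = spectralMap reHom (LinearMap.baseChange ℂ T)) : IsDiag S := by
  have hre : ∀ z : ℂ ⊗[ℝ] V, rePart V (LinearMap.baseChange ℂ S z) = S (rePart V z) := by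
    intro z
    induction z with
    | zero => simp
    | tmul a v => simp
    | add x y hx hy => simp [hx, hy]
  have key : ∀ z : ℂ ⊗[ℝ] V, rePart V z ∈ ⨆ μ : ℝ, S.eigenspace μ := by
    intro z
    refine induction_maxGenEigenspace (LinearMap.baseChange ℂ T)
      (p := fun z => rePart V z ∈ ⨆ μ : ℝ, S.eigenspace μ) (fun μ z hz => ?_) (by simp)
      (fun x y hx hy => by rw [map_add]; exact add_mem hx hy) z
    refine Submodule.mem_iSup_of_mem μ.re ?_
    rw [mem_eigenspace_iff, ← hre, h, spectralMap_apply reHom hz, reHom_apply,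
      ← map_smul (rePart V)]
    congr 1
  rw [IsDiag, eq_top_iff]
  intro v _
  simpa using key (1 ⊗ₜ v)

theorem baseChange_eq_spectralMap_of_isDiag {S : Module.End ℝ V} (h : IsDiag S) :
    LinearMap.baseChange ℂ S = spectralMap reHom (LinearMap.baseChange ℂ S) := by
  ext v
  have hv : v ∈ ⨆ μ : ℝ, S.eigenspace μ := by
    have : (⨆ μ : ℝ, S.eigenspace μ) = ⊤ := h
    rw [this]; trivial
  refine Submodule.iSup_induction _ (motive := fun v =>
    LinearMap.baseChange ℂ S ((1 : ℂ) ⊗ₜ v) =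
      spectralMap reHom (LinearMap.baseChange ℂ S) ((1 : ℂ) ⊗ₜ v)) hv (fun μ v hv => ?_) (by simp)
    (fun x y hx hy => by rw [TensorProduct.tmul_add, map_add, map_add, hx, hy])
  have h1 : LinearMap.baseChange ℂ S ((1 : ℂ) ⊗ₜ v) = (μ : ℂ) • ((1 : ℂ) ⊗ₜ v) := by
    rw [LinearMap.baseChange_tmul, mem_eigenspace_iff.1 hv, ← TensorProduct.smul_tmul,
      TensorProduct.smul_tmul']
    congr 1
  rw [spectralMap_apply reHom (μ := (μ : ℂ)), h1]
  · simp only [reHom_apply, Complex.ofReal_re]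
  · exact eigenspace_le_maxGenEigenspace (mem_eigenspace_iff.2 h1)

theorem absReRoots_charpoly (T : Module.End ℝ V) :
    absReRoots T.charpoly = (LinearMap.trace ℂ _
      (spectralMap (fun z => ((|z.re| : ℝ) : ℂ)) (LinearMap.baseChange ℂ T))).re := by
  rw [trace_spectralMap, re_multiset_sum, LinearMap.charpoly_baseChange, absReRoots]
  rfl

theorem absReRoots_charpoly_eq {S T : Module.End ℝ V}
    (h : LinearMap.baseChange ℂ S = spectralMap reHom (LinearMap.baseChange ℂ T)) :
    absReRoots S.charpoly = absReRoots T.charpoly := by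
  rw [absReRoots_charpoly, absReRoots_charpoly, h, spectralMap_spectralMap]
  congr 4

end Hyperbolic

/-! ### Gradings by split elements and reduction of `ρ` to a maximal split abelian subalgebra -/

section

variable {L : Type*} [LieRing L] [LieAlgebra ℝ L] [FiniteDimensional ℝ L]
  {V : Type*} [AddCommGroup V] [Module ℝ V] [FiniteDimensional ℝ V]
  [LieRingModule L V] [LieModule ℝ L V]

theorem ActsAs.rho_eq {X H : L} (h : ActsAs V reHom X H) : rho L V H = rho L V X := by
  rw [LieRep.rho_eq, LieRep.rho_eq, absReRoots_charpoly_eq h]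

theorem ActsAs.isDiag {X H : L} (h : ActsAs V reHom X H) : IsDiag (LieModule.toEnd ℝ L V H) :=
  isDiag_of_baseChange_eq h

/-- Holds because `f 0 = 0`. As a consequence, stabilizers contain the Jordan components of their
elements. -/
theorem ActsAs.lie_eq_zero {f : ℂ →+ ℂ} {X H : L} (h : ActsAs V f X H) {v : V} (hv : ⁅X, v⁆ = 0) :
    ⁅H, v⁆ = 0 := by
  apply tmul_injective
  have h1 : LinearMap.baseChange ℂ (LieModule.toEnd ℝ L V X) ((1 : ℂ) ⊗ₜ v) = 0 := by simp [hv]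
  have h2 := LinearMap.congr_fun h ((1 : ℂ) ⊗ₜ v)
  rw [spectralMap_apply f (μ := 0), map_zero, zero_smul, LinearMap.baseChange_tmul] at h2
  · simpa using h2
  · exact eigenspace_le_maxGenEigenspace (mem_eigenspace_iff.2 (by rw [h1, zero_smul]))

/-- The sum of the eigenspaces of `ad D` for eigenvalues in `P`. -/
def grade (D : L) (P : Set ℝ) : Submodule ℝ L :=
  ⨆ μ ∈ P, eigenspace (LieModule.toEnd ℝ L L D) μ

theorem grade_le_iff {D : L} {P : Set ℝ} {N : Submodule ℝ L} :
    grade D P ≤ N ↔ ∀ μ ∈ P, ∀ Y, ⁅D, Y⁆ = μ • Y → Y ∈ N := by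
  simp only [grade, iSup_le_iff]
  exact forall₂_congr fun μ _ => ⟨fun h Y hY => h (mem_eigenspace_iff.2 hY),
    fun h Y hY => h Y (mem_eigenspace_iff.1 hY)⟩

theorem mem_grade_singleton {D Y : L} {μ : ℝ} : Y ∈ grade D {μ} ↔ ⁅D, Y⁆ = μ • Y := by
  rw [grade, iSup_singleton]
  exact mem_eigenspace_iff

theorem grade_union (D : L) (P Q : Set ℝ) : grade D (P ∪ Q) = grade D P ⊔ grade D Q :=
  iSup_union

theorem grade_mono (D : L) {P Q : Set ℝ} (h : P ⊆ Q) : grade D P ≤ grade D Q :=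
  biSup_mono h

theorem grade_univ {D : L} (hD : IsDiag (LieModule.toEnd ℝ L L D)) : grade D Set.univ = ⊤ := by
  rw [grade, ← hD]
  simp

theorem killingForm_grade {D : L} {P Q : Set ℝ} (h : ∀ μ ∈ P, ∀ ν ∈ Q, μ + ν ≠ 0) {x y : L}
    (hx : x ∈ grade D P) (hy : y ∈ grade D Q) : killingForm ℝ L x y = 0 := by
  have h1 : grade D P ≤ LinearMap.ker ((killingForm ℝ L).flip y) := by
    refine grade_le_iff.2 fun μ hμ x hx => ?_
    change killingForm ℝ L x y = 0
    have h2 : grade D Q ≤ LinearMap.ker (killingForm ℝ L x) := by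
      refine grade_le_iff.2 fun ν hν y hy => ?_
      change killingForm ℝ L x y = 0
      have h3 : killingForm ℝ L ⁅x, D⁆ y = killingForm ℝ L x ⁅D, y⁆ :=
        LieModule.traceForm_apply_lie_apply ℝ L L x D y
      rw [← lie_skew, hx, hy, map_neg, map_smul, map_smul, LinearMap.neg_apply,
        LinearMap.smul_apply, smul_eq_mul, smul_eq_mul] at h3
      have h4 : (μ + ν) * killingForm ℝ L x y = 0 := by linear_combination -h3
      exact (mul_eq_zero.1 h4).resolve_left (h μ hμ ν hν)
    exact h2 hy
  exact h1 hx

/-- In an eigenbasis of `D`, the element `Y'` preserves the eigenspaces and `Y - Y'` strictly raises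
the eigenvalue, so `Y` is block triangular with the diagonal blocks of `Y'`. -/
theorem charpoly_eq_of_grade {D Y Y' : L} (hD : IsDiag (LieModule.toEnd ℝ L V D))
    (hY' : Y' ∈ grade D {0}) (h : Y - Y' ∈ grade D (Set.Ioi 0)) :
    (LieModule.toEnd ℝ L V Y).charpoly = (LieModule.toEnd ℝ L V Y').charpoly := by
  obtain ⟨b, d, hd⟩ := hD.exists_basis
  have shift : ∀ (Z : L) (μ : ℝ), ⁅D, Z⁆ = μ • Z → ∀ i j, d i ≠ μ + d j →
      b.repr ⁅Z, b j⁆ i = 0 := by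
    intro Z μ hZ i j hij
    have h1 : ⁅D, ⁅Z, b j⁆⁆ = (μ + d j) • ⁅Z, b j⁆ := by
      have : ⁅D, b j⁆ = d j • b j := hd j
      rw [leibniz_lie, hZ, this, lie_smul, smul_lie, add_smul]
    have h2 : ⁅D, ⁅Z, b j⁆⁆ = ∑ k, (b.repr ⁅Z, b j⁆ k * d k) • b k := by
      conv_lhs => rw [← b.sum_repr ⁅Z, b j⁆]
      rw [lie_sum]
      refine Finset.sum_congr rfl fun k _ => ?_
      have : ⁅D, b k⁆ = d k • b k := hd k
      rw [lie_smul, this, smul_smul]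
    have h3 := congrArg (fun y => b.repr y i) (h1.symm.trans h2)
    simp only [b.repr_sum_self, map_smul, Finsupp.smul_apply, smul_eq_mul] at h3
    have h4 : (d i - (μ + d j)) * b.repr ⁅Z, b j⁆ i = 0 := by linear_combination -h3
    exact (mul_eq_zero.1 h4).resolve_left (sub_ne_zero.2 hij)
  have hpos : ∀ i j, d i ≤ d j → b.repr ⁅Y - Y', b j⁆ i = 0 := by
    intro i j hij
    let φ : L →ₗ[ℝ] ℝ := (b.coord i) ∘ₗ (LieModule.toEnd ℝ L V : L →ₗ[ℝ] Module.End ℝ V).flip (b j)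
    have : grade D (Set.Ioi 0) ≤ LinearMap.ker φ := by
      refine grade_le_iff.2 fun μ hμ Z hZ => ?_
      refine shift Z μ hZ i j ?_
      have : (0 : ℝ) < μ := hμ
      linarith
    exact this h
  have h0 : ∀ i j, d i ≠ d j → b.repr ⁅Y', b j⁆ i = 0 := fun i j hij =>
    shift Y' 0 (mem_grade_singleton.1 hY') i j (by simpa using hij)
  have hsum : ∀ i j, d i ≤ d j → b.repr ⁅Y, b j⁆ i = b.repr ⁅Y', b j⁆ i := by
    intro i j hij
    have := hpos i j hij
    rw [sub_lie, map_sub, Finsupp.sub_apply, sub_eq_zero] at this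
    exact this
  refine charpoly_eq_of_eigenbasis b d (fun i j hij => ?_) (fun i j hij => h0 i j hij.ne)
    fun i j hij => hsum i j hij.le
  exact (hsum i j hij.le).trans (h0 i j hij.ne)

theorem isNilpotent_of_charpoly_eq {T T' : Module.End ℝ V} (h : T.charpoly = T'.charpoly)
    (hT : IsNilpotent T) : IsNilpotent T' := by
  have h1 := (LinearMap.isNilpotent_iff_charpoly T).1 hT
  refine ⟨finrank ℝ V, ?_⟩
  have := T'.aeval_self_charpoly
  rw [← h, h1] at this
  simpa using this

theorem commute_toEnd_of_lie_eq_zero {X Y : L} (h : ⁅X, Y⁆ = 0) :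
    Commute (LieModule.toEnd ℝ L V X) (LieModule.toEnd ℝ L V Y) := by
  refine LinearMap.ext fun v => ?_
  change ⁅X, ⁅Y, v⁆⁆ = ⁅Y, ⁅X, v⁆⁆
  rw [leibniz_lie, h, zero_lie, zero_add]

variable [LieAlgebra.IsKilling ℝ L]

/-- The Killing form pairs the degree `μ` only with the degree `-μ`. The component of `x` in degrees
opposite to `P` is therefore orthogonal to everything, and vanishes. -/
theorem mem_grade_of_orthogonal {D : L} (hD : IsDiag (LieModule.toEnd ℝ L L D)) {P : Set ℝ}
    {x : L} (hx : ∀ y ∈ grade D P, killingForm ℝ L y x = 0) : x ∈ grade D {μ | -μ ∉ P} := by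
  have split : ∀ (A : Set ℝ) (z : L), ∃ z₁ ∈ grade D A, ∃ z₂ ∈ grade D Aᶜ, z₁ + z₂ = z := by
    intro A z
    rw [← Submodule.mem_sup, ← grade_union, Set.union_compl_self, grade_univ hD]
    trivial
  obtain ⟨x₁, h₁, x₂, h₂, rfl⟩ := split {μ | -μ ∉ P} x
  have hx2 : x₂ = 0 := by
    have hk : x₂ ∈ LinearMap.ker (killingForm ℝ L) := by
      refine LinearMap.ext fun y => ?_
      obtain ⟨y₁, hy₁, y₂, hy₂, rfl⟩ := split P y
      have e1 : killingForm ℝ L y₁ x₂ = 0 := by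
        have e2 := hx y₁ hy₁
        have e4 : killingForm ℝ L y₁ x₁ = 0 := by
          refine killingForm_grade (fun μ hμ ν hν h => ?_) hy₁ h₁
          rw [eq_neg_of_add_eq_zero_left h] at hμ
          exact hν hμ
        rwa [map_add, e4, zero_add] at e2
      have e3 : killingForm ℝ L y₂ x₂ = 0 := by
        refine killingForm_grade (fun μ hμ ν hν h => ?_) hy₂ h₂
        rw [eq_neg_of_add_eq_zero_left h] at hμ
        exact hν hμ
      rw [map_add, LieModule.traceForm_comm ℝ L L x₂, LieModule.traceForm_comm ℝ L L x₂]
      change killingForm ℝ L y₁ x₂ + killingForm ℝ L y₂ x₂ = 0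
      rw [e1, e3, add_zero]
    rwa [LieAlgebra.IsKilling.ker_killingForm_eq_bot] at hk
  rwa [hx2, add_zero]

/-- Positivity for `B` makes `e` ad-nilpotent. Its degree-0 part for `A` has the same characteristic
polynomial, so it is nilpotent too; it commutes with `A` and is thus orthogonal to it. The part of
positive degree is orthogonal to `A` for degree reasons. -/
theorem killingForm_eq_zero_of_mem_grade {A B e : L} (hA : IsDiag (LieModule.toEnd ℝ L L A))
    (hB : IsDiag (LieModule.toEnd ℝ L L B)) (heB : e ∈ grade B (Set.Ioi 0))
    (heA : e ∈ grade A (Set.Ici 0)) : killingForm ℝ L A e = 0 := by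
  have hA0 : A ∈ grade A {0} := mem_grade_singleton.2 (by simp)
  have he : e ∈ grade A {0} ⊔ grade A (Set.Ioi 0) := by
    rw [← grade_union]
    refine grade_mono A ?_ heA
    intro μ hμ
    rcases eq_or_lt_of_le (show (0 : ℝ) ≤ μ from hμ) with h | h
    · exact Or.inl h.symm
    · exact Or.inr h
  obtain ⟨e₀, h₀, e₁, h₁, rfl⟩ := Submodule.mem_sup.1 he
  have hk1 : killingForm ℝ L A e₁ = 0 := by
    refine killingForm_grade (fun μ hμ ν hν => ?_) hA0 h₁
    have h1 : μ = 0 := hμ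
    have h2 : (0 : ℝ) < ν := hν
    rw [h1, zero_add]
    exact h2.ne'
  have hnil : IsNilpotent (LieModule.toEnd ℝ L L (e₀ + e₁)) := by
    refine isNilpotent_of_charpoly_eq (T := LieModule.toEnd ℝ L L (0 : L)) ?_ (by simp)
    refine (charpoly_eq_of_grade hB (zero_mem _) ?_).symm
    rwa [sub_zero]
  have hnil0 : IsNilpotent (LieModule.toEnd ℝ L L e₀) := by
    refine isNilpotent_of_charpoly_eq (charpoly_eq_of_grade hA h₀ ?_) hnil
    rwa [add_sub_cancel_left]
  have hcomm : Commute (LieModule.toEnd ℝ L L A) (LieModule.toEnd ℝ L L e₀) := by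
    have h1 : ⁅A, e₀⁆ = 0 := by rw [mem_grade_singleton.1 h₀, zero_smul]
    exact commute_toEnd_of_lie_eq_zero h1
  rw [map_add, hk1, add_zero]
  exact (LinearMap.isNilpotent_trace_of_isNilpotent (hcomm.isNilpotent_mul_left hnil0)).eq_zero

theorem IsDiag.actsAs {D : L} (hD : IsDiag (LieModule.toEnd ℝ L L D)) : ActsAs L reHom D D :=
  baseChange_eq_spectralMap_of_isDiag hD

theorem IsSplitAbelian.isDiag {b : LieSubalgebra ℝ L} (hb : IsSplitAbelian b) {Y : L}
    (hY : Y ∈ b) : IsDiag (LieModule.toEnd ℝ L L Y) := hb.2 Y hY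

theorem IsSplitAbelian.lie_eq_zero {b : LieSubalgebra ℝ L} (hb : IsSplitAbelian b) {Y Z : L}
    (hY : Y ∈ b) (hZ : Z ∈ b) : ⁅Y, Z⁆ = 0 := by
  have := hb.1.trivial ⟨Y, hY⟩ ⟨Z, hZ⟩
  exact congrArg Subtype.val this

/-- A split abelian subalgebra has an element with the same centralizer. -/
theorem IsSplitAbelian.exists_generic {b : LieSubalgebra ℝ L} (hb : IsSplitAbelian b) :
    ∃ B ∈ b, ∀ z : L, ⁅B, z⁆ = 0 → ∀ C ∈ b, ⁅C, z⁆ = 0 := by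
  have := hb.1
  have htri : LieModule.IsTriangularizable ℝ b L := by
    constructor
    intro x
    rw [eq_top_iff, ← hb.isDiag x.2]
    exact iSup_mono fun μ => eigenspace_le_maxGenEigenspace
  have hs : Submodule.span ℝ {v : L | ∀ C ∈ b, ∃ c : ℝ, ⁅C, v⁆ = c • v} = ⊤ := by
    have h1 := congrArg LieSubmodule.toSubmodule (LieModule.iSup_genWeightSpace_eq_top ℝ b L)
    rw [LieSubmodule.iSup_toSubmodule, LieSubmodule.top_toSubmodule] at h1
    rw [eq_top_iff, ← h1]
    refine iSup_le fun χ v hv => Submodule.subset_span fun C hC => ⟨χ ⟨C, hC⟩, ?_⟩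
    have h2 : v ∈ (LieModule.toEnd ℝ L L C).maxGenEigenspace (χ ⟨C, hC⟩) := by
      have h3 := (LieModule.mem_genWeightSpace L χ v).1 hv ⟨C, hC⟩
      exact (mem_maxGenEigenspace _ _ _).2 h3
    exact mem_eigenspace_iff.1 ((hb.isDiag hC).maxGenEigenspace_le _ h2)
  obtain ⟨v, hv⟩ := exists_basis_subset hs
  let χ : Fin (finrank ℝ L) → Dual ℝ L := fun i =>
    (v.coord i) ∘ₗ (LieModule.toEnd ℝ L L : L →ₗ[ℝ] Module.End ℝ L).flip (v i)
  have hχ : ∀ C ∈ b, ∀ i, ⁅C, v i⁆ = χ i C • v i := by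
    intro C hC i
    obtain ⟨c, hc⟩ := hv i C hC
    have : χ i C = c := by
      change v.repr ⁅C, v i⁆ i = c
      rw [hc]; simp
    rw [this, hc]
  obtain ⟨B, hB, hB'⟩ := Module.Dual.exists_forall_mem_ne_zero_of_forall_exists b.toSubmodule
    (fun i : {i // ∃ C ∈ b, χ i C ≠ 0} => χ i) (fun i => i.2)
  refine ⟨B, hB, fun z hz C hC => ?_⟩
  have expand : ∀ C ∈ b, ⁅C, z⁆ = ∑ i, (v.repr z i * χ i C) • v i := by
    intro C hC
    conv_lhs => rw [← v.sum_repr z]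
    rw [lie_sum]
    exact Finset.sum_congr rfl fun i _ => by rw [lie_smul, hχ C hC, smul_smul]
  have h1 : ∀ i, v.repr z i * χ i B = 0 := by
    intro i
    have := congrArg (fun y => v.repr y i) ((expand B hB).symm.trans hz)
    simpa only [v.repr_sum_self, map_zero, Finsupp.coe_zero, Pi.zero_apply] using this
  rw [expand C hC]
  refine Finset.sum_eq_zero fun i _ => ?_
  by_cases h : χ i C = 0
  · rw [h, mul_zero, zero_smul]
  · rw [(mul_eq_zero.1 (h1 i)).resolve_right (hB' ⟨i, C, hC, h⟩), zero_mul, zero_smul]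

/-- A split element commuting with a maximal split abelian subalgebra belongs to it. -/
theorem mem_of_maximal {b : LieSubalgebra ℝ L} (hb : Maximal IsSplitAbelian b) {H : L}
    (hH : IsDiag (LieModule.toEnd ℝ L L H)) (hc : ∀ C ∈ b, ⁅C, H⁆ = 0) : H ∈ b := by
  have hbc : ∀ x ∈ b.toSubmodule ⊔ Submodule.span ℝ {H}, ∀ y ∈ b.toSubmodule ⊔ Submodule.span ℝ {H},
      ⁅x, y⁆ = 0 := by
    intro x hx y hy
    obtain ⟨x₁, hx₁, x₂, hx₂, rfl⟩ := Submodule.mem_sup.1 hx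
    obtain ⟨y₁, hy₁, y₂, hy₂, rfl⟩ := Submodule.mem_sup.1 hy
    obtain ⟨s, rfl⟩ := Submodule.mem_span_singleton.1 hx₂
    obtain ⟨t, rfl⟩ := Submodule.mem_span_singleton.1 hy₂
    have h1 : ⁅H, y₁⁆ = 0 := by rw [← lie_skew, hc y₁ hy₁, neg_zero]
    simp [hb.prop.lie_eq_zero hx₁ hy₁, hc x₁ hx₁, h1]
  let b' : LieSubalgebra ℝ L :=
    { b.toSubmodule ⊔ Submodule.span ℝ {H} with
      lie_mem' := fun {x y} hx hy => by
        rw [hbc x hx y hy]; exact zero_mem (b.toSubmodule ⊔ Submodule.span ℝ {H}) }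
  have hb' : IsSplitAbelian b' := by
    refine ⟨⟨fun x y => Subtype.ext (hbc x x.2 y y.2)⟩, fun Y hY => ?_⟩
    obtain ⟨Y₁, hY₁, Y₂, hY₂, rfl⟩ := Submodule.mem_sup.1 hY
    obtain ⟨t, rfl⟩ := Submodule.mem_span_singleton.1 hY₂
    have hd : IsDiag (LieModule.toEnd ℝ L L (Y₁ + t • H)) := by
      rw [map_add, map_smul]
      exact (hb.prop.isDiag hY₁).add (hH.smul t)
        (Commute.smul_right (commute_toEnd_of_lie_eq_zero (hc Y₁ hY₁)) t)
    exact hd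
  have hle : b ≤ b' := fun x hx => Submodule.mem_sup_left hx
  exact hb.le_of_ge hb' hle (Submodule.mem_sup_right (Submodule.mem_span_singleton_self H))

/-- Every element of a semisimple Lie algebra has the same `ρ`-values as some element of a given
maximal split abelian subalgebra. -/
theorem exists_mem_rho_eq {b : LieSubalgebra ℝ L} (hb : Maximal IsSplitAbelian b)
    (X : L) : ∃ Y ∈ b, rho L L Y = rho L L X ∧ rho L V Y = rho L V X := by
  obtain ⟨A, hA⟩ := exists_actsAs reHom_conj X
  obtain ⟨B, hB, hBgen⟩ := hb.prop.exists_generic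
  have hBd := hb.prop.isDiag hB
  have hAd := hA.isDiag
  -- This takes the place of a conjugacy theorem. Write 𝔭 for the sum of the degrees ≥ 0 and 𝔫 for
  -- that of the degrees > 0. The orthogonal of 𝔭_B + 𝔫_A lies in 𝔫_B ∩ 𝔭_A, whose elements are
  -- orthogonal to `A`; so `A ∈ 𝔭_B + 𝔫_A`.
  have hsum : A ∈ grade B (Set.Ici 0) ⊔ grade A (Set.Ioi 0) := by
    have hnd := LieAlgebra.IsKilling.killingForm_nondegenerate ℝ L
    have hrefl : (killingForm ℝ L).IsRefl := (LieModule.traceForm_isSymm ℝ L L).isRefl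
    rw [← LinearMap.BilinForm.orthogonal_orthogonal hnd hrefl
      (grade B (Set.Ici 0) ⊔ grade A (Set.Ioi 0))]
    intro e he
    rw [LinearMap.BilinForm.mem_orthogonal_iff] at he
    have h1 : e ∈ grade B (Set.Ioi 0) := by
      refine grade_mono B ?_ (mem_grade_of_orthogonal hBd
        (P := Set.Ici 0) (x := e) fun y hy => he y (Submodule.mem_sup_left hy))
      intro μ hμ
      simpa using hμ
    have h2 : e ∈ grade A (Set.Ici 0) := by
      refine grade_mono A ?_ (mem_grade_of_orthogonal hAd
        (P := Set.Ioi 0) (x := e) fun y hy => he y (Submodule.mem_sup_right hy))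
      intro μ hμ
      simpa using hμ
    rw [LieModule.traceForm_comm]
    exact killingForm_eq_zero_of_mem_grade hAd hBd h1 h2
  obtain ⟨c, hc, n, hn, hcn⟩ := Submodule.mem_sup.1 hsum
  have hc' : c ∈ grade B {0} ⊔ grade B (Set.Ioi 0) := by
    rw [← grade_union]
    refine grade_mono B ?_ hc
    intro μ hμ
    rcases eq_or_lt_of_le (show (0 : ℝ) ≤ μ from hμ) with h | h
    · exact Or.inl h.symm
    · exact Or.inr h
  obtain ⟨C, hC, u, hu, rfl⟩ := Submodule.mem_sup.1 hc'
  have hA0 : A ∈ grade A {0} := mem_grade_singleton.2 (by simp)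
  -- Now `A - n = C + u`. Removing `n` does not change the characteristic polynomial of `A`, by the
  -- grading of `A`; removing `u` does not change that of `C + u`, by the grading of `B`.
  have hch : ∀ (W : Type _) [AddCommGroup W] [Module ℝ W] [FiniteDimensional ℝ W]
      [LieRingModule L W] [LieModule ℝ L W], rho L W C = rho L W X := by
    intro W _ _ _ _ _
    rw [← hA.rep.rho_eq (V := W), rho_eq, rho_eq]
    congr 2
    rw [← charpoly_eq_of_grade (Y := C + u) hBd.actsAs.rep.isDiag hC (by simpa using hu)]
    refine charpoly_eq_of_grade hA.rep.isDiag hA0 ?_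
    rw [show C + u - A = -n by rw [← hcn, sub_add_cancel_left]]
    exact neg_mem hn
  -- The same argument for the adjoint representation, since `L` and `V` may lie in different
  -- universes.
  have hch' : rho L L C = rho L L X := by
    rw [← hA.rho_eq, rho_eq, rho_eq]
    congr 2
    rw [← charpoly_eq_of_grade (Y := C + u) hBd hC (by simpa using hu)]
    refine charpoly_eq_of_grade hA.isDiag hA0 ?_
    rw [show C + u - A = -n by rw [← hcn, sub_add_cancel_left]]
    exact neg_mem hn
  -- `C` commutes with `B`, hence with all of `b` by the choice of `B`; its hyperbolic part does so
  -- too and lies in `b` by maximality.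
  obtain ⟨H, hH⟩ := exists_actsAs reHom_conj C
  refine ⟨H, mem_of_maximal hb hH.isDiag fun Z hZ => ?_, ?_, ?_⟩
  · have h1 : ⁅Z, C⁆ = 0 := by
      refine hBgen C ?_ Z hZ
      rw [mem_grade_singleton.1 hC, zero_smul]
    have h2 : ⁅C, Z⁆ = 0 := by rw [← lie_skew, h1, neg_zero]
    rw [← lie_skew, hH.lie_eq_zero h2, neg_zero]
  · rw [hH.rho_eq, hch']
  · rw [(hH.rep (V := V)).rho_eq, hch V]

end

/-! ### Simple root vectors generate -/

section Generation

open LieAlgebra LieAlgebra.IsKilling LieModule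

variable {K L : Type*} [Field K] [CharZero K] [LieRing L] [LieAlgebra K L]
  [FiniteDimensional K L] [LieAlgebra.IsKilling K L]
  {H : LieSubalgebra K L} [H.IsCartanSubalgebra] [IsTriangularizable K H L]

/-- If `α`, `β` and `α + β` are roots, then `ad f ∘ ad e` acts on the root space of `β` by a
positive integer, for an `sl₂`-triple with `e` in the root space of `α`. -/
theorem exists_lie_f_lie_e_eq_nsmul {α β : Weight K H L} (hα : α.IsNonZero) (hβ : β.IsNonZero)
    {h e f : L} (t : IsSl2Triple h e f) (he : e ∈ rootSpace H α) (hf : f ∈ rootSpace H (-α))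
    (hαβ : rootSpace H (α + β) ≠ ⊥) :
    ∃ c : ℕ, 0 < c ∧ ∀ y ∈ rootSpace H β, ⁅f, ⁅e, y⁆⁆ = c • y := by
  obtain ⟨x, hx, hx0⟩ := (chainTop α β).exists_ne_zero
  have hh := t.h_eq_coroot hα he hf
  subst hh
  have prim : t.HasPrimitiveVectorWith x (chainLength α β : K) :=
    have := lie_mem_genWeightSpace_of_mem_genWeightSpace he hx
    ⟨hx0, (chainLength_smul _ _ hx).symm, by rwa [genWeightSpace_add_chainTop _ _ hα] at this⟩
  have hq1 : 1 ≤ chainTopCoeff α β := by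
    have := ((rootSpace_zsmul_add_ne_bot_iff α β hα 1).mp (by rwa [one_smul])).1
    exact_mod_cast this
  obtain ⟨q, hq⟩ : ∃ q, chainTopCoeff α β = q + 1 := ⟨_, (Nat.succ_pred_eq_of_pos hq1).symm⟩
  have hle := chainTopCoeff_le_chainLength α β
  set z := ((toEnd K L L f) ^ (q + 1)) x with hz
  have hz0 : z ≠ 0 := prim.pow_toEnd_f_ne_zero_of_eq_nat rfl (hq ▸ hle)
  have hzβ : z ∈ rootSpace H β := by
    have := toEnd_pow_apply_mem hf hx (q + 1)
    rw [coe_chainTop', hq] at this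
    convert this using 2
    module
  -- With `x` at the top of the `α`-string, the space of `β` is spanned by `f^(q+1) x`. The constant
  -- is that of the `sl₂`-formula for `e f^(q+1) x`, positive because `q + 1` is at most the length
  -- of the string.
  refine ⟨(q + 1) * (chainLength α β - q), Nat.mul_pos (by omega) (by omega), fun y hy => ?_⟩
  obtain ⟨s, hs⟩ := (finrank_eq_one_iff_of_nonzero' (⟨z, hzβ⟩ : rootSpace H β)
    (by simpa using hz0)).mp (finrank_rootSpace_eq_one β hβ) ⟨y, hy⟩
  replace hs : s • z = y := congrArg Subtype.val hs
  rw [← hs, lie_smul, lie_smul, hz, prim.lie_e_pow_succ_toEnd_f, lie_smul,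
    prim.lie_f_pow_toEnd_f, smul_comm]
  rw [← Nat.cast_smul_eq_nsmul K, Nat.cast_mul, Nat.cast_sub (by omega)]
  push_cast
  rfl

variable (H)

/-- A system of `sl₂`-triples, one for each root. -/
theorem exists_sl2_family : ∃ e f : H.root → L, ∀ α : H.root,
    IsSl2Triple ((coroot (α : Weight K H L) : H) : L) (e α) (f α) ∧ e α ∈ rootSpace H α.1 ∧
      f α ∈ rootSpace H (-α.1 : H → K) := by
  have key (α : H.root) : ∃ p : L × L, IsSl2Triple ((coroot α.1 : H) : L) p.1 p.2 ∧
      p.1 ∈ rootSpace H α.1 ∧ p.2 ∈ rootSpace H (-α.1 : H → K) := by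
    have hα : (α : Weight K H L).IsNonZero := LieSubalgebra.isNonZero_coe_root α
    obtain ⟨h, e, f, t, he, hf⟩ := exists_isSl2Triple_of_weight_isNonZero hα
    have := t.h_eq_coroot hα he hf
    subst this
    exact ⟨(e, f), t, he, hf⟩
  choose p hp using key
  exact ⟨fun α => (p α).1, fun α => (p α).2, hp⟩

variable {H}

theorem mem_of_mem_rootSpace_of_mem {α : Weight K H L} (hα : α.IsNonZero) {e x : L} (he0 : e ≠ 0)
    (he : e ∈ rootSpace H α) (hx : x ∈ rootSpace H α) : ∃ s : K, s • e = x := by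
  obtain ⟨s, hs⟩ := (finrank_eq_one_iff_of_nonzero' (⟨e, he⟩ : rootSpace H α)
    (by simpa using he0)).mp (finrank_rootSpace_eq_one α hα) ⟨x, hx⟩
  exact ⟨s, congrArg Subtype.val hs⟩

theorem eq_neg_of_reflectionPerm_self (α : H.root) :
    (((rootSystem H).reflectionPerm α α : H.root) : Weight K H L) = -(α : Weight K H L) := by
  have h1 : (rootSystem H).root ((rootSystem H).reflectionPerm α α) = -(rootSystem H).root α := by
    rw [RootPairing.root_reflectionPerm, RootPairing.reflection_apply_self]
  rw [rootSystem_root_apply, rootSystem_root_apply] at h1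
  ext x
  simpa using LinearMap.congr_fun h1 x

theorem coe_eq_of_root_eq_add {i j k : H.root}
    (h : (rootSystem H).root k = (rootSystem H).root i + (rootSystem H).root j) :
    ((k : Weight K H L) : H → K) = (i : Weight K H L) + (j : Weight K H L) := by
  ext x
  simpa using LinearMap.congr_fun h x

/-- Root spaces and the Cartan subalgebra span. -/
theorem iSup_rootSpace_sup_eq_top :
    H.toSubmodule ⊔ (⨆ α : H.root, (rootSpace H (α : Weight K H L)).toSubmodule) = ⊤ := by
  have h := congrArg LieSubmodule.toSubmodule (iSup_genWeightSpace_eq_top' K H L)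
  rw [LieSubmodule.iSup_toSubmodule, LieSubmodule.top_toSubmodule] at h
  rw [eq_top_iff, ← h, iSup_le_iff]
  intro χ
  by_cases hχ : χ.IsZero
  · refine le_sup_of_le_left ?_
    rw [hχ.eq]
    have := (rootSpace_zero_eq K L H)
    change (rootSpace H 0).toSubmodule ≤ _
    rw [this]
    exact le_rfl
  · refine le_sup_of_le_right ?_
    exact le_iSup (fun α : H.root => (rootSpace H (α : Weight K H L)).toSubmodule)
      ⟨χ, by simpa using hχ⟩

/-- The vectors of the `sl₂`-triples of the simple roots generate the Lie algebra. -/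
theorem lieSpan_simple_eq_top (b : (rootSystem H).Base) {e f : H.root → L}
    (hef : ∀ α : H.root, IsSl2Triple ((coroot (α : Weight K H L) : H) : L) (e α) (f α) ∧
      e α ∈ rootSpace H α.1 ∧ f α ∈ rootSpace H (-α.1 : H → K)) :
    LieSubalgebra.lieSpan K L (Set.range (fun i : b.support => e i) ∪
      Set.range (fun i : b.support => f i)) = ⊤ := by
  set S := LieSubalgebra.lieSpan K L (Set.range (fun i : b.support => e i) ∪
      Set.range (fun i : b.support => f i))
  have heS (i : H.root) (hi : i ∈ b.support) : e i ∈ S :=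
    LieSubalgebra.subset_lieSpan (Or.inl ⟨⟨i, hi⟩, rfl⟩)
  have hfS (i : H.root) (hi : i ∈ b.support) : f i ∈ S :=
    LieSubalgebra.subset_lieSpan (Or.inr ⟨⟨i, hi⟩, rfl⟩)
  have hnz (i : H.root) : (i : Weight K H L).IsNonZero := LieSubalgebra.isNonZero_coe_root i
  have key (i : H.root) : (∀ x ∈ rootSpace H (i : Weight K H L), x ∈ S) ∧
      (∀ x ∈ rootSpace H (-(i : Weight K H L) : H → K), x ∈ S) := by
    -- All roots arise from simple ones by negation and by adding a simple root `j`. Root spaces are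
    -- lines, so the nonzero brackets with `e j` and `f j` fill the next ones.
    refine b.induction_add i (p := fun i => (∀ x ∈ rootSpace H (i : Weight K H L), x ∈ S) ∧
      (∀ x ∈ rootSpace H (-(i : Weight K H L) : H → K), x ∈ S)) ?_ ?_ ?_
    · rintro i ⟨h1, h2⟩
      rw [eq_neg_of_reflectionPerm_self]
      simp only [Weight.coe_neg, neg_neg]
      exact ⟨h2, h1⟩
    · intro i hi
      obtain ⟨t, he, hf⟩ := hef i
      refine ⟨fun x hx => ?_, fun x hx => ?_⟩
      · obtain ⟨s, rfl⟩ := mem_of_mem_rootSpace_of_mem (hnz i) t.e_ne_zero he hx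
        exact S.smul_mem _ (heS i hi)
      · obtain ⟨s, rfl⟩ := mem_of_mem_rootSpace_of_mem (hnz i).neg t.f_ne_zero
          (by simpa using! hf) (by simpa using! hx)
        exact S.smul_mem _ (hfS i hi)
    · rintro i j k hk ⟨h1, h2⟩ hj
      have hk' := coe_eq_of_root_eq_add hk
      obtain ⟨t, he, hf⟩ := hef j
      have hne : rootSpace H ((j : Weight K H L) + (i : Weight K H L) : H → K) ≠ ⊥ := by
        rw [add_comm, ← hk']; exact (k : Weight K H L).2
      have hne' : rootSpace H (((-j.1 : Weight K H L) : H → K) + (-i.1 : Weight K H L)) ≠ ⊥ := by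
        have : (((-j.1 : Weight K H L) : H → K) + (-i.1 : Weight K H L)) =
          (-k.1 : Weight K H L) := by
          simp only [Weight.coe_neg, hk']; abel
        rw [this]; exact (-k.1 : Weight K H L).2
      refine ⟨fun x hx => ?_, fun x hx => ?_⟩
      · obtain ⟨c, hc, hy⟩ := exists_lie_f_lie_e_eq_nsmul (hnz j) (hnz i) t he hf hne
        obtain ⟨y, hyi, hy0⟩ := (i : Weight K H L).exists_ne_zero
        have h3 : ⁅e j, y⁆ ∈ rootSpace H (k : Weight K H L) := by
          rw [hk', add_comm]; exact lie_mem_genWeightSpace_of_mem_genWeightSpace he hyi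
        have h4 : ⁅e j, y⁆ ≠ 0 := by
          intro h0
          have := hy y hyi
          rw [h0, lie_zero, ← Nat.cast_smul_eq_nsmul K] at this
          exact (smul_ne_zero (Nat.cast_ne_zero.mpr hc.ne') hy0) this.symm
        obtain ⟨s, rfl⟩ := mem_of_mem_rootSpace_of_mem (hnz k) h4 h3 hx
        exact S.smul_mem _ (S.lie_mem (heS j hj) (h1 _ hyi))
      · obtain ⟨c, hc, hy⟩ := exists_lie_f_lie_e_eq_nsmul (hnz j).neg (hnz i).neg t.symm
          (by simpa using! hf) (by simpa using! he) hne'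
        obtain ⟨y, hyi, hy0⟩ := (-i.1 : Weight K H L).exists_ne_zero
        have h3 : ⁅f j, y⁆ ∈ rootSpace H (-k.1 : Weight K H L) := by
          have : (((-k.1 : Weight K H L) : H → K)) =
             (-j.1 : Weight K H L) + (-i.1 : Weight K H L) := by
            simp only [Weight.coe_neg, hk']; abel
          rw [this]
          exact lie_mem_genWeightSpace_of_mem_genWeightSpace (by simpa using! hf) hyi
        have h4 : ⁅f j, y⁆ ≠ 0 := by
          intro h0
          have := hy y hyi
          rw [h0, lie_zero, ← Nat.cast_smul_eq_nsmul K] at this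
          exact (smul_ne_zero (Nat.cast_ne_zero.mpr hc.ne') hy0) this.symm
        obtain ⟨s, rfl⟩ := mem_of_mem_rootSpace_of_mem (hnz k).neg h4 h3 (by simpa using! hx)
        exact S.smul_mem _ (S.lie_mem (hfS j hj) (h2 _ (by simpa using! hyi)))
  have hroot (i : H.root) : ((coroot (i : Weight K H L) : H) : L) ∈ S := by
    obtain ⟨t, he, hf⟩ := hef i
    rw [← t.lie_e_f]
    exact S.lie_mem ((key i).1 _ he) ((key i).2 _ hf)
  have hH : H ≤ S := by
    intro x hx
    have h1 : Submodule.span K (Set.range (rootSystem H).coroot) = ⊤ :=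
      RootPairing.IsRootSystem.span_coroot_eq_top
    have h2 : (⟨x, hx⟩ : H) ∈ Submodule.span K (Set.range (rootSystem H).coroot) := by
      rw [h1]; trivial
    have h3 : Submodule.span K (Set.range (rootSystem H).coroot) ≤
        S.toSubmodule.comap H.toSubmodule.subtype := by
      rw [Submodule.span_le]
      rintro _ ⟨i, rfl⟩
      exact hroot i
    exact h3 h2
  rw [eq_top_iff]
  have := iSup_rootSpace_sup_eq_top (K := K) (L := L) (H := H)
  intro x _
  have hx : x ∈ (⊤ : Submodule K L) := trivial
  rw [← this] at hx
  have hle : H.toSubmodule ⊔ (⨆ α : H.root, (rootSpace H (α : Weight K H L)).toSubmodule) ≤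
      S.toSubmodule := by
    refine sup_le hH (iSup_le fun α => ?_)
    exact fun x hx => (key α).1 x hx
  exact hle hx

/-- The Lie algebra basis attached to a base of the root system and `sl₂`-triples. -/
def simpleBasis (b : (rootSystem H).Base) {e f : H.root → L}
    (hef : ∀ α : H.root, IsSl2Triple ((coroot (α : Weight K H L) : H) : L) (e α) (f α) ∧
      e α ∈ rootSpace H α.1 ∧ f α ∈ rootSpace H (-α.1 : H → K)) :
    LieAlgebra.Basis b.support H where
  A := b.cartanMatrix
  h i := ((coroot (i.1 : Weight K H L) : H) : L)
  e i := e i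
  f i := f i
  cartan_eq_lieSpan := by
    refine le_antisymm ?_ ?_
    · intro x hx
      have h1 : Submodule.span K ((rootSystem H).coroot '' b.support) = ⊤ := by
        rw [b.span_coroot_support]
        exact RootPairing.IsRootSystem.span_coroot_eq_top
      have h2 : (⟨x, hx⟩ : H) ∈ Submodule.span K ((rootSystem H).coroot '' b.support) := by
        rw [h1]; trivial
      have h3 : Submodule.span K ((rootSystem H).coroot '' b.support) ≤
          (LieSubalgebra.lieSpan K L (Set.range fun i : b.support =>
            ((coroot (i.1 : Weight K H L) : H) : L))).toSubmodule.comap H.toSubmodule.subtype := by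
        rw [Submodule.span_le]
        rintro _ ⟨i, hi, rfl⟩
        exact LieSubalgebra.subset_lieSpan ⟨⟨i, hi⟩, rfl⟩
      exact h3 h2
    · rw [LieSubalgebra.lieSpan_le]
      rintro _ ⟨i, rfl⟩
      exact SetLike.coe_mem _
  span_ef := lieSpan_simple_eq_top b hef
  linInd := by
    have h1 : LinearIndependent K fun i : b.support => (rootSystem H).coroot i :=
      b.linearIndepOn_coroot
    exact h1.map' H.toSubmodule.subtype (Submodule.ker_subtype _)
  nondegen := b.cartanMatrix_nondegenerate
  sl2 i := (hef i).1
  lie_h_h i j := by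
    have : IsLieAbelian H := inferInstance
    exact congrArg Subtype.val (trivial_lie_zero H H (coroot (i.1 : Weight K H L))
      (coroot (j.1 : Weight K H L)))
  lie_h_e i j := by
    have h1 := lie_eq_smul_of_mem_rootSpace (hef i).2.1 (coroot (j.1 : Weight K H L))
    have h2 := (rootSystem H).algebraMap_pairingIn ℤ i j
    rw [LieSubalgebra.coe_bracket_of_module] at h1
    rw [h1, ← Int.cast_smul_eq_zsmul K]
    exact congrArg (· • e i) h2.symm
  lie_h_f i j := by
    have h1 := lie_eq_smul_of_mem_rootSpace (hef i).2.2 (coroot (j.1 : Weight K H L))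
    have h2 := (rootSystem H).algebraMap_pairingIn ℤ i j
    rw [LieSubalgebra.coe_bracket_of_module] at h1
    rw [h1, ← Int.cast_smul_eq_zsmul K, Int.cast_neg]
    exact congrArg (- · • f i) h2.symm
  lie_e_f_ne i j hij := by
    have h1 : ⁅e i, f j⁆ ∈ rootSpace H ((i.1 : Weight K H L) + (-(j.1 : Weight K H L)) : H → K) :=
      lie_mem_genWeightSpace_of_mem_genWeightSpace (hef i).2.1 (hef j).2.2
    by_contra h0
    have h2 : rootSpace H ((i.1 : Weight K H L) + (-(j.1 : Weight K H L)) : H → K) ≠ ⊥ := by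
      intro h2
      rw [h2] at h1
      exact h0 (by simpa using h1)
    let W : Weight K H L := ⟨_, h2⟩
    have hW : W.IsNonZero := by
      intro hz
      have h3 : ((i.1 : Weight K H L) : H → K) = (j.1 : Weight K H L) := by
        have : ((i.1 : Weight K H L) + (-(j.1 : Weight K H L)) : H → K) = 0 := hz
        rwa [← sub_eq_add_neg, sub_eq_zero] at this
      exact hij (Subtype.ext (Subtype.ext (DFunLike.coe_injective h3)))
    refine b.sub_notMem_range_root i.2 j.2 ⟨⟨W, by simpa using hW⟩, ?_⟩
    ext x
    simp [W, sub_eq_add_neg]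

end Generation

/-! ### Homomorphisms defined on Chevalley generators -/

section Chevalley

open LieAlgebra LieAlgebra.IsKilling LieModule

section Generated

variable {ι K G : Type*} [Finite ι] [Field K] [CharZero K] [LieRing G] [LieAlgebra K G]

/-- Elements satisfying the Chevalley–Serre relations form a basis of the Lie subalgebra which
they generate. -/
def chevalleyBasis (A : Matrix ι ι ℤ) (hA : A.Nondegenerate) {h e f : ι → G}
    (hlin : LinearIndependent K h) (t : ∀ i, IsSl2Triple (h i) (e i) (f i))
    (hhh : ∀ i j, ⁅h i, h j⁆ = 0) (hhe : ∀ i j, ⁅h j, e i⁆ = A i j • e i)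
    (hhf : ∀ i j, ⁅h j, f i⁆ = -A i j • f i) (hef : ∀ i j, i ≠ j → ⁅e i, f j⁆ = 0)
    {M : LieSubalgebra K G} (hM : LieSubalgebra.lieSpan K G (Set.range e ∪ Set.range f) = M)
    (he : ∀ i, e i ∈ M) (hf : ∀ i, f i ∈ M) (hh : ∀ i, h i ∈ M) :
    LieAlgebra.Basis ι (LieSubalgebra.lieSpan K M (Set.range fun i => (⟨h i, hh i⟩ : M))) where
  A := A
  h i := ⟨h i, hh i⟩
  e i := ⟨e i, he i⟩
  f i := ⟨f i, hf i⟩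
  cartan_eq_lieSpan := rfl
  span_ef := by
    set S := LieSubalgebra.lieSpan K M (Set.range (fun i => (⟨e i, he i⟩ : M)) ∪
      Set.range (fun i => (⟨f i, hf i⟩ : M)))
    have h1 : M ≤ S.map M.incl := by
      conv_lhs => rw [← hM]
      rw [LieSubalgebra.lieSpan_le]
      rintro _ (⟨i, rfl⟩ | ⟨i, rfl⟩)
      · exact ⟨⟨e i, he i⟩, LieSubalgebra.subset_lieSpan (Or.inl ⟨i, rfl⟩), rfl⟩
      · exact ⟨⟨f i, hf i⟩, LieSubalgebra.subset_lieSpan (Or.inr ⟨i, rfl⟩), rfl⟩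
    rw [eq_top_iff]
    intro x _
    obtain ⟨y, hy, hyx⟩ := h1 x.2
    have : y = x := Subtype.ext hyx
    exact this ▸ hy
  linInd := by
    refine LinearIndependent.of_comp M.toSubmodule.subtype ?_
    exact hlin
  nondegen := hA
  sl2 i :=
    { h_ne_zero := fun h0 => (t i).h_ne_zero (congrArg Subtype.val h0)
      lie_e_f := Subtype.ext (t i).lie_e_f
      lie_h_e_nsmul := Subtype.ext (t i).lie_h_e_nsmul
      lie_h_f_nsmul := Subtype.ext (t i).lie_h_f_nsmul }
  lie_h_h i j := Subtype.ext (hhh i j)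
  lie_h_e i j := Subtype.ext (hhe i j)
  lie_h_f i j := Subtype.ext (hhf i j)
  lie_e_f_ne i j hij := Subtype.ext (hef i j hij)

/-- In the Lie subalgebra generated by elements satisfying the Chevalley–Serre relations, the
elements commuting with all `h i` are linear combinations of the `h i`. -/
theorem mem_span_of_commute [FiniteDimensional K G] (A : Matrix ι ι ℤ) (hA : A.Nondegenerate)
    {h e f : ι → G}
    (hlin : LinearIndependent K h) (t : ∀ i, IsSl2Triple (h i) (e i) (f i))
    (hhh : ∀ i j, ⁅h i, h j⁆ = 0) (hhe : ∀ i j, ⁅h j, e i⁆ = A i j • e i)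
    (hhf : ∀ i j, ⁅h j, f i⁆ = -A i j • f i) (hef : ∀ i j, i ≠ j → ⁅e i, f j⁆ = 0)
    {z : G} (hz : z ∈ LieSubalgebra.lieSpan K G (Set.range e ∪ Set.range f))
    (hcomm : ∀ i, ⁅h i, z⁆ = 0) : z ∈ Submodule.span K (Set.range h) := by
  set M := LieSubalgebra.lieSpan K G (Set.range e ∪ Set.range f) with hM
  have he (i) : e i ∈ M := LieSubalgebra.subset_lieSpan (Or.inl ⟨i, rfl⟩)
  have hf (i) : f i ∈ M := LieSubalgebra.subset_lieSpan (Or.inr ⟨i, rfl⟩)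
  have hh (i) : h i ∈ M := by
    rw [← (t i).lie_e_f]; exact M.lie_mem (he i) (hf i)
  let b := chevalleyBasis A hA hlin t hhh hhe hhf hef hM.symm he hf hh
  have := Fintype.ofFinite ι
  have hbh : b.h = fun i => (⟨h i, hh i⟩ : M) := rfl
  have hCartan := b.isCartanSubalgebra
  have hspan := b.coe_cartan_eq_span
  rw [hbh] at hspan
  set C := LieSubalgebra.lieSpan K M (Set.range fun i => (⟨h i, hh i⟩ : M)) with hC
  have hzC : (⟨z, hz⟩ : M) ∈ C := by
    rw [← hCartan.self_normalizing, LieSubalgebra.mem_normalizer_iff']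
    intro y hy
    have h1 : C.toSubmodule ≤ LinearMap.ker (LieModule.toEnd K M M ⟨z, hz⟩) := by
      rw [hspan, Submodule.span_le]
      rintro _ ⟨i, rfl⟩
      change ⁅(⟨z, hz⟩ : M), (⟨h i, hh i⟩ : M)⁆ = 0
      rw [← lie_skew, neg_eq_zero]
      exact Subtype.ext (hcomm i)
    have h2 : ⁅(⟨z, hz⟩ : M), y⁆ = 0 := h1 hy
    rw [← lie_skew, h2, neg_zero]
    exact C.zero_mem
  have h3 : (⟨z, hz⟩ : M) ∈ Submodule.span K (Set.range fun i => (⟨h i, hh i⟩ : M)) := by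
    rw [← hspan]; exact hzC
  have h4 := Submodule.mem_map_of_mem (f := M.toSubmodule.subtype) h3
  rw [Submodule.map_span, ← Set.range_comp] at h4
  exact h4

end Generated

variable {K L : Type*} [Field K] [CharZero K] [LieRing L] [LieAlgebra K L]
  [FiniteDimensional K L] [LieAlgebra.IsKilling K L]
  {H : LieSubalgebra K L} [H.IsCartanSubalgebra] [IsTriangularizable K H L]

/-- A non-zero ideal contains a coroot. -/
theorem exists_coroot_mem_of_ne_bot (b : (rootSystem H).Base) (I : LieIdeal K L) (hI : I ≠ ⊥) :
    ∃ i : b.support, ((coroot (i.1 : Weight K H L) : H) : L) ∈ I := by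
  obtain ⟨e, f, hef⟩ := exists_sl2_family H
  have hnz (i : H.root) : (i : Weight K H L).IsNonZero := LieSubalgebra.isNonZero_coe_root i
  have hmem (i : H.root) (hi : e i ∈ I) : ((coroot (i : Weight K H L) : H) : L) ∈ I := by
    rw [← (hef i).1.lie_e_f, ← lie_skew]
    exact I.neg_mem (I.lie_mem hi)
  have hmem' (i : H.root) (hi : f i ∈ I) : ((coroot (i : Weight K H L) : H) : L) ∈ I := by
    rw [← (hef i).1.lie_e_f]
    exact I.lie_mem hi
  by_contra! hcon
  refine hI ?_
  have hH (x : H) (hx : (x : L) ∈ I) : x = 0 := by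
    have hx0 (i : b.support) : (i.1 : Weight K H L) x = 0 := by
      by_contra h0
      have h1 : ⁅(x : L), e i⁆ ∈ I := by
        rw [← lie_skew]; exact I.neg_mem (I.lie_mem hx)
      rw [← LieSubalgebra.coe_bracket_of_module,
        lie_eq_smul_of_mem_rootSpace (hef i).2.1 x] at h1
      refine hcon i (hmem i ?_)
      have := I.smul_mem ((i.1 : Weight K H L) x)⁻¹ h1
      rwa [inv_smul_smul₀ h0] at this
    have h2 : Submodule.span K ((rootSystem H).root '' b.support) = ⊤ := by
      rw [b.span_root_support]
      exact RootPairing.IsRootSystem.span_root_eq_top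
    have h3 : Submodule.span K ((rootSystem H).root '' b.support) ≤
        LinearMap.ker (Dual.eval K H x) := by
      rw [Submodule.span_le]
      rintro _ ⟨i, hi, rfl⟩
      exact hx0 ⟨i, hi⟩
    rw [h2, top_le_iff] at h3
    refine (Module.forall_dual_apply_eq_zero_iff K x).mp fun φ => ?_
    have : φ ∈ LinearMap.ker (Dual.eval K H x) := by rw [h3]; trivial
    exact this
  have h4 := lieIdeal_eq_inf_cartan_sup_biSup_rootSpace (H := H) I
  have h5 : I.restr H = ⊥ := by
    rw [h4, eq_bot_iff]
    refine sup_le ?_ (iSup₂_le fun α hα => ?_)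
    · rintro x ⟨hxI, hxH⟩
      have := hH ⟨x, hxH⟩ hxI
      exact congrArg Subtype.val this
    · have h6 := hH _ (hmem α (hα (hef α).2.1))
      exact absurd (congrArg Subtype.val h6) (hef α).1.h_ne_zero
  rw [eq_bot_iff]
  intro x hx
  have : x ∈ I.restr H := hx
  rw [h5] at this
  exact this

/-- A Lie algebra basis with the Cartan matrix of a Killing Lie algebra maps homomorphically
onto the Chevalley generators. -/
theorem exists_lieHom_simple (b : (rootSystem H).Base) {e f : H.root → L}
    (hef : ∀ α : H.root, IsSl2Triple ((coroot (α : Weight K H L) : H) : L) (e α) (f α) ∧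
      e α ∈ rootSpace H α.1 ∧ f α ∈ rootSpace H (-α.1 : H → K))
    {L' : Type*} [LieRing L'] [LieAlgebra K L'] [FiniteDimensional K L']
    {H' : LieSubalgebra K L'} (b' : LieAlgebra.Basis b.support H') (hA : b'.A = b.cartanMatrix) :
    ∃ φ : L' →ₗ⁅K⁆ L, ∀ i, φ (b'.e i) = e i ∧ φ (b'.f i) = f i := by
  set B := simpleBasis b hef with hB
  have hBA : B.A = b.cartanMatrix := rfl
  let h₂ : b.support → L × L' := fun i => (B.h i, b'.h i)
  let e₂ : b.support → L × L' := fun i => (B.e i, b'.e i)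
  let f₂ : b.support → L × L' := fun i => (B.f i, b'.f i)
  -- `M` will be the graph of the homomorphism. Its intersection with `L × 0` is an ideal of `L`; if
  -- nonzero, it contains a coroot `h j`. Then `(h j, 0)` commutes with all `(h i, h' i)` and is a
  -- linear combination of them, which contradicts the independence of the `h' i`.
  set M := LieSubalgebra.lieSpan K (L × L') (Set.range e₂ ∪ Set.range f₂) with hM
  have heM (i) : e₂ i ∈ M := LieSubalgebra.subset_lieSpan (Or.inl ⟨i, rfl⟩)
  have hfM (i) : f₂ i ∈ M := LieSubalgebra.subset_lieSpan (Or.inr ⟨i, rfl⟩)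
  have hlin : LinearIndependent K h₂ :=
    LinearIndependent.of_comp (LinearMap.fst K L L') B.linInd
  have t (i) : IsSl2Triple (h₂ i) (e₂ i) (f₂ i) :=
    { h_ne_zero := fun h0 => (B.sl2 i).h_ne_zero (congrArg Prod.fst h0)
      lie_e_f := Prod.ext (B.sl2 i).lie_e_f (b'.sl2 i).lie_e_f
      lie_h_e_nsmul := Prod.ext (B.sl2 i).lie_h_e_nsmul (b'.sl2 i).lie_h_e_nsmul
      lie_h_f_nsmul := Prod.ext (B.sl2 i).lie_h_f_nsmul (b'.sl2 i).lie_h_f_nsmul }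
  have hbot (x : L) (hx : (x, (0 : L')) ∈ M) : x = 0 := by
    let I₀ : Submodule K L := M.toSubmodule.comap (LinearMap.inl K L L')
    have hstab : ∀ y x : L, x ∈ I₀ → ⁅y, x⁆ ∈ I₀ := by
      let N : LieSubalgebra K L :=
        { carrier := {y | ∀ x ∈ I₀, ⁅y, x⁆ ∈ I₀}
          add_mem' := fun {y z} hy hz x hx => by
            rw [add_lie]; exact I₀.add_mem (hy x hx) (hz x hx)
          zero_mem' := fun x hx => by rw [zero_lie]; exact I₀.zero_mem
          smul_mem' := fun c y hy x hx => by rw [smul_lie]; exact I₀.smul_mem _ (hy x hx)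
          lie_mem' := fun {y z} hy hz x hx => by
            rw [lie_lie]; exact I₀.sub_mem (hy _ (hz x hx)) (hz _ (hy x hx)) }
      have hN : N = ⊤ := by
        rw [eq_top_iff, ← B.span_ef, LieSubalgebra.lieSpan_le]
        rintro _ (⟨i, rfl⟩ | ⟨i, rfl⟩) x hx
        · have := M.lie_mem (heM i) hx
          have h1 : ⁅e₂ i, LinearMap.inl K L L' x⁆ = (⁅B.e i, x⁆, 0) :=
            Prod.ext rfl (lie_zero _)
          change (⁅B.e i, x⁆, (0 : L')) ∈ M
          rw [← h1]; exact this
        · have := M.lie_mem (hfM i) hx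
          have h1 : ⁅f₂ i, LinearMap.inl K L L' x⁆ = (⁅B.f i, x⁆, 0) :=
            Prod.ext rfl (lie_zero _)
          change (⁅B.f i, x⁆, (0 : L')) ∈ M
          rw [← h1]; exact this
      intro y x hx
      have : y ∈ N := by rw [hN]; trivial
      exact this x hx
    let I : LieIdeal K L := { I₀ with lie_mem := fun {y x} hx => hstab y x hx }
    by_contra hx0
    have hI : I ≠ ⊥ := by
      intro hI
      have : x ∈ I := hx
      rw [hI] at this
      exact hx0 this
    obtain ⟨j, hj⟩ := exists_coroot_mem_of_ne_bot b I hI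
    have hjM : (B.h j, (0 : L')) ∈ M := hj
    have h5 : (B.h j, (0 : L')) ∈ Submodule.span K (Set.range h₂) := by
      refine mem_span_of_commute b.cartanMatrix b.cartanMatrix_nondegenerate hlin t
        (fun i k => Prod.ext (B.lie_h_h i k) (b'.lie_h_h i k))
        (fun i k => Prod.ext (B.lie_h_e i k) (hA ▸ b'.lie_h_e i k))
        (fun i k => Prod.ext (B.lie_h_f i k) (hA ▸ b'.lie_h_f i k))
        (fun i k hik => Prod.ext (B.lie_e_f_ne i k hik) (b'.lie_e_f_ne i k hik)) hjM
        (fun i => Prod.ext (B.lie_h_h i j) (lie_zero _))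
    have hfin : Fintype b.support := inferInstance
    obtain ⟨c, hc⟩ := (Submodule.mem_span_range_iff_exists_fun K).mp h5
    have hc2 : ∑ i, c i • b'.h i = 0 := by
      have := congrArg (LinearMap.snd K L L') hc
      simpa [h₂] using this
    have hc0 := Fintype.linearIndependent_iff.mp b'.linInd c hc2
    have hc1 : ∑ i, c i • B.h i = B.h j := by
      have := congrArg (LinearMap.fst K L L') hc
      simpa [h₂] using this
    simp only [hc0, zero_smul, Finset.sum_const_zero] at hc1
    exact (B.sl2 j).h_ne_zero hc1.symm
  have hex : ∀ y : L', ∃ x, (x, y) ∈ M := by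
    intro y
    let sndHom : L × L' →ₗ⁅K⁆ L' := { LinearMap.snd K L L' with map_lie' := rfl }
    have h1 : M.map sndHom = ⊤ := by
      rw [eq_top_iff, ← b'.span_ef, LieSubalgebra.lieSpan_le]
      rintro _ (⟨i, rfl⟩ | ⟨i, rfl⟩)
      · exact ⟨e₂ i, heM i, rfl⟩
      · exact ⟨f₂ i, hfM i, rfl⟩
    have h2 : y ∈ M.map sndHom := by rw [h1]; trivial
    obtain ⟨⟨x, y'⟩, hxy, h3⟩ := h2
    have : y' = y := h3
    exact ⟨x, this ▸ hxy⟩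
  choose φ hφ using hex
  have huniq (x : L) (y : L') (hxy : (x, y) ∈ M) : φ y = x := by
    have := M.sub_mem (hφ y) hxy
    rw [Prod.mk_sub_mk, sub_self] at this
    exact sub_eq_zero.mp (hbot _ this)
  refine ⟨{ toFun := φ
            map_add' := fun y z => huniq _ _ (M.add_mem (hφ y) (hφ z))
            map_smul' := fun c y => huniq _ _ (M.smul_mem c (hφ y))
            map_lie' := fun {y z} => huniq _ _ (M.lie_mem (hφ y) (hφ z)) },
    fun i => ⟨huniq _ _ (heM i), huniq _ _ (hfM i)⟩⟩

end Chevalley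

/-! ### The compact conjugation of a complex Killing Lie algebra -/

section Compact

open LieAlgebra LieAlgebra.IsKilling LieModule

/-- A complex Lie algebra with the conjugate scalar multiplication. -/
def Conj (L : Type*) := L

section ConjInst

variable (L : Type*) [LieRing L] [LieAlgebra ℂ L]

instance : LieRing (Conj L) := inferInstanceAs (LieRing L)

instance : Module ℂ (Conj L) := Module.compHom L (starRingEnd ℂ)

/-- The identity as a map to the conjugate Lie algebra. -/
def toConj : L →+ Conj L := AddMonoidHom.id L

variable {L} in
theorem toConj_smul (c : ℂ) (x : L) : toConj L (c • x) = (starRingEnd ℂ) c • toConj L x := by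
  change c • x = (starRingEnd ℂ) ((starRingEnd ℂ) c) • x
  rw [Complex.conj_conj]

variable {L} in
theorem smul_toConj (c : ℂ) (x : L) : c • toConj L x = toConj L ((starRingEnd ℂ) c • x) := rfl

variable {L} in
theorem toConj_lie (x y : L) : toConj L ⁅x, y⁆ = ⁅toConj L x, toConj L y⁆ := rfl

instance : LieAlgebra ℂ (Conj L) where
  lie_smul c x y := lie_smul (L := L) (M := L) ((starRingEnd ℂ) c) x y

instance [FiniteDimensional ℂ L] : FiniteDimensional ℂ (Conj L) :=
  Module.Finite.of_surjective (σ := starRingEnd ℂ)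
    { toFun := toConj L, map_add' := fun _ _ => rfl, map_smul' := toConj_smul }
    (fun x => ⟨x, rfl⟩)

end ConjInst

variable {L : Type*} [LieRing L] [LieAlgebra ℂ L]

/-- The basis of the conjugate Lie algebra in which `e` and `f` are interchanged up to sign. -/
def conjBasis {ι : Type*} [Finite ι] {H : LieSubalgebra ℂ L} (b : LieAlgebra.Basis ι H) :
    LieAlgebra.Basis ι (LieSubalgebra.lieSpan ℂ (Conj L)
      (Set.range fun i => toConj L (-b.h i))) where
  A := b.A
  h i := toConj L (-b.h i)
  e i := toConj L (-b.f i)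
  f i := toConj L (-b.e i)
  cartan_eq_lieSpan := rfl
  span_ef := by
    set S := LieSubalgebra.lieSpan ℂ (Conj L) (Set.range (fun i => toConj L (-b.f i)) ∪
      Set.range (fun i => toConj L (-b.e i)))
    let S' : LieSubalgebra ℂ L :=
      { carrier := {x | toConj L x ∈ S}
        add_mem' := fun {x y} hx hy => S.add_mem hx hy
        zero_mem' := S.zero_mem
        smul_mem' := fun c x hx => by
          change toConj L (c • x) ∈ S
          rw [toConj_smul]; exact S.smul_mem _ hx
        lie_mem' := fun {x y} hx hy => S.lie_mem hx hy }
    have h1 : S' = ⊤ := by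
      rw [eq_top_iff, ← b.span_ef, LieSubalgebra.lieSpan_le]
      rintro _ (⟨i, rfl⟩ | ⟨i, rfl⟩)
      · have : toConj L (-b.e i) ∈ S := LieSubalgebra.subset_lieSpan (Or.inr ⟨i, rfl⟩)
        exact (neg_mem_iff (S := LieSubalgebra ℂ (Conj L))).mp this
      · have : toConj L (-b.f i) ∈ S := LieSubalgebra.subset_lieSpan (Or.inl ⟨i, rfl⟩)
        exact (neg_mem_iff (S := LieSubalgebra ℂ (Conj L))).mp this
    rw [eq_top_iff]
    intro x _
    have : (x : L) ∈ S' := by rw [h1]; trivial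
    exact this
  linInd := by
    have := Fintype.ofFinite ι
    rw [Fintype.linearIndependent_iff]
    intro g hg i
    have h1 : ∑ j, (-(starRingEnd ℂ) (g j)) • b.h j = 0 := by
      have h2 : ∑ j, g j • toConj L (-b.h j) = toConj L (∑ j, (-(starRingEnd ℂ) (g j)) • b.h j) := by
        rw [map_sum]
        refine Finset.sum_congr rfl fun j _ => ?_
        rw [smul_toConj, smul_neg, neg_smul]
      exact h2.symm.trans hg
    have h3 := Fintype.linearIndependent_iff.mp b.linInd _ h1 i
    simpa using h3
  nondegen := b.nondegen
  sl2 i :=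
    { h_ne_zero := fun h0 => (b.sl2 i).h_ne_zero (neg_eq_zero.mp (show -b.h i = 0 from h0))
      lie_e_f := by
        change ⁅-b.f i, -b.e i⁆ = -b.h i
        rw [lie_neg, neg_lie, neg_neg, ← lie_skew, (b.sl2 i).lie_e_f]
      lie_h_e_nsmul := by
        have h1 : ⁅-b.h i, -b.f i⁆ = 2 • -b.f i := by
          rw [lie_neg, neg_lie, neg_neg, (b.sl2 i).lie_h_f_nsmul, smul_neg]
        exact h1
      lie_h_f_nsmul := by
        have h1 : ⁅-b.h i, -b.e i⁆ = -(2 • -b.e i) := by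
          rw [lie_neg, neg_lie, neg_neg, (b.sl2 i).lie_h_e_nsmul, smul_neg, neg_neg]
        exact h1 }
  lie_h_h i j := by
    change ⁅-b.h i, -b.h j⁆ = 0
    rw [lie_neg, neg_lie, neg_neg, b.lie_h_h]
  lie_h_e i j := by
    have h1 : ⁅-b.h j, -b.f i⁆ = b.A i j • -b.f i := by
      rw [lie_neg, neg_lie, neg_neg, b.lie_h_f, smul_neg, neg_smul]
    exact h1
  lie_h_f i j := by
    have h1 : ⁅-b.h j, -b.e i⁆ = -b.A i j • -b.e i := by
      rw [lie_neg, neg_lie, neg_neg, b.lie_h_e, smul_neg, neg_smul, neg_neg]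
    exact h1
  lie_e_f_ne i j hij := by
    change ⁅-b.f i, -b.e j⁆ = 0
    rw [lie_neg, neg_lie, neg_neg, ← lie_skew, b.lie_e_f_ne j i hij.symm, neg_zero]

/-- A conjugation of a complex Lie algebra: an antilinear involutive automorphism. -/
structure IsConjugation (θ : L →+ L) : Prop where
  smul : ∀ (c : ℂ) (x : L), θ (c • x) = (starRingEnd ℂ) c • θ x
  lie : ∀ x y, θ ⁅x, y⁆ = ⁅θ x, θ y⁆
  invol : ∀ x, θ (θ x) = x

variable [FiniteDimensional ℂ L] [LieAlgebra.IsKilling ℂ L]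
  {H : LieSubalgebra ℂ L} [H.IsCartanSubalgebra]

/-- A homomorphism from the conjugate algebra, with basis `-f i`, `-e i`, to `L` is an antilinear
endomorphism of `L`. Its square fixes the generators, hence everything. -/
theorem exists_isConjugation (b : (rootSystem H).Base) {e f : H.root → L}
    (hef : ∀ α : H.root, IsSl2Triple ((coroot (α : Weight ℂ H L) : H) : L) (e α) (f α) ∧
      e α ∈ rootSpace H α.1 ∧ f α ∈ rootSpace H (-α.1 : H → ℂ)) :
    ∃ θ : L →+ L, IsConjugation θ ∧ ∀ i ∈ b.support, θ (e i) = -f i ∧ θ (f i) = -e i := by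
  obtain ⟨φ, hφ⟩ := exists_lieHom_simple b hef (conjBasis (simpleBasis b hef)) rfl
  let θ : L →+ L := (φ : Conj L →ₗ[ℂ] L).toAddMonoidHom.comp (toConj L)
  have hθ (x : L) : θ x = φ (toConj L x) := rfl
  have hsmul (c : ℂ) (x : L) : θ (c • x) = (starRingEnd ℂ) c • θ x := by
    rw [hθ, hθ, toConj_smul, map_smul]
  have hlie (x y : L) : θ ⁅x, y⁆ = ⁅θ x, θ y⁆ := by
    rw [hθ, toConj_lie, LieHom.map_lie]; rfl
  have hf (i : b.support) : θ (f i) = -e i := by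
    have h1 : φ (toConj L (-f i)) = e i := (hφ i).1
    rw [map_neg, map_neg] at h1
    rw [hθ, ← h1, neg_neg]
  have he (i : b.support) : θ (e i) = -f i := by
    have h1 : φ (toConj L (-e i)) = f i := (hφ i).2
    rw [map_neg, map_neg] at h1
    rw [hθ, ← h1, neg_neg]
  refine ⟨θ, ⟨hsmul, hlie, ?_⟩, fun i hi => ⟨he ⟨i, hi⟩, hf ⟨i, hi⟩⟩⟩
  let S : LieSubalgebra ℂ L :=
    { carrier := {x | θ (θ x) = x}
      add_mem' := fun {x y} hx hy => by
        change θ (θ (x + y)) = x + y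
        rw [map_add, map_add]; exact congrArg₂ _ hx hy
      zero_mem' := by change θ (θ 0) = 0; rw [map_zero, map_zero]
      smul_mem' := fun c x hx => by
        change θ (θ (c • x)) = c • x
        rw [hsmul, hsmul, Complex.conj_conj]; exact congrArg _ hx
      lie_mem' := fun {x y} hx hy => by
        change θ (θ ⁅x, y⁆) = ⁅x, y⁆
        rw [hlie, hlie]; exact congrArg₂ _ hx hy }
  have hS : S = ⊤ := by
    rw [eq_top_iff, ← lieSpan_simple_eq_top b hef, LieSubalgebra.lieSpan_le]
    rintro _ (⟨i, rfl⟩ | ⟨i, rfl⟩)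
    · change θ (θ (e i)) = e i
      rw [he, map_neg, hf, neg_neg]
    · change θ (θ (f i)) = f i
      rw [hf, map_neg, he, neg_neg]
  intro x
  have : x ∈ S := by rw [hS]; trivial
  exact this

theorem mem_rootSpace_of_forall_lie {χ : H → ℂ} {x : L} (h : ∀ y : H, ⁅(y : L), x⁆ = χ y • x) :
    x ∈ rootSpace H χ := by
  rw [LieModule.mem_genWeightSpace]
  intro y
  refine ⟨1, ?_⟩
  rw [pow_one, LinearMap.sub_apply, LinearMap.smul_apply, Module.End.one_apply,
    LieModule.toEnd_apply_apply, LieSubalgebra.coe_bracket_of_module, h, sub_self]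

/-- The value is the sum of the squares of the integers `β (coroot α)`, and `β = α` contributes
`2²`. -/
theorem killingForm_coroot_re_pos (α : H.root) :
    0 < (killingForm ℂ L ((coroot (α : Weight ℂ H L) : H) : L)
      ((coroot (α : Weight ℂ H L) : H) : L)).re := by
  have h1 := congrArg (fun B => B (coroot (α : Weight ℂ H L)) (coroot (α : Weight ℂ H L)))
    (restrict_killingForm_eq_sum (H := H) (K := ℂ) (L := L))
  have h2 : killingForm ℂ L ((coroot (α : Weight ℂ H L) : H) : L)
      ((coroot (α : Weight ℂ H L) : H) : L) =
      ∑ β ∈ H.root, β (coroot (α : Weight ℂ H L)) * β (coroot (α : Weight ℂ H L)) := by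
    refine h1.trans ?_
    simp only [LinearMap.sum_apply, LinearMap.smulRight_apply, LinearMap.smul_apply, smul_eq_mul]
    rfl
  rw [h2, Complex.re_sum]
  have h3 (β : Weight ℂ H L) : (β (coroot (α : Weight ℂ H L)) * β (coroot (α : Weight ℂ H L))).re =
      ((chainBotCoeff (α : Weight ℂ H L) β : ℝ) - chainTopCoeff (α : Weight ℂ H L) β) ^ 2 := by
    rw [apply_coroot_eq_cast]
    have : (((chainBotCoeff (α : Weight ℂ H L) β : ℤ) - (chainTopCoeff (α : Weight ℂ H L) β : ℤ)
        : ℤ) : ℂ) = (((chainBotCoeff (α : Weight ℂ H L) β : ℝ)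
          - chainTopCoeff (α : Weight ℂ H L) β : ℝ) : ℂ) := by push_cast; ring
    rw [this, ← Complex.ofReal_mul, Complex.ofReal_re, sq]
  refine Finset.sum_pos' (fun β _ => by rw [h3]; positivity) ⟨α, α.2, ?_⟩
  rw [root_apply_coroot (LieSubalgebra.isNonZero_coe_root α)]
  norm_num

/-- `θ` interchanges the weights `χ` and `-χ`, so different weight spaces are orthogonal for `κ(x, θ
y)`. On the Cartan subalgebra the form is minus the sum of the `|β(x)|²`. On root spaces negativity
passes from `z` to `[e j, z]`, as `κ([e j, z], θ [e j, z])` is a positive integer times `κ(z, θ z)`.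
-/
theorem IsConjugation.killingForm_re_neg (b : (rootSystem H).Base) {e f : H.root → L}
    (hef : ∀ α : H.root, IsSl2Triple ((coroot (α : Weight ℂ H L) : H) : L) (e α) (f α) ∧
      e α ∈ rootSpace H α.1 ∧ f α ∈ rootSpace H (-α.1 : H → ℂ))
    {θ : L →+ L} (hθ : IsConjugation θ)
    (hθef : ∀ i ∈ b.support, θ (e i) = -f i ∧ θ (f i) = -e i) {x : L} (hx0 : x ≠ 0) :
    (killingForm ℂ L x (θ x)).re < 0 := by
  set κ := killingForm ℂ L with hκ
  have hnz (i : H.root) : (i : Weight ℂ H L).IsNonZero := LieSubalgebra.isNonZero_coe_root i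
  have hθ0 (y : L) (hy : y ≠ 0) : θ y ≠ 0 := fun h => hy (by
    rw [← hθ.invol y, h, map_zero])
  have hh (i : H.root) (hi : i ∈ b.support) : θ ((coroot (i : Weight ℂ H L) : H) : L) =
      -((coroot (i : Weight ℂ H L) : H) : L) := by
    rw [← (hef i).1.lie_e_f, hθ.lie, (hθef i hi).1, (hθef i hi).2, neg_lie, lie_neg, neg_neg,
      ← lie_skew]
  have hreal (χ : Weight ℂ H L) (i : H.root) : (starRingEnd ℂ) (χ (coroot (i : Weight ℂ H L))) =
      χ (coroot (i : Weight ℂ H L)) := by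
    rw [apply_coroot_eq_cast, map_intCast]
  have hspan : Submodule.span ℂ ((rootSystem H).coroot '' b.support) = ⊤ := by
    rw [b.span_coroot_support]
    exact RootPairing.IsRootSystem.span_coroot_eq_top
  have hθH (x : H) : ∃ x' : H, (x' : L) = θ x ∧
      ∀ χ : Weight ℂ H L, χ x' = -(starRingEnd ℂ) (χ x) := by
    have hx : x ∈ Submodule.span ℂ ((rootSystem H).coroot '' b.support) := by
      rw [hspan]; trivial
    induction hx using Submodule.span_induction with
    | mem x hx =>
      obtain ⟨i, hi, rfl⟩ := hx
      refine ⟨-coroot (i : Weight ℂ H L), ?_, fun χ => ?_⟩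
      · exact (hh i hi).symm
      · rw [rootSystem_coroot_apply, hreal]
        exact map_neg (Weight.toLinear ℂ H L χ) _
    | zero => exact ⟨0, by simp, fun χ => by
        have : χ (0 : H) = 0 := map_zero (Weight.toLinear ℂ H L χ)
        simp [this]⟩
    | add x y _ _ hx hy =>
      obtain ⟨x', hx', hx''⟩ := hx
      obtain ⟨y', hy', hy''⟩ := hy
      refine ⟨x' + y', by simp [hx', hy'], fun χ => ?_⟩
      have h1 := map_add (Weight.toLinear ℂ H L χ) x' y'
      have h2 := map_add (Weight.toLinear ℂ H L χ) x y
      simp only [Weight.toLinear_apply] at h1 h2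
      rw [h1, h2, hx'', hy'', map_add, neg_add]
    | smul c x _ hx =>
      obtain ⟨x', hx', hx''⟩ := hx
      refine ⟨(starRingEnd ℂ) c • x', by simp [hx', hθ.smul], fun χ => ?_⟩
      have h1 := map_smul (Weight.toLinear ℂ H L χ) ((starRingEnd ℂ) c) x'
      have h2 := map_smul (Weight.toLinear ℂ H L χ) c x
      simp only [Weight.toLinear_apply] at h1 h2
      rw [h1, h2, hx'', smul_eq_mul, smul_eq_mul, map_mul, mul_neg]
  have hmap (χ : Weight ℂ H L) (y : L) (hy : y ∈ rootSpace H χ) :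
      θ y ∈ rootSpace H (-χ : H → ℂ) := by
    refine mem_rootSpace_of_forall_lie fun z => ?_
    obtain ⟨z', hz', hz''⟩ := hθH z
    have h1 := lie_eq_smul_of_mem_rootSpace hy z'
    rw [LieSubalgebra.coe_bracket_of_module, hz'] at h1
    have h2 := congrArg θ h1
    rw [hθ.lie, hθ.invol, hθ.smul, hz'', map_neg, Complex.conj_conj] at h2
    exact h2
  have hscale (s : ℂ) (y : L) : (κ (s • y) (θ (s • y))).re = Complex.normSq s * (κ y (θ y)).re := by
    rw [hθ.smul, map_smul, map_smul, LinearMap.smul_apply, smul_eq_mul, smul_eq_mul,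
      ← mul_assoc, mul_comm ((starRingEnd ℂ) s), Complex.mul_conj, Complex.re_ofReal_mul]
  have hinv (x y z : L) : κ ⁅x, y⁆ z = κ x ⁅y, z⁆ := LieModule.traceForm_apply_lie_apply ℂ L L x y z
  have hsymm (x y : L) : κ x y = κ y x := LieModule.traceForm_comm ℂ L L x y
  have hscale' (s : ℂ) (y : L) (h0 : s • y ≠ 0) (h : (κ y (θ y)).re < 0) :
      (κ (s • y) (θ (s • y))).re < 0 := by
    rw [hscale]
    exact mul_neg_of_pos_of_neg (Complex.normSq_pos.mpr fun h => h0 (by rw [h, zero_smul])) h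
  have hroot (i : H.root) : ∀ y ∈ rootSpace H (i : Weight ℂ H L), y ≠ 0 →
      (κ y (θ y)).re < 0 := by
    refine b.induction_add i (p := fun i => ∀ y ∈ rootSpace H (i : Weight ℂ H L), y ≠ 0 →
      (κ y (θ y)).re < 0) ?_ ?_ ?_
    · intro i hi y hy hy0
      rw [eq_neg_of_reflectionPerm_self] at hy
      have h1 := hi (θ y) (by simpa using hmap _ _ hy) (hθ0 _ hy0)
      rwa [hθ.invol, hsymm] at h1
    · intro i hi y hy hy0
      obtain ⟨t, he, hf⟩ := hef i
      obtain ⟨s, rfl⟩ := mem_of_mem_rootSpace_of_mem (hnz i) t.e_ne_zero he hy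
      refine hscale' s _ hy0 ?_
      rw [(hθef i hi).1, map_neg, Complex.neg_re, neg_lt_zero]
      have h1 := killingForm_coroot_re_pos i
      rw [← hκ] at h1
      nth_rewrite 1 [← t.lie_e_f] at h1
      rw [hinv, ← lie_skew, t.lie_h_f_nsmul, neg_neg, ← Nat.cast_smul_eq_nsmul ℂ, map_smul,
        smul_eq_mul] at h1
      simpa using h1
    · intro i j k hk hi hj y hy hy0
      have hk' := coe_eq_of_root_eq_add hk
      obtain ⟨t, he, hf⟩ := hef j
      have hne : rootSpace H ((j : Weight ℂ H L) + (i : Weight ℂ H L) : H → ℂ) ≠ ⊥ := by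
        rw [add_comm, ← hk']; exact (k : Weight ℂ H L).2
      have hne' : rootSpace H (((-j.1 : Weight ℂ H L) : H → ℂ) + (-i.1 : Weight ℂ H L)) ≠ ⊥ := by
        have : (((-j.1 : Weight ℂ H L) : H → ℂ) + (-i.1 : Weight ℂ H L)) =
          (-k.1 : Weight ℂ H L) := by
          simp only [Weight.coe_neg, hk']; abel
        rw [this]; exact (-k.1 : Weight ℂ H L).2
      obtain ⟨c, hc, hc'⟩ := exists_lie_f_lie_e_eq_nsmul (hnz j) (hnz i) t he hf hne
      obtain ⟨c', hcp, hc''⟩ := exists_lie_f_lie_e_eq_nsmul (hnz j).neg (hnz i).neg t.symm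
          (by simpa using! hf) (by simpa using! he) hne'
      obtain ⟨z, hzi, hz0⟩ := (i : Weight ℂ H L).exists_ne_zero
      have h3 : ⁅e j, z⁆ ∈ rootSpace H (k : Weight ℂ H L) := by
        rw [hk', add_comm]; exact lie_mem_genWeightSpace_of_mem_genWeightSpace he hzi
      have h4 : ⁅e j, z⁆ ≠ 0 := by
        intro h0
        have := hc' z hzi
        rw [h0, lie_zero, ← Nat.cast_smul_eq_nsmul ℂ] at this
        exact (smul_ne_zero (Nat.cast_ne_zero.mpr hc.ne') hz0) this.symm
      obtain ⟨s, rfl⟩ := mem_of_mem_rootSpace_of_mem (hnz k) h4 h3 hy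
      refine hscale' s _ hy0 ?_
      have h5 := hc'' (θ z) (by simpa using! hmap _ _ hzi)
      rw [hθ.lie, (hθef j hj).1, ← lie_skew, map_neg, LinearMap.neg_apply, hinv, neg_lie,
        lie_neg, map_neg, neg_neg, h5, ← Nat.cast_smul_eq_nsmul ℂ, map_smul, smul_eq_mul]
      have h6 := hi z hzi hz0
      have h7 : (((c' : ℂ)) * κ z (θ z)).re = c' * (κ z (θ z)).re := by
        rw [← Complex.ofReal_natCast, Complex.re_ofReal_mul]
      rw [h7]
      exact mul_neg_of_pos_of_neg (by exact_mod_cast hcp) h6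
  have hzero (y : H) (hy0 : y ≠ 0) : (κ (y : L) (θ y)).re < 0 := by
    obtain ⟨y', hy', hy''⟩ := hθH y
    have h1 := congrArg (fun B => B y y')
      (restrict_killingForm_eq_sum (H := H) (K := ℂ) (L := L))
    have h2 : κ (y : L) (θ y) = ∑ β ∈ H.root, β y * β y' := by
      rw [← hy']
      refine h1.trans ?_
      simp only [LinearMap.sum_apply, LinearMap.smulRight_apply, LinearMap.smul_apply,
        smul_eq_mul]
      rfl
    rw [h2, Complex.re_sum]
    have h3 (β : Weight ℂ H L) : (β y * β y').re = -Complex.normSq (β y) := by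
      rw [hy'', mul_neg, Complex.mul_conj, Complex.neg_re, Complex.ofReal_re]
    simp_rw [h3]
    rw [Finset.sum_neg_distrib, neg_lt_zero]
    by_contra hcon
    have h4 := Finset.sum_nonneg (s := H.root) fun (β : Weight ℂ H L) _ => Complex.normSq_nonneg (β y)
    have h5 := (Finset.sum_eq_zero_iff_of_nonneg
      (fun (β : Weight ℂ H L) _ => Complex.normSq_nonneg (β y))).mp (le_antisymm (not_lt.mp hcon) h4)
    refine hy0 ((Module.forall_dual_apply_eq_zero_iff ℂ y).mp fun φ => ?_)
    have h6 : φ ∈ Submodule.span ℂ (Set.range (rootSystem H).root) := by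
      rw [RootPairing.IsRootSystem.span_root_eq_top]; trivial
    have h7 : Submodule.span ℂ (Set.range (rootSystem H).root) ≤
        LinearMap.ker (Dual.eval ℂ H y) := by
      rw [Submodule.span_le]
      rintro _ ⟨i, rfl⟩
      exact Complex.normSq_eq_zero.mp (h5 i.1 i.2)
    exact h7 h6
  have hall (χ : Weight ℂ H L) (y : L) (hy : y ∈ rootSpace H χ) (hy0 : y ≠ 0) :
      (κ y (θ y)).re < 0 := by
    by_cases hχ : χ.IsZero
    · rw [hχ.eq] at hy
      have hyH : y ∈ H := by
        have h1 : rootSpace H (0 : H → ℂ) = H.toLieSubmodule := rootSpace_zero_eq ℂ L H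
        have h2 : y ∈ rootSpace H (0 : H → ℂ) := hy
        rw [h1] at h2
        exact h2
      exact hzero ⟨y, hyH⟩ fun h => hy0 (congrArg Subtype.val h)
    · exact hroot ⟨χ, by simpa using hχ⟩ y hy hy0
  have htop := congrArg LieSubmodule.toSubmodule (iSup_genWeightSpace_eq_top' ℂ H L)
  rw [LieSubmodule.iSup_toSubmodule, LieSubmodule.top_toSubmodule] at htop
  have hxtop : x ∈ (⊤ : Submodule ℂ L) := trivial
  rw [← htop, Submodule.mem_iSup_iff_exists_finsupp] at hxtop
  obtain ⟨g, hg, rfl⟩ := hxtop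
  have hcross (χ χ' : Weight ℂ H L) (hne : χ ≠ χ') : κ (g χ) (θ (g χ')) = 0 := by
    refine killingForm_apply_eq_zero_of_mem_rootSpace_of_add_ne_zero ℂ L H (hg χ)
      (hmap _ _ (hg χ')) ?_
    rw [← sub_eq_add_neg, sub_ne_zero]
    exact fun h => hne (DFunLike.coe_injective h)
  have hsum : κ (g.sum fun _ xi => xi) (θ (g.sum fun _ xi => xi)) =
      ∑ χ ∈ g.support, κ (g χ) (θ (g χ)) := by
    rw [Finsupp.sum, map_sum θ, map_sum κ, LinearMap.sum_apply]
    refine Finset.sum_congr rfl fun χ hχ => ?_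
    rw [map_sum]
    exact Finset.sum_eq_single_of_mem χ hχ fun χ' _ hne => hcross χ χ' hne.symm
  rw [hsum, Complex.re_sum]
  refine Finset.sum_neg (fun χ hχ => hall χ _ (hg χ) (Finsupp.mem_support_iff.mp hχ)) ?_
  rw [Finset.nonempty_iff_ne_empty]
  intro h0
  refine hx0 ?_
  rw [Finsupp.sum, h0, Finset.sum_empty]

variable (L) in
/-- A complex Lie algebra with non-degenerate Killing form has a compact conjugation. -/
theorem exists_compact_conjugation : ∃ θ : L →+ L, IsConjugation θ ∧
    ∀ x, x ≠ 0 → (killingForm ℂ L x (θ x)).re < 0 := by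
  obtain ⟨x, hx⟩ := LieAlgebra.exists_isCartanSubalgebra_engel ℂ L
  obtain ⟨b⟩ := RootPairing.nonempty_base (P := rootSystem (LieSubalgebra.engel ℂ x))
  obtain ⟨e, f, hef⟩ := exists_sl2_family (LieSubalgebra.engel ℂ x)
  obtain ⟨θ, hθ, hθef⟩ := exists_isConjugation b hef
  exact ⟨θ, hθ, fun y hy => hθ.killingForm_re_neg b hef hθef hy⟩

end Compact

/-! ### A Perron–Frobenius theorem for cones -/

section PerronFrobenius

/-- `u` is an order unit of the cone `K`. -/
def IsOrderUnit {W : Type*} [AddCommGroup W] [Module ℝ W] (K : Set W) (u : W) : Prop :=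
  ∀ w, ∃ C : ℝ, 0 < C ∧ C • u - w ∈ K

/-- A salient closed convex cone, given by a family of linear inequalities. -/
theorem exists_perron_eigenvector {W α : Type*} [NormedAddCommGroup W] [NormedSpace ℝ W]
    [FiniteDimensional ℝ W] (φ : α → W →ₗ[ℝ] ℝ)
    (hsal : ∀ w, (∀ a, φ a w = 0) → w = 0) {Ψ : W →ₗ[ℝ] W}
    (hΨ : ∀ w ∈ {w | ∀ a, 0 ≤ φ a w}, Ψ w ∈ {w | ∀ a, 0 ≤ φ a w})
    (hirr : ∀ w ∈ {w | ∀ a, 0 ≤ φ a w}, w ≠ 0 →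
      ∃ m : ℕ, IsOrderUnit {w | ∀ a, 0 ≤ φ a w} (((1 + Ψ) ^ m) w))
    {w₀ : W} (hw₀ : w₀ ∈ {w | ∀ a, 0 ≤ φ a w}) (hw₀0 : w₀ ≠ 0) :
    ∃ (P : W) (C : ℝ), IsOrderUnit {w | ∀ a, 0 ≤ φ a w} P ∧ Ψ P = C • P ∧
      P ∈ {w | ∀ a, 0 ≤ φ a w} ∧ ∀ P', Ψ P' = C • P' → ∃ t : ℝ, P' = t • P := by
  set K : Set W := {w | ∀ a, 0 ≤ φ a w} with hK
  have hadd {x y : W} (hx : x ∈ K) (hy : y ∈ K) : x + y ∈ K := fun a => by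
    rw [map_add]; exact add_nonneg (hx a) (hy a)
  have hsmul {c : ℝ} (hc : 0 ≤ c) {x : W} (hx : x ∈ K) : c • x ∈ K := fun a => by
    rw [map_smul, smul_eq_mul]; exact mul_nonneg hc (hx a)
  have hneg {x : W} (hx : x ∈ K) (hx' : -x ∈ K) : x = 0 := hsal x fun a => by
    have h1 := hx a
    have h2 := hx' a
    rw [map_neg] at h2
    linarith
  have hclosed : IsClosed K := by
    have : K = ⋂ a, {w | 0 ≤ φ a w} := by ext; simp [hK]
    rw [this]
    exact isClosed_iInter fun a => isClosed_le continuous_const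
      (φ a).continuous_of_finiteDimensional
  have hpow (m : ℕ) {x : W} (hx : x ∈ K) : ((1 + Ψ) ^ m) x ∈ K := by
    induction m with
    | zero => simpa using hx
    | succ m ih =>
      rw [pow_succ', Module.End.mul_apply, LinearMap.add_apply, Module.End.one_apply]
      exact hadd ih (hΨ _ ih)
  have hpow0 (m : ℕ) {x : W} (hx : x ∈ K) (hx0 : x ≠ 0) : ((1 + Ψ) ^ m) x ≠ 0 := by
    induction m with
    | zero => simpa using hx0
    | succ m ih =>
      rw [pow_succ', Module.End.mul_apply, LinearMap.add_apply, Module.End.one_apply]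
      intro h0
      refine ih (hneg (hpow m hx) ?_)
      rw [← eq_neg_of_add_eq_zero_right h0]
      exact hΨ _ (hpow m hx)
  -- eigenvectors in the cone are order units
  have hunit {C : ℝ} {x : W} (hx : x ∈ K) (hx0 : x ≠ 0) (hC : 0 ≤ C) (hxC : Ψ x = C • x) :
      IsOrderUnit K x := by
    obtain ⟨m, hm⟩ := hirr x hx hx0
    have h1 (m : ℕ) : ((1 + Ψ) ^ m) x = (1 + C) ^ m • x := by
      induction m with
      | zero => simp
      | succ m ih =>
        rw [pow_succ', Module.End.mul_apply, ih, map_smul, LinearMap.add_apply,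
          Module.End.one_apply, hxC, pow_succ, mul_smul, add_smul, one_smul]
    intro w
    obtain ⟨D, hD, hw⟩ := hm w
    refine ⟨D * (1 + C) ^ m, by positivity, ?_⟩
    rw [mul_smul, ← h1]
    exact hw
  obtain ⟨m₀, hm₀⟩ := hirr w₀ hw₀ hw₀0
  set P₀ := ((1 + Ψ) ^ m₀) w₀ with hP₀
  have hP₀K : P₀ ∈ K := hpow m₀ hw₀
  have hP₀0 : P₀ ≠ 0 := hpow0 m₀ hw₀ hw₀0
  obtain ⟨C₀, hC₀, hC₀K⟩ := hm₀ (Ψ P₀)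
  -- The eigenvalue is the least `c ≥ 0` such that `c w - Ψ w` is in the cone for some unit vector
  -- `w` of the cone. At a minimum this difference vanishes: otherwise a power of `1 + Ψ` turns it
  -- into an order unit, which leaves room to decrease `c`.
  let S : Set (ℝ × W) := {p | p.1 ∈ Set.Icc 0 C₀ ∧ p.2 ∈ K ∧ ‖p.2‖ = 1 ∧ p.1 • p.2 - Ψ p.2 ∈ K}
  have hΨc : Continuous Ψ := Ψ.continuous_of_finiteDimensional
  have : ProperSpace W := FiniteDimensional.proper ℝ W
  have hS : IsCompact S := by
    have h1 : IsCompact (Set.Icc (0 : ℝ) C₀ ×ˢ Metric.closedBall (0 : W) 1) :=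
      isCompact_Icc.prod (isCompact_closedBall _ _)
    refine h1.of_isClosed_subset ?_ ?_
    · have h2 : IsClosed {p : ℝ × W | p.1 ∈ Set.Icc 0 C₀} :=
        isClosed_Icc.preimage continuous_fst
      have h3 : IsClosed {p : ℝ × W | p.2 ∈ K} := hclosed.preimage continuous_snd
      have h4 : IsClosed {p : ℝ × W | ‖p.2‖ = 1} :=
        isClosed_eq (continuous_snd.norm) continuous_const
      have h5 : IsClosed {p : ℝ × W | p.1 • p.2 - Ψ p.2 ∈ K} :=
        hclosed.preimage ((continuous_fst.smul continuous_snd).sub (hΨc.comp continuous_snd))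
      exact h2.inter (h3.inter (h4.inter h5))
    · rintro ⟨c, w⟩ ⟨h2, _, h4, _⟩
      exact ⟨h2, by simpa using h4.le⟩
  have hnormalize {c : ℝ} {x : W} (hx : x ∈ K) (hx0 : x ≠ 0) (hc : c ∈ Set.Icc 0 C₀)
      (hxc : c • x - Ψ x ∈ K) : (c, ‖x‖⁻¹ • x) ∈ S := by
    refine ⟨hc, hsmul (by positivity) hx, ?_, ?_⟩
    · rw [norm_smul, norm_inv, norm_norm, inv_mul_cancel₀ (norm_ne_zero_iff.mpr hx0)]
    · change c • (‖x‖⁻¹ • x) - Ψ (‖x‖⁻¹ • x) ∈ K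
      rw [map_smul, smul_comm, ← smul_sub]
      exact hsmul (by positivity) hxc
  obtain ⟨⟨C, P⟩, ⟨hC, hPK, hP1, hCP⟩, hmin⟩ := hS.exists_isMinOn
    ⟨_, hnormalize hP₀K hP₀0 ⟨hC₀.le, le_rfl⟩ hC₀K⟩ continuous_fst.continuousOn
  simp only at hC hPK hP1 hCP
  have hP0 : P ≠ 0 := by rw [← norm_ne_zero_iff, hP1]; exact one_ne_zero
  have hQ : C • P - Ψ P = 0 := by
    by_contra hQ0
    obtain ⟨m, hm⟩ := hirr _ hCP hQ0
    set P' := ((1 + Ψ) ^ m) P with hP'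
    have hcomm : Commute ((1 + Ψ) ^ m) Ψ :=
      ((Commute.one_left Ψ).add_left (Commute.refl Ψ)).pow_left m
    have h1 : ((1 + Ψ) ^ m) (C • P - Ψ P) = C • P' - Ψ P' := by
      rw [map_sub, map_smul, hP', ← Module.End.mul_apply, hcomm.eq, Module.End.mul_apply]
    rw [h1] at hm
    obtain ⟨D, hD, hDK⟩ := hm P'
    have h2 : (C - D⁻¹) • P' - Ψ P' ∈ K := by
      have := hsmul (inv_nonneg.mpr hD.le) hDK
      rw [smul_sub, smul_smul, inv_mul_cancel₀ hD.ne', one_smul] at this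
      convert this using 1
      rw [sub_smul]; abel
    have hP'K := hpow m hPK
    have hP'0 := hpow0 m hPK hP0
    rcases le_or_gt 0 (C - D⁻¹) with h3 | h3
    · have h4 := hmin (hnormalize hP'K hP'0
        ⟨h3, (sub_le_self _ (inv_nonneg.mpr hD.le)).trans hC.2⟩ h2)
      have h5 : C ≤ C - D⁻¹ := h4
      have := inv_pos.mpr hD
      linarith
    · have h4 := hadd h2 (hΨ _ hP'K)
      rw [sub_add_cancel] at h4
      have h5 := hsmul (neg_nonneg.mpr h3.le) hP'K
      rw [neg_smul] at h5
      exact (smul_ne_zero h3.ne hP'0) (hneg h4 h5)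
  have hΨP : Ψ P = C • P := (sub_eq_zero.mp hQ).symm
  have hPu := hunit hPK hP0 hC.1 hΨP
  refine ⟨P, C, hPu, hΨP, hPK, fun P' hP' => ?_⟩
  -- For the least such `t`, a nonzero `t P - P'` would be an eigenvector in the cone, hence an
  -- order unit, and `t` could be decreased further.
  let T : Set ℝ := {t | t • P - P' ∈ K}
  obtain ⟨D, hD, hDK⟩ := hPu P'
  obtain ⟨E, hE, hEK⟩ := hPu (-P')
  have hTc : IsClosed T := hclosed.preimage
    ((continuous_id.smul continuous_const).sub continuous_const)
  have hTb : BddBelow T := by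
    refine ⟨-E, fun t ht => ?_⟩
    by_contra! hlt
    have h1 : t • P - P' + (E • P - -P') ∈ K := hadd ht hEK
    have h2 : t • P - P' + (E • P - -P') = (t + E) • P := by rw [add_smul]; abel
    rw [h2] at h1
    have h3 := hsmul (show 0 ≤ -(t + E) by linarith) hPK
    rw [neg_smul] at h3
    exact smul_ne_zero (show t + E ≠ 0 by linarith) hP0 (hneg h1 h3)
  have ht₀ := hTc.csInf_mem ⟨D, hDK⟩ hTb
  set t₀ := sInf T
  refine ⟨t₀, ?_⟩
  by_contra hne
  have hR0 : t₀ • P - P' ≠ 0 := fun h => hne (sub_eq_zero.mp h).symm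
  have hRu := hunit ht₀ hR0 hC.1 (by rw [map_sub, map_smul, hΨP, hP', smul_sub, smul_comm])
  obtain ⟨F, hF, hFK⟩ := hRu P
  have h1 : t₀ - F⁻¹ ∈ T := by
    have := hsmul (inv_nonneg.mpr hF.le) hFK
    rw [smul_sub, smul_smul, inv_mul_cancel₀ hF.ne', one_smul] at this
    change (t₀ - F⁻¹) • P - P' ∈ K
    convert this using 1
    rw [sub_smul]; abel
  have h2 := csInf_le hTb h1
  have := inv_pos.mpr hF
  change t₀ ≤ t₀ - F⁻¹ at h2
  linarith

end PerronFrobenius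

/-! ### Inner products and symmetric forms -/

section Inner

variable {E : Type*} [AddCommGroup E] [Module ℝ E]

/-- Symmetric positive definite bilinear forms. -/
structure IsInner (g : LinearMap.BilinForm ℝ E) : Prop where
  symm : ∀ x y, g x y = g y x
  pos : ∀ x, x ≠ 0 → 0 < g x x

theorem IsInner.nonneg {g : LinearMap.BilinForm ℝ E} (hg : IsInner g) (x : E) : 0 ≤ g x x := by
  rcases eq_or_ne x 0 with rfl | h
  · simp
  · exact (hg.pos x h).le

theorem IsInner.eq_zero {g : LinearMap.BilinForm ℝ E} (hg : IsInner g) {x : E} (h : g x x = 0) :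
    x = 0 := by
  by_contra h0
  exact (hg.pos x h0).ne' h

/-- The Cauchy–Schwarz inequality for isotropic vectors of a semidefinite form. -/
theorem eq_zero_of_isotropic {P : LinearMap.BilinForm ℝ E} (hs : ∀ x y, P x y = P y x)
    (hP : ∀ x, 0 ≤ P x x) {v : E} (hv : P v v = 0) (w : E) : P v w = 0 := by
  by_contra h0
  have h1 (t : ℝ) : 0 ≤ 2 * t * P v w + P w w := by
    have := hP (t • v + w)
    simp only [map_add, map_smul, LinearMap.add_apply, LinearMap.smul_apply, smul_eq_mul, hv,
      hs w v] at this
    linarith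
  have h2 := h1 (-(P w w + 1) / (2 * P v w))
  -- For this `t` the inequality `h1` reads `0 ≤ -1`.
  have h3 : 2 * (-(P w w + 1) / (2 * P v w)) * P v w = -(P w w + 1) := by field_simp
  rw [h3] at h2
  linarith

variable [FiniteDimensional ℝ E]

theorem IsInner.exists_orthonormal {g : LinearMap.BilinForm ℝ E} (hg : IsInner g) :
    ∃ b : Basis (Fin (finrank ℝ E)) ℝ E, ∀ i j, g (b i) (b j) = if i = j then 1 else 0 := by
  have : Invertible (2 : ℝ) := invertibleOfNonzero two_ne_zero
  obtain ⟨v, hv⟩ := LinearMap.BilinForm.exists_orthogonal_basis (B := g) ⟨fun x y => hg.symm x y⟩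
  have hpos (i) : 0 < g (v i) (v i) := hg.pos _ (v.ne_zero i)
  have hunit (i) : IsUnit (Real.sqrt (g (v i) (v i)))⁻¹ :=
    (inv_ne_zero (Real.sqrt_ne_zero'.mpr (hpos i))).isUnit
  refine ⟨v.isUnitSMul hunit, fun i j => ?_⟩
  rw [Basis.isUnitSMul_apply, Basis.isUnitSMul_apply, map_smul, map_smul, LinearMap.smul_apply,
    smul_eq_mul, smul_eq_mul]
  split_ifs with h
  · subst h
    have := Real.mul_self_sqrt (hpos i).le
    have h0 := Real.sqrt_ne_zero'.mpr (hpos i)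
    field_simp
    rw [sq, this]
  · have : g (v i) (v j) = 0 := hv h
    rw [this, mul_zero, mul_zero]

theorem repr_eq_of_orthonormal {n : ℕ} {g : LinearMap.BilinForm ℝ E} {b : Basis (Fin n) ℝ E}
    (hb : ∀ i j, g (b i) (b j) = if i = j then 1 else 0) (x : E) (i : Fin n) :
    b.repr x i = g (b i) x := by
  conv_rhs => rw [← b.sum_repr x]
  simp only [map_sum, map_smul, hb, smul_eq_mul, mul_ite, mul_one, mul_zero, Finset.sum_ite_eq,
    Finset.mem_univ, if_true]

theorem trace_eq_of_orthonormal {n : ℕ} {g : LinearMap.BilinForm ℝ E} {b : Basis (Fin n) ℝ E}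
    (hb : ∀ i j, g (b i) (b j) = if i = j then 1 else 0) (T : Module.End ℝ E) :
    LinearMap.trace ℝ E T = ∑ i, g (b i) (T (b i)) := by
  rw [LinearMap.trace_eq_matrix_trace ℝ b, Matrix.trace]
  exact Finset.sum_congr rfl fun i _ => by
    rw [Matrix.diag_apply, LinearMap.toMatrix_apply, repr_eq_of_orthonormal hb]

theorem IsInner.exists_le {g : LinearMap.BilinForm ℝ E} (hg : IsInner g)
    (w : LinearMap.BilinForm ℝ E) : ∃ C : ℝ, 0 < C ∧ ∀ x, w x x ≤ C * g x x := by
  obtain ⟨b, hb⟩ := hg.exists_orthonormal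
  refine ⟨∑ i, ∑ j, |w (b i) (b j)| + 1, by positivity, fun x => ?_⟩
  have hx := b.sum_repr x
  set c := b.repr x with hc
  have h1 : g x x = ∑ i, c i ^ 2 := by
    conv_lhs => rw [← hx]
    simp [hb, sq]
  have h2 : w x x = ∑ i, ∑ j, c i * c j * w (b i) (b j) := by
    conv_lhs => rw [← hx]
    simp only [map_sum, map_smul, LinearMap.sum_apply, LinearMap.smul_apply, smul_eq_mul,
      Finset.mul_sum, mul_assoc]
    rw [Finset.sum_comm]
    exact Finset.sum_congr rfl fun i _ => Finset.sum_congr rfl fun j _ => by ring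
  have h3 (i) : c i ^ 2 ≤ g x x := by
    rw [h1]
    exact Finset.single_le_sum (f := fun i => c i ^ 2) (fun i _ => sq_nonneg _) (Finset.mem_univ i)
  have h4 : w x x ≤ ∑ i, ∑ j, |w (b i) (b j)| * g x x := by
    rw [h2]
    refine Finset.sum_le_sum fun i _ => Finset.sum_le_sum fun j _ => ?_
    have h5 : |c i * c j| ≤ g x x := by
      rw [abs_le]
      constructor <;> nlinarith [h3 i, h3 j, sq_nonneg (c i + c j), sq_nonneg (c i - c j)]
    calc c i * c j * w (b i) (b j) ≤ |c i * c j * w (b i) (b j)| := le_abs_self _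
      _ = |w (b i) (b j)| * |c i * c j| := by rw [abs_mul, mul_comm]
      _ ≤ _ := mul_le_mul_of_nonneg_left h5 (abs_nonneg _)
  refine h4.trans ?_
  simp_rw [← Finset.sum_mul]
  rw [add_mul, one_mul]
  linarith [hg.nonneg x]

variable (E) in
/-- The space of symmetric bilinear forms. -/
def symForms : Submodule ℝ (LinearMap.BilinForm ℝ E) where
  carrier := {P | ∀ x y, P x y = P y x}
  add_mem' {P Q} hP hQ x y := by
    change P x y + Q x y = P y x + Q y x
    rw [hP, hQ]
  zero_mem' _ _ := rfl
  smul_mem' c P hP x y := by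
    change c * P x y = c * P y x
    rw [hP]

instance : AddCommGroup (symForms E) := Module.addCommMonoidToAddCommGroup ℝ

theorem symForms_ext {P Q : symForms E} (h : ∀ v, P.1 v v = Q.1 v v) : P = Q := by
  refine Subtype.ext (LinearMap.ext₂ fun x y => ?_)
  have h1 := h (x + y)
  simp only [map_add, LinearMap.add_apply] at h1
  have h2 := h x
  have h3 := h y
  have h4 := P.2 x y
  have h5 := Q.2 x y
  linarith

end Inner

/-- The statement does not involve the norm, so one pulled back from coordinates will do. -/
theorem exists_perron_eigenvector' {W α : Type*} [AddCommGroup W] [Module ℝ W]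
    [FiniteDimensional ℝ W] (φ : α → W →ₗ[ℝ] ℝ)
    (hsal : ∀ w, (∀ a, φ a w = 0) → w = 0) {Ψ : W →ₗ[ℝ] W}
    (hΨ : ∀ w ∈ {w | ∀ a, 0 ≤ φ a w}, Ψ w ∈ {w | ∀ a, 0 ≤ φ a w})
    (hirr : ∀ w ∈ {w | ∀ a, 0 ≤ φ a w}, w ≠ 0 →
      ∃ m : ℕ, IsOrderUnit {w | ∀ a, 0 ≤ φ a w} (((1 + Ψ) ^ m) w))
    {w₀ : W} (hw₀ : w₀ ∈ {w | ∀ a, 0 ≤ φ a w}) (hw₀0 : w₀ ≠ 0) :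
    ∃ (P : W) (C : ℝ), IsOrderUnit {w | ∀ a, 0 ≤ φ a w} P ∧ Ψ P = C • P ∧
      P ∈ {w | ∀ a, 0 ≤ φ a w} ∧ ∀ P', Ψ P' = C • P' → ∃ t : ℝ, P' = t • P := by
  let e := (finBasis ℝ W).equivFun
  let _ : NormedAddCommGroup W :=
    NormedAddCommGroup.induced W (Fin (finrank ℝ W) → ℝ) e.toLinearMap e.injective
  let _ : NormedSpace ℝ W := NormedSpace.induced ℝ W (Fin (finrank ℝ W) → ℝ) e.toLinearMap
  exact exists_perron_eigenvector φ hsal hΨ hirr hw₀ hw₀0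

/-! ### Invariant inner products of compact Lie algebras -/

section Invariant

variable {u : Type*} [LieRing u] [LieAlgebra ℝ u] [FiniteDimensional ℝ u]
  [LieAlgebra.IsKilling ℝ u] {E : Type*} [AddCommGroup E] [Module ℝ E] [FiniteDimensional ℝ E]
  [LieRingModule u E] [LieModule ℝ u E]

/-- The action of an element of the Lie algebra on symmetric forms, up to sign. -/
def actForm (E : Type*) [AddCommGroup E] [Module ℝ E] [FiniteDimensional ℝ E]
    [LieRingModule u E] [LieModule ℝ u E] (x : u) : symForms E →ₗ[ℝ] symForms E where
  toFun P := ⟨P.1.compl₁₂ (LieModule.toEnd ℝ u E x) LinearMap.id +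
      P.1.compl₁₂ LinearMap.id (LieModule.toEnd ℝ u E x), fun v w => by
    simp only [LinearMap.add_apply, LinearMap.compl₁₂_apply, LinearMap.id_apply]
    rw [P.2 _ w, P.2 v, add_comm]⟩
  map_add' P Q := symForms_ext fun v => by
    simp only [Submodule.coe_add, LinearMap.add_apply, LinearMap.compl₁₂_apply, LinearMap.id_apply]
    ring
  map_smul' c P := symForms_ext fun v => by
    simp only [Submodule.coe_smul, LinearMap.add_apply, LinearMap.compl₁₂_apply,
      LinearMap.id_apply, LinearMap.smul_apply, smul_eq_mul, RingHom.id_apply]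
    ring

theorem actForm_apply (x : u) (P : symForms E) (v w : E) :
    (actForm E x P).1 v w = P.1 ⁅x, v⁆ w + P.1 v ⁅x, w⁆ := rfl

/-- The positive operator on symmetric forms attached to a finite family of elements. -/
def posOp (E : Type*) [AddCommGroup E] [Module ℝ E] [FiniteDimensional ℝ E]
    [LieRingModule u E] [LieModule ℝ u E] {n : ℕ} (X : Fin n → u) :
    symForms E →ₗ[ℝ] symForms E where
  toFun P := ⟨∑ i, P.1.compl₁₂ (LieModule.toEnd ℝ u E (X i)) (LieModule.toEnd ℝ u E (X i)),
    fun v w => by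
      simp only [LinearMap.sum_apply, LinearMap.compl₁₂_apply]
      exact Finset.sum_congr rfl fun i _ => P.2 _ _⟩
  map_add' P Q := symForms_ext fun v => by
    simp only [Submodule.coe_add, LinearMap.add_apply, LinearMap.sum_apply,
      LinearMap.compl₁₂_apply, Finset.sum_add_distrib]
  map_smul' c P := symForms_ext fun v => by
    simp only [Submodule.coe_smul, LinearMap.sum_apply, LinearMap.compl₁₂_apply,
      LinearMap.smul_apply, smul_eq_mul, RingHom.id_apply, Finset.mul_sum]

theorem posOp_apply {n : ℕ} (X : Fin n → u) (P : symForms E) (v w : E) :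
    (posOp E X P).1 v w = ∑ i, P.1 ⁅X i, v⁆ ⁅X i, w⁆ := by
  change (∑ i, P.1.compl₁₂ (LieModule.toEnd ℝ u E (X i)) (LieModule.toEnd ℝ u E (X i))) v w = _
  simp only [LinearMap.sum_apply, LinearMap.compl₁₂_apply, LieModule.toEnd_apply_apply]

/-- `ad x` is skew in the orthonormal basis `X`, so the terms with `[x, X i]` cancel, as for a
Casimir operator. -/
theorem posOp_actForm {β : LinearMap.BilinForm ℝ u} (hβ : IsInner β)
    (hinv : ∀ x y z : u, β ⁅x, y⁆ z = -β y ⁅x, z⁆) {n : ℕ} {X : Basis (Fin n) ℝ u}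
    (hX : ∀ i j, β (X i) (X j) = if i = j then 1 else 0) (x : u) (P : symForms E) :
    posOp E X (actForm E x P) = actForm E x (posOp E X P) := by
  refine symForms_ext fun v => ?_
  have hlie (i) : ⁅x, X i⁆ = ∑ j, β (X j) ⁅x, X i⁆ • X j := by
    conv_lhs => rw [← X.sum_repr ⁅x, X i⁆]
    simp_rw [repr_eq_of_orthonormal hX]
  have hskew (i j) : β (X j) ⁅x, X i⁆ = -β (X i) ⁅x, X j⁆ := by
    have := hinv x (X j) (X i)
    rw [hβ.symm (X i), this, neg_neg]
  simp only [posOp_apply, actForm_apply]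
  have h1 (i) : ⁅x, ⁅X i, v⁆⁆ = ⁅⁅x, X i⁆, v⁆ + ⁅X i, ⁅x, v⁆⁆ := by rw [lie_lie]; abel
  simp_rw [h1, map_add, LinearMap.add_apply]
  rw [← Finset.sum_add_distrib]
  have h2 : ∑ i, P.1 ⁅⁅x, X i⁆, v⁆ ⁅X i, v⁆ = 0 := by
    have h3 : ∑ i, P.1 ⁅⁅x, X i⁆, v⁆ ⁅X i, v⁆ =
        ∑ i, ∑ j, β (X j) ⁅x, X i⁆ * P.1 ⁅X j, v⁆ ⁅X i, v⁆ := by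
      refine Finset.sum_congr rfl fun i _ => ?_
      conv_lhs => rw [hlie i]
      rw [sum_lie, map_sum, LinearMap.sum_apply]
      refine Finset.sum_congr rfl fun j _ => ?_
      rw [smul_lie, map_smul, LinearMap.smul_apply, smul_eq_mul]
    have h4 : ∑ i, ∑ j, β (X j) ⁅x, X i⁆ * P.1 ⁅X j, v⁆ ⁅X i, v⁆ =
        -∑ i, ∑ j, β (X j) ⁅x, X i⁆ * P.1 ⁅X j, v⁆ ⁅X i, v⁆ := by
      conv_lhs => rw [Finset.sum_comm]
      rw [← Finset.sum_neg_distrib]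
      refine Finset.sum_congr rfl fun i _ => ?_
      rw [← Finset.sum_neg_distrib]
      refine Finset.sum_congr rfl fun j _ => ?_
      rw [hskew j i, P.2 ⁅X i, v⁆]
      ring
    rw [h3]
    linarith
  have h5 : ∑ i, P.1 ⁅X i, v⁆ ⁅⁅x, X i⁆, v⁆ = 0 := by
    rw [← h2]
    exact Finset.sum_congr rfl fun i _ => P.2 _ _
  have h6 : ∀ i, P.1 ⁅⁅x, X i⁆, v⁆ ⁅X i, v⁆ + P.1 ⁅X i, ⁅x, v⁆⁆ ⁅X i, v⁆ +
      (P.1 ⁅X i, v⁆ ⁅⁅x, X i⁆, v⁆ + P.1 ⁅X i, v⁆ ⁅X i, ⁅x, v⁆⁆) =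
      (P.1 ⁅⁅x, X i⁆, v⁆ ⁅X i, v⁆ + P.1 ⁅X i, v⁆ ⁅⁅x, X i⁆, v⁆) +
      (P.1 ⁅X i, ⁅x, v⁆⁆ ⁅X i, v⁆ + P.1 ⁅X i, v⁆ ⁅X i, ⁅x, v⁆⁆) := fun i => by ring
  simp_rw [h6]
  rw [Finset.sum_add_distrib, Finset.sum_add_distrib, h2, h5, add_zero, zero_add]

theorem actForm_lie (x y : u) (P : symForms E) :
    actForm E ⁅x, y⁆ P + actForm E x (actForm E y P) = actForm E y (actForm E x P) := by
  refine symForms_ext fun v => ?_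
  rw [Submodule.coe_add, LinearMap.add_apply, LinearMap.add_apply]
  simp only [actForm_apply, lie_lie, map_sub, LinearMap.sub_apply]
  ring

/-- Perron–Frobenius for `P ↦ ∑ P(X i ·, X i ·)` on the cone of semidefinite forms. For nonzero `P`
in the cone, the kernels of `(1 + Ψ)^m P` decrease to a proper submodule, which is zero; so some
such form is definite, that is, an order unit. The Perron eigenvector is unique up to a scalar and
`Ψ` commutes with `u`, so each element of `u` multiplies it by a scalar. These scalars vanish on
brackets, hence on the perfect algebra `u`. -/
theorem exists_invariant_inner_of_irreducible {β : LinearMap.BilinForm ℝ u} (hβ : IsInner β)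
    (hinv : ∀ x y z : u, β ⁅x, y⁆ z = -β y ⁅x, z⁆) [Nontrivial E]
    (hirr : ∀ U : LieSubmodule ℝ u E, U = ⊥ ∨ U = ⊤) :
    ∃ g : LinearMap.BilinForm ℝ E, IsInner g ∧ ∀ (x : u) v w, g ⁅x, v⁆ w = -g v ⁅x, w⁆ := by
  obtain ⟨X, hX⟩ := hβ.exists_orthonormal
  let φ : E → symForms E →ₗ[ℝ] ℝ := fun v =>
    { toFun := fun P => P.1 v v, map_add' := fun _ _ => rfl, map_smul' := fun _ _ => rfl }
  have hφsub (c : ℝ) (P Q : symForms E) (v : E) : φ v (c • P - Q) = c * P.1 v v - Q.1 v v := by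
    rw [map_sub, map_smul]; rfl
  set Ψ := posOp E X with hΨ
  set K : Set (symForms E) := {w | ∀ a, 0 ≤ φ a w} with hK
  have hKdef (P : symForms E) : P ∈ K ↔ ∀ v, 0 ≤ P.1 v v := Iff.rfl
  have hΨK : ∀ P ∈ K, Ψ P ∈ K := fun P hP v => by
    change 0 ≤ (Ψ P).1 v v
    rw [hΨ, posOp_apply]
    exact Finset.sum_nonneg fun i _ => hP _
  have hunit {P : symForms E} (hP : IsInner P.1) : IsOrderUnit K P := fun w => by
    obtain ⟨C, hC, h⟩ := hP.exists_le w.1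
    refine ⟨C, hC, fun v => ?_⟩
    rw [hφsub]
    linarith [h v]
  have hpow (m : ℕ) {P : symForms E} (hP : P ∈ K) : ((1 + Ψ) ^ m) P ∈ K := by
    induction m with
    | zero => simpa using hP
    | succ m ih =>
      rw [pow_succ', Module.End.mul_apply, LinearMap.add_apply, Module.End.one_apply]
      exact fun v => add_nonneg (ih v) (hΨK _ ih v)
  obtain ⟨b, -⟩ : ∃ b : Basis (Fin (finrank ℝ E)) ℝ E, True := ⟨finBasis ℝ E, trivial⟩
  -- a positive definite form to start with
  let P₀ : symForms E := ⟨∑ i, (LinearMap.mul ℝ ℝ).compl₁₂ (b.coord i) (b.coord i), fun v w => by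
    simp only [LinearMap.sum_apply, LinearMap.compl₁₂_apply, LinearMap.mul_apply']
    exact Finset.sum_congr rfl fun i _ => mul_comm _ _⟩
  have hP₀ (v : E) : P₀.1 v v = ∑ i, b.coord i v * b.coord i v := by
    change (∑ i, (LinearMap.mul ℝ ℝ).compl₁₂ (b.coord i) (b.coord i)) v v = _
    simp only [LinearMap.sum_apply, LinearMap.compl₁₂_apply, LinearMap.mul_apply']
  have hP₀K : P₀ ∈ K := fun v => by
    change 0 ≤ P₀.1 v v
    rw [hP₀]
    exact Finset.sum_nonneg fun i _ => mul_self_nonneg _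
  have hP₀0 : P₀ ≠ 0 := by
    intro h0
    obtain ⟨v, hv⟩ := exists_ne (0 : E)
    refine hv (b.ext_elem fun i => ?_)
    have h1 := hP₀ v
    rw [h0] at h1
    have h2 : ∑ i, b.coord i v * b.coord i v = 0 := h1.symm
    have h3 := (Finset.sum_eq_zero_iff_of_nonneg fun i _ => mul_self_nonneg _).mp h2 i
      (Finset.mem_univ i)
    simpa using h3
  have key : ∀ P ∈ K, P ≠ 0 → ∃ m : ℕ, IsOrderUnit K (((1 + Ψ) ^ m) P) := by
    intro P hP hP0
    let N : ℕ → Submodule ℝ E := fun m => LinearMap.ker (((1 + Ψ) ^ m) P).1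
    have hNmem (m : ℕ) (v : E) : v ∈ N m ↔ (((1 + Ψ) ^ m) P).1 v v = 0 := by
      constructor
      · intro h
        have h1 : (((1 + Ψ) ^ m) P).1 v = 0 := h
        rw [h1]; rfl
      · intro h
        exact LinearMap.ext fun w => eq_zero_of_isotropic (((1 + Ψ) ^ m) P).2 (hpow m hP) h w
    have hNsucc (m : ℕ) (v : E) : v ∈ N (m + 1) ↔ v ∈ N m ∧ ∀ i, ⁅X i, v⁆ ∈ N m := by
      simp_rw [hNmem]
      have h1 : (((1 + Ψ) ^ (m + 1)) P).1 v v = (((1 + Ψ) ^ m) P).1 v v +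
          ∑ i, (((1 + Ψ) ^ m) P).1 ⁅X i, v⁆ ⁅X i, v⁆ := by
        rw [pow_succ', Module.End.mul_apply, LinearMap.add_apply, Module.End.one_apply,
          Submodule.coe_add, LinearMap.add_apply, LinearMap.add_apply, hΨ, posOp_apply]
      rw [h1]
      have h2 : ∀ v, 0 ≤ (((1 + Ψ) ^ m) P).1 v v := hpow m hP
      rw [add_eq_zero_iff_of_nonneg (h2 v) (Finset.sum_nonneg fun i _ => h2 _),
        Finset.sum_eq_zero_iff_of_nonneg fun i _ => h2 _]
      simp
    have hanti : Antitone N := antitone_nat_of_succ_le fun m v hv => ((hNsucc m v).mp hv).1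
    obtain ⟨m, hm⟩ := IsArtinian.monotone_stabilizes
      (⟨fun m => OrderDual.toDual (N m), fun _ _ h => hanti h⟩ : ℕ →o (Submodule ℝ E)ᵒᵈ)
    have hm1 : N m = N (m + 1) := hm (m + 1) (Nat.le_succ m)
    have hinvt (x : u) (v : E) (hv : v ∈ N m) : ⁅x, v⁆ ∈ N m := by
      rw [← X.sum_repr x, sum_lie]
      refine Submodule.sum_mem _ fun i _ => ?_
      rw [smul_lie]
      refine Submodule.smul_mem _ _ ?_
      rw [hm1] at hv
      exact ((hNsucc m v).mp hv).2 i
    refine ⟨m, hunit ⟨(((1 + Ψ) ^ m) P).2, fun v hv => ?_⟩⟩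
    refine lt_of_le_of_ne (hpow m hP v) fun h0 => ?_
    rcases hirr { N m with lie_mem := fun {x v} hv => hinvt x v hv } with h1 | h1
    · have h2 : v ∈ ({ N m with lie_mem := fun {x v} hv => hinvt x v hv } :
        LieSubmodule ℝ u E) := (hNmem m v).mpr h0.symm
      rw [h1] at h2
      exact hv (by simpa using h2)
    · refine hP0 (symForms_ext fun w => ?_)
      have h2 : w ∈ ({ N m with lie_mem := fun {x v} hv => hinvt x v hv } :
        LieSubmodule ℝ u E) := by rw [h1]; trivial
      have h3 : w ∈ N 0 := hanti (Nat.zero_le m) h2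
      have h4 := (hNmem 0 w).mp h3
      rw [pow_zero, Module.End.one_apply] at h4
      exact h4
  obtain ⟨P, C, hPu, hPC, hPK, huniq⟩ := exists_perron_eigenvector' φ
    (fun w hw => symForms_ext fun v => hw v) hΨK key hP₀K hP₀0
  have hPinner : IsInner P.1 := by
    refine ⟨P.2, fun v hv => ?_⟩
    refine lt_of_le_of_ne (hPK v) fun h0 => ?_
    obtain ⟨D, hD, hDK⟩ := hPu P₀
    have h1 : 0 ≤ D * P.1 v v - P₀.1 v v := (hDK v).trans_eq (hφsub D P P₀ v)
    have h0' : P.1 v v = 0 := h0.symm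
    rw [h0', mul_zero, zero_sub, hP₀] at h1
    have h2 := Finset.sum_nonneg (s := Finset.univ) fun i _ => mul_self_nonneg (b.coord i v)
    refine hv (b.ext_elem fun i => ?_)
    have h3 := (Finset.sum_eq_zero_iff_of_nonneg fun i _ => mul_self_nonneg _).mp
      (le_antisymm (by linarith) h2) i (Finset.mem_univ i)
    simpa using h3
  have hchar (x : u) : ∃ t : ℝ, actForm E x P = t • P := by
    refine huniq _ ?_
    rw [hΨ, posOp_actForm hβ hinv hX, ← hΨ, hPC, map_smul]
  have hzero (x : u) : actForm E x P = 0 := by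
    refine induction_lie (K := ℝ) (p := fun x => actForm E x P = 0) (fun x y => ?_) ?_ ?_ ?_ x
    · obtain ⟨s, hs⟩ := hchar x
      obtain ⟨t, ht⟩ := hchar y
      have h1 := actForm_lie x y P
      rw [hs, ht, map_smul, map_smul, hs, ht, smul_comm] at h1
      exact add_eq_right.mp h1
    · exact symForms_ext fun v => by rw [actForm_apply, zero_lie, map_zero]; simp
    · intro x y hx hy
      have : actForm E (x + y) P = actForm E x P + actForm E y P := symForms_ext fun v => by
        rw [Submodule.coe_add, LinearMap.add_apply, LinearMap.add_apply]
        simp only [actForm_apply, add_lie, map_add, LinearMap.add_apply]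
        ring
      rw [this, hx, hy, add_zero]
    · intro c x hx
      have : actForm E (c • x) P = c • actForm E x P := symForms_ext fun v => by
        rw [Submodule.coe_smul, LinearMap.smul_apply, LinearMap.smul_apply]
        simp only [actForm_apply, smul_lie, map_smul, LinearMap.smul_apply, smul_eq_mul]
        ring
      rw [this, hx, smul_zero]
  refine ⟨P.1, hPinner, fun x v w => ?_⟩
  have h1 : (actForm E x P).1 v w = 0 := by rw [hzero]; rfl
  rw [actForm_apply] at h1
  linarith

/-- Every finite-dimensional real module of a compact semisimple Lie algebra has an invariant
inner product. -/
theorem exists_invariant_inner {β : LinearMap.BilinForm ℝ u} (hβ : IsInner β)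
    (hinv : ∀ x y z : u, β ⁅x, y⁆ z = -β y ⁅x, z⁆) (E : Type*) [AddCommGroup E] [Module ℝ E]
    [FiniteDimensional ℝ E] [LieRingModule u E] [LieModule ℝ u E] :
    ∃ g : LinearMap.BilinForm ℝ E, IsInner g ∧ ∀ (x : u) v w, g ⁅x, v⁆ w = -g v ⁅x, w⁆ := by
  -- Semidefinite forms on all of `E` that are definite on `U` can be added after pulling back along
  -- equivariant projections, so no forms on submodules need to be glued.
  suffices h : ∀ (n : ℕ) (U : LieSubmodule ℝ u E), finrank ℝ U = n →
      ∃ g : LinearMap.BilinForm ℝ E, (∀ x y, g x y = g y x) ∧ (∀ x, 0 ≤ g x x) ∧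
        (∀ x ∈ U, g x x = 0 → x = 0) ∧ ∀ (x : u) v w, g ⁅x, v⁆ w = -g v ⁅x, w⁆ by
    obtain ⟨g, h1, h2, h3, h4⟩ := h _ ⊤ rfl
    exact ⟨g, ⟨h1, fun x hx => lt_of_le_of_ne (h2 x) fun h0 => hx (h3 x trivial h0.symm)⟩, h4⟩
  intro n
  induction n using Nat.strong_induction_on with
  | _ n ih =>
    intro U hU
    by_cases hbot : U = ⊥
    · refine ⟨0, fun _ _ => rfl, fun _ => le_rfl, fun x hx _ => ?_, fun _ _ _ => by simp⟩
      rw [hbot] at hx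
      simpa using hx
    by_cases hirr : ∀ U' : LieSubmodule ℝ u E, U' ≤ U → U' = ⊥ ∨ U' = U
    · have : Nontrivial U := by
        rw [← not_subsingleton_iff_nontrivial]
        intro hs
        refine hbot ((LieSubmodule.eq_bot_iff _).mpr fun x hx => ?_)
        exact congrArg Subtype.val (Subsingleton.elim (⟨x, hx⟩ : U) 0)
      obtain ⟨g, hg, hg'⟩ := exists_invariant_inner_of_irreducible (E := U) hβ hinv (by
        intro N
        rcases hirr (N.map U.incl) (by
          rintro x hx
          obtain ⟨y, -, rfl⟩ := (LieSubmodule.mem_map _).mp hx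
          exact y.2) with h1 | h1
        · left
          refine (LieSubmodule.eq_bot_iff _).mpr fun x hx => ?_
          have h2 : (x : E) ∈ N.map U.incl := (LieSubmodule.mem_map _).mpr ⟨x, hx, rfl⟩
          rw [h1] at h2
          exact Subtype.ext (by simpa using h2)
        · right
          refine eq_top_iff.mpr fun x _ => ?_
          have h2 : (x : E) ∈ N.map U.incl := by rw [h1]; exact x.2
          obtain ⟨y, hy, hyx⟩ := (LieSubmodule.mem_map _).mp h2
          have : y = x := Subtype.ext hyx
          exact this ▸ hy)
      obtain ⟨p, hp⟩ := exists_equivariant_projection U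
      refine ⟨g.compl₁₂ (p : E →ₗ[ℝ] U) (p : E →ₗ[ℝ] U), fun x y => hg.symm _ _,
        fun x => hg.nonneg _, fun x hx h0 => ?_, fun x v w => ?_⟩
      · have h1 : p x = 0 := hg.eq_zero h0
        have h2 := hp ⟨x, hx⟩
        change p x = _ at h2
        rw [h1] at h2
        exact (congrArg Subtype.val h2).symm
      · change g (p ⁅x, v⁆) (p w) = -g (p v) (p ⁅x, w⁆)
        rw [LieModuleHom.map_lie, LieModuleHom.map_lie, hg']
    · push Not at hirr
      obtain ⟨U', hU', hne, hne'⟩ := hirr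
      have hlt (A B : LieSubmodule ℝ u E) (hAB : A ≤ B) (hAB' : A ≠ B) :
          finrank ℝ A < finrank ℝ B :=
        Submodule.finrank_lt_finrank_of_lt (s := A.toSubmodule) (t := B.toSubmodule)
          (lt_of_le_of_ne hAB fun h => hAB' (LieSubmodule.toSubmodule_injective h))
      obtain ⟨p, hp⟩ := exists_equivariant_projection U'
      obtain ⟨g₁, hs₁, hn₁, hd₁, hi₁⟩ := ih _ (hU ▸ hlt U' U hU' hne') U' rfl
      obtain ⟨g₂, hs₂, hn₂, hd₂, hi₂⟩ := ih _ (hU ▸ hlt (p.ker ⊓ U) U inf_le_right (by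
        intro h
        have h1 : U ≤ p.ker := by rw [← h]; exact inf_le_left
        refine hne ((LieSubmodule.eq_bot_iff _).mpr fun x hx => ?_)
        have h2 : p x = 0 := h1 (hU' hx)
        have h3 := hp ⟨x, hx⟩
        change p x = _ at h3
        rw [h2] at h3
        exact (congrArg Subtype.val h3).symm)) (p.ker ⊓ U) rfl
      have hpl (x : u) (v : E) : ((p ⁅x, v⁆ : U') : E) = ⁅x, (p v : E)⁆ := by
        rw [LieModuleHom.map_lie]; rfl
      let q : E →ₗ[ℝ] E := U'.toSubmodule.subtype ∘ₗ (p : E →ₗ[ℝ] U')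
      have hq (v : E) : q v = (p v : E) := rfl
      refine ⟨g₁.compl₁₂ q q + g₂, fun x y => ?_, fun x => add_nonneg (hn₁ _) (hn₂ _),
        fun x hx h0 => ?_, fun x v w => ?_⟩
      · change g₁ (q x) (q y) + g₂ x y = g₁ (q y) (q x) + g₂ y x
        rw [hs₁, hs₂]
      · have h1 : g₁ (q x) (q x) + g₂ x x = 0 := h0
        obtain ⟨h2, h3⟩ := (add_eq_zero_iff_of_nonneg (hn₁ _) (hn₂ _)).mp h1
        have h4 : p x = 0 := Subtype.ext (hd₁ (q x) (p x).2 h2)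
        exact hd₂ x ⟨h4, hx⟩ h3
      · change g₁ (q ⁅x, v⁆) (q w) + g₂ ⁅x, v⁆ w = -(g₁ (q v) (q ⁅x, w⁆) + g₂ v ⁅x, w⁆)
        rw [hq, hq ⁅x, w⁆, hpl, hpl, hi₁, hi₂, hq, hq]
        ring

end Invariant

/-! ### Symmetric operators -/

section Symmetric

variable {E : Type*} [AddCommGroup E] [Module ℝ E] [FiniteDimensional ℝ E]

/-- The spectral theorem for symmetric operators. -/
theorem IsInner.isDiag {g : LinearMap.BilinForm ℝ E} (hg : IsInner g) {S : Module.End ℝ E}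
    (hS : ∀ x y, g (S x) y = g x (S y)) : IsDiag S := by
  let core : InnerProductSpace.Core ℝ E :=
    { inner := fun x y => g x y
      conj_inner_symm := fun x y => hg.symm y x
      re_inner_nonneg := fun x => hg.nonneg x
      add_left := fun x y z => by simp
      smul_left := fun x y r => by simp
      definite := fun x hx => hg.eq_zero hx }
  let _ : NormedAddCommGroup E := core.toNormedAddCommGroup
  let _ : InnerProductSpace ℝ E := InnerProductSpace.ofCore core.toCore
  have hsym : S.IsSymmetric := fun x y => hS x y
  have h1 := hsym.orthogonalComplement_iSup_eigenspaces_eq_bot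
  rw [Submodule.orthogonal_eq_bot_iff] at h1
  exact h1

/-- A polynomial in a diagonalizable operator realizes any function of the eigenvalues. -/
theorem exists_aeval_eq (S : Module.End ℝ E) (f : ℝ → ℝ) :
    ∃ p : Polynomial ℝ, ∀ μ, ∀ v ∈ S.eigenspace μ, Polynomial.aeval S p v = f μ • v := by
  have hfin : {μ | S.HasEigenvalue μ}.Finite := Module.End.finite_hasEigenvalue S
  refine ⟨Lagrange.interpolate hfin.toFinset id f, fun μ v hv => ?_⟩
  rcases eq_or_ne v 0 with rfl | hv0
  · simp
  have hvec : S.HasEigenvector μ v := ⟨hv, hv0⟩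
  rw [Module.End.aeval_apply_of_hasEigenvector hvec]
  congr 1
  exact Lagrange.eval_interpolate_at_node f (Set.injOn_id _)
    (hfin.mem_toFinset.mpr (Module.End.hasEigenvalue_of_hasEigenvector hvec))

theorem eq_of_isDiag {S T T' : Module.End ℝ E} (hS : IsDiag S)
    (h : ∀ μ, ∀ v ∈ S.eigenspace μ, T v = T' v) : T = T' := by
  have h1 : (⨆ μ, S.eigenspace μ) ≤ LinearMap.eqLocus T T' := iSup_le fun μ v hv => h μ v hv
  have h2 : (⨆ μ, S.eigenspace μ) = ⊤ := hS
  rw [h2, top_le_iff] at h1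
  exact LinearMap.eqLocus_eq_top.mp h1

theorem symmetric_aeval {g : LinearMap.BilinForm ℝ E} {S : Module.End ℝ E}
    (hS : ∀ x y, g (S x) y = g x (S y)) (p : Polynomial ℝ) (x y : E) :
    g (Polynomial.aeval S p x) y = g x (Polynomial.aeval S p y) := by
  induction p using Polynomial.induction_on' with
  | add p q hp hq => simp only [map_add, LinearMap.add_apply, hp, hq]
  | monomial n a =>
    have h1 (n : ℕ) : ∀ x y, g ((S ^ n) x) y = g x ((S ^ n) y) := by
      induction n with
      | zero => simp
      | succ n ih =>
        intro x y
        rw [pow_succ, Module.End.mul_apply, ih, hS, ← Module.End.mul_apply, ← pow_succ',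
          ← pow_succ]
    simp [Polynomial.aeval_monomial, Module.algebraMap_end_apply, h1]

/-- The sign of an injective symmetric operator. -/
theorem IsInner.exists_sign {g : LinearMap.BilinForm ℝ E} (hg : IsInner g) {S : Module.End ℝ E}
    (hS : ∀ x y, g (S x) y = g x (S y)) (hinj : ∀ x, S x = 0 → x = 0) :
    ∃ c : Module.End ℝ E, (∀ x, c (c x) = x) ∧ (∀ x, x ≠ 0 → 0 < g (S x) (c x)) ∧
      (∀ T : Module.End ℝ E, Commute T S → Commute T c) ∧
      ∀ T : Module.End ℝ E, (∀ x, T (S x) = -S (T x)) → ∀ x, T (c x) = -c (T x) := by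
  have hdiag := hg.isDiag hS
  -- `c` is the sign of `S` and `r` the square root of its absolute value, both polynomials in `S`,
  -- with `c² = 1` and `c S = r²`. Since the sign is odd, operators anticommuting with `S`
  -- anticommute with `c`.
  obtain ⟨p, hp⟩ := exists_aeval_eq S (fun μ => SignType.sign μ)
  obtain ⟨q, hq⟩ := exists_aeval_eq S (fun μ => Real.sqrt |μ|)
  have hne {μ : ℝ} {v : E} (hv : v ∈ S.eigenspace μ) (hv0 : v ≠ 0) : μ ≠ 0 := by
    rintro rfl
    rw [Module.End.mem_eigenspace_iff, zero_smul] at hv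
    exact hv0 (hinj v hv)
  set c := Polynomial.aeval S p with hc
  set r := Polynomial.aeval S q with hr
  have hcc : c * c = 1 := eq_of_isDiag hdiag fun μ v hv => by
    rcases eq_or_ne v 0 with rfl | hv0
    · simp
    rw [Module.End.mul_apply, hp μ v hv, map_smul, hp μ v hv, smul_smul, Module.End.one_apply]
    have := hne hv hv0
    rcases lt_or_gt_of_ne this with h | h
    · rw [sign_neg h]; simp
    · rw [sign_pos h]; simp
  have hrr : r * r = c * S := eq_of_isDiag hdiag fun μ v hv => by
    rw [Module.End.mul_apply, Module.End.mul_apply, hq μ v hv, map_smul, hq μ v hv,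
      Module.End.mem_eigenspace_iff.mp hv, map_smul, hp μ v hv, smul_smul, smul_smul,
      Real.mul_self_sqrt (abs_nonneg _), self_mul_sign]
  have hcx (x : E) : c (c x) = x := by rw [← Module.End.mul_apply, hcc, Module.End.one_apply]
  refine ⟨c, hcx, fun x hx => ?_, fun T hT => ?_, fun T hT => ?_⟩
  · have h1 : g (S x) (c x) = g (r x) (r x) := by
      rw [← symmetric_aeval hS p, ← hc, ← Module.End.mul_apply, ← hrr, Module.End.mul_apply,
        hr, symmetric_aeval hS q]
    rw [h1]
    refine hg.pos _ fun h0 => hx (hinj x ?_)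
    have h2 : (r * r) x = 0 := by rw [Module.End.mul_apply, h0, map_zero]
    rw [hrr, Module.End.mul_apply] at h2
    rw [← hcx (S x), h2, map_zero]
  · have h1 : T * c = c * T := eq_of_isDiag hdiag fun μ v hv => by
      have h2 : T v ∈ S.eigenspace μ := by
        rw [Module.End.mem_eigenspace_iff, ← Module.End.mul_apply, ← hT.eq, Module.End.mul_apply,
          Module.End.mem_eigenspace_iff.mp hv, map_smul]
      rw [Module.End.mul_apply, Module.End.mul_apply, hp μ v hv, hp μ _ h2, map_smul]
    exact h1
  · have h1 : T * c = -(c * T) := eq_of_isDiag hdiag fun μ v hv => by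
      have h2 : T v ∈ S.eigenspace (-μ) := by
        rw [Module.End.mem_eigenspace_iff, neg_smul, ← map_smul,
          ← Module.End.mem_eigenspace_iff.mp hv, hT, neg_neg]
      rw [LinearMap.neg_apply, Module.End.mul_apply, Module.End.mul_apply, hp μ v hv, hp _ _ h2,
        map_smul, Left.sign_neg, SignType.coe_neg, neg_smul, neg_neg]
    intro x
    have := LinearMap.congr_fun h1 x
    exact this

/-- Representation of a bilinear form by an operator. -/
theorem IsInner.exists_operator {g : LinearMap.BilinForm ℝ E} (hg : IsInner g)
    (b : LinearMap.BilinForm ℝ E) : ∃ S : Module.End ℝ E, ∀ x y, g (S x) y = b x y := by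
  have hnd : Function.Injective g := by
    rw [← LinearMap.ker_eq_bot, LinearMap.ker_eq_bot']
    intro x hx
    exact hg.eq_zero (by rw [hx]; rfl)
  have hbij : Function.Bijective g := ⟨hnd,
    (LinearMap.injective_iff_surjective_of_finrank_eq_finrank
      (Subspace.dual_finrank_eq (K := ℝ) (V := E)).symm).mp hnd⟩
  let e : E ≃ₗ[ℝ] Dual ℝ E := LinearEquiv.ofBijective g hbij
  refine ⟨e.symm.toLinearMap ∘ₗ b, fun x y => ?_⟩
  have h1 : e (e.symm (b x)) = b x := e.apply_symm_apply _
  exact LinearMap.congr_fun h1 y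

end Symmetric

/-! ### Compact real forms -/

section CompactForm

variable (L : Type*) [LieRing L] [LieAlgebra ℂ L]

/-- The real Lie algebra underlying a complex Lie algebra. -/
abbrev realLieAlgebra : LieAlgebra ℝ L where
  lie_smul c x y := lie_smul (c : ℂ) x y

attribute [local instance] realLieAlgebra

/-- The real module underlying a complex module. -/
theorem realLieModule (E : Type*) [AddCommGroup E] [Module ℂ E] [LieRingModule L E]
    [LieModule ℂ L E] : LieModule ℝ L E where
  smul_lie c x v := smul_lie (c : ℂ) x v
  lie_smul c x v := lie_smul (c : ℂ) x v

attribute [local instance] realLieModule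

variable {L}

/-- The fixed points of a conjugation. -/
def IsConjugation.fixed {θ : L →+ L} (hθ : IsConjugation θ) : LieSubalgebra ℝ L where
  carrier := {x | θ x = x}
  add_mem' {x y} (hx : θ x = x) (hy : θ y = y) := by
    change θ (x + y) = x + y
    rw [map_add, hx, hy]
  zero_mem' := map_zero θ
  smul_mem' c x (hx : θ x = x) := by
    change θ ((c : ℂ) • x) = (c : ℂ) • x
    rw [hθ.smul, hx, Complex.conj_ofReal]
  lie_mem' {x y} (hx : θ x = x) (hy : θ y = y) := by
    change θ ⁅x, y⁆ = ⁅x, y⁆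
    rw [hθ.lie, hx, hy]

theorem IsConjugation.exists_eq_add {θ : L →+ L} (hθ : IsConjugation θ) (x : L) :
    ∃ a b : hθ.fixed, x = a + Complex.I • (b : L) ∧ θ x = a - Complex.I • (b : L) := by
  let a : L := (1 / 2 : ℂ) • (x + θ x)
  let b : L := (-Complex.I / 2 : ℂ) • (x - θ x)
  have ha : θ a = a := by
    change θ ((1 / 2 : ℂ) • (x + θ x)) = (1 / 2 : ℂ) • (x + θ x)
    rw [hθ.smul, map_add, hθ.invol, add_comm]
    congr 1
    rw [map_div₀, map_one, map_ofNat]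
  have hb : θ b = b := by
    change θ ((-Complex.I / 2 : ℂ) • (x - θ x)) = (-Complex.I / 2 : ℂ) • (x - θ x)
    rw [hθ.smul, map_sub, hθ.invol]
    have : (starRingEnd ℂ) (-Complex.I / 2) = Complex.I / 2 := by
      rw [map_div₀, map_neg, Complex.conj_I, neg_neg, map_ofNat]
    rw [this]
    module
  have hI : Complex.I • b = (1 / 2 : ℂ) • (x - θ x) := by
    change Complex.I • ((-Complex.I / 2 : ℂ) • (x - θ x)) = _
    rw [smul_smul]
    congr 1
    rw [mul_div_assoc', mul_neg, Complex.I_mul_I, neg_neg]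
  refine ⟨⟨a, ha⟩, ⟨b, hb⟩, ?_, ?_⟩
  · change x = a + Complex.I • b
    rw [hI]
    change x = (1 / 2 : ℂ) • (x + θ x) + (1 / 2 : ℂ) • (x - θ x)
    module
  · change θ x = a - Complex.I • b
    rw [hI]
    change θ x = (1 / 2 : ℂ) • (x + θ x) - (1 / 2 : ℂ) • (x - θ x)
    module

variable [FiniteDimensional ℂ L]

/-- The real part of minus the Killing form on a real form. -/
def IsConjugation.form {θ : L →+ L} (hθ : IsConjugation θ) : LinearMap.BilinForm ℝ hθ.fixed :=
  LinearMap.mk₂ ℝ (fun x y => -(killingForm ℂ L (x : L) (y : L)).re)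
    (fun x y z => by
      have : ((x + y : hθ.fixed) : L) = (x : L) + (y : L) := rfl
      rw [this, map_add, LinearMap.add_apply, Complex.add_re]; ring)
    (fun c x y => by
      have : ((c • x : hθ.fixed) : L) = (c : ℂ) • (x : L) := rfl
      rw [this, map_smul, LinearMap.smul_apply, smul_eq_mul, Complex.re_ofReal_mul, smul_eq_mul]
      ring)
    (fun x y z => by
      have : ((y + z : hθ.fixed) : L) = (y : L) + (z : L) := rfl
      rw [this, map_add, Complex.add_re]; ring)
    (fun c x y => by
      have : ((c • y : hθ.fixed) : L) = (c : ℂ) • (y : L) := rfl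
      rw [this, map_smul, smul_eq_mul, Complex.re_ofReal_mul, smul_eq_mul]
      ring)

theorem IsConjugation.form_apply {θ : L →+ L} (hθ : IsConjugation θ) (x y : hθ.fixed) :
    hθ.form x y = -(killingForm ℂ L (x : L) (y : L)).re := rfl

theorem IsConjugation.form_isInner {θ : L →+ L} (hθ : IsConjugation θ)
    (hneg : ∀ x, x ≠ 0 → (killingForm ℂ L x (θ x)).re < 0) : IsInner hθ.form := by
  refine ⟨fun x y => ?_, fun x hx => ?_⟩
  · rw [hθ.form_apply, hθ.form_apply, LieModule.traceForm_comm]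
  · have h1 := hneg x fun h => hx (Subtype.ext h)
    have h2 : θ x = x := x.2
    rw [h2] at h1
    rw [hθ.form_apply]
    linarith

theorem IsConjugation.form_lie {θ : L →+ L} (hθ : IsConjugation θ) (x y z : hθ.fixed) :
    hθ.form ⁅x, y⁆ z = -hθ.form y ⁅x, z⁆ := by
  rw [hθ.form_apply, hθ.form_apply, LieSubalgebra.coe_bracket, LieSubalgebra.coe_bracket,
    ← lie_skew, map_neg, LinearMap.neg_apply, LieModule.traceForm_apply_lie_apply, Complex.neg_re]

/-- `ad x` is skew for the inner product `hθ.form`, so the trace of its square is minus a sum of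
squares. An `x` in the radical then commutes with the real form, hence with `L`, and `form x x = 0`.
-/
theorem IsConjugation.isKilling_fixed {θ : L →+ L} (hθ : IsConjugation θ)
    (hneg : ∀ x, x ≠ 0 → (killingForm ℂ L x (θ x)).re < 0) :
    LieAlgebra.IsKilling ℝ hθ.fixed := by
  have hβ := hθ.form_isInner hneg
  constructor
  rw [LieSubmodule.eq_bot_iff]
  intro x hx
  rw [LieIdeal.mem_killingCompl] at hx
  have h1 : killingForm ℝ hθ.fixed x x = 0 := hx x trivial
  obtain ⟨b, hb⟩ := hβ.exists_orthonormal
  rw [killingForm_apply_apply, trace_eq_of_orthonormal hb] at h1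
  have h2 (i) : hθ.form (b i) ((LieAlgebra.ad ℝ hθ.fixed x ∘ₗ LieAlgebra.ad ℝ hθ.fixed x) (b i)) =
      -hθ.form ⁅x, b i⁆ ⁅x, b i⁆ := by
    rw [hθ.form_lie, neg_neg]
    rfl
  simp_rw [h2] at h1
  rw [Finset.sum_neg_distrib, neg_eq_zero,
    Finset.sum_eq_zero_iff_of_nonneg fun i _ => hβ.nonneg _] at h1
  have h3 : LieAlgebra.ad ℝ hθ.fixed x = 0 := b.ext fun i => hβ.eq_zero (h1 i (Finset.mem_univ i))
  have h4 (y : hθ.fixed) : ⁅(x : L), (y : L)⁆ = 0 :=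
    congrArg Subtype.val (LinearMap.congr_fun h3 y)
  have h5 : LieAlgebra.ad ℂ L (x : L) = 0 := by
    refine LinearMap.ext fun y => ?_
    obtain ⟨a, b, hab, -⟩ := hθ.exists_eq_add y
    rw [LieAlgebra.ad_apply, hab, lie_add, lie_smul, h4, h4, smul_zero, add_zero]
    rfl
  refine hβ.eq_zero ?_
  rw [hθ.form_apply, killingForm_apply_apply, h5]
  simp

theorem smul_real_eq {E : Type*} [AddCommGroup E] [Module ℂ E] (r : ℝ) (v : E) :
    r • v = (r : ℂ) • v := rfl

/-- The unitarian trick: an orthogonal representation of a complex Killing Lie algebra has a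
conjugation compatible with a compact conjugation of the Lie algebra. -/
theorem IsConjugation.exists_compatible {θ : L →+ L} (hθ : IsConjugation θ)
    (hneg : ∀ x, x ≠ 0 → (killingForm ℂ L x (θ x)).re < 0)
    {E : Type*} [AddCommGroup E] [Module ℂ E] [FiniteDimensional ℂ E] [LieRingModule L E]
    [LieModule ℂ L E] {B : LinearMap.BilinForm ℂ E} (hsymm : ∀ v w, B v w = B w v)
    (hnd : ∀ v, (∀ w, B v w = 0) → v = 0) (hinv : ∀ (x : L) v w, B ⁅x, v⁆ w = -B v ⁅x, w⁆) :
    ∃ c : E →+ E, (∀ (a : ℂ) v, c (a • v) = (starRingEnd ℂ) a • c v) ∧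
      (∀ (x : L) v, c ⁅x, v⁆ = ⁅θ x, c v⁆) ∧ (∀ v, c (c v) = v) ∧
      ∀ v, v ≠ 0 → 0 < (B v (c v)).re := by
  have := hθ.isKilling_fixed hneg
  obtain ⟨g₀, hg₀, hg₀inv⟩ := exists_invariant_inner (hθ.form_isInner hneg) hθ.form_lie E
  let J : Module.End ℝ E :=
    { toFun := fun v => Complex.I • v
      map_add' := fun v w => smul_add _ v w
      map_smul' := fun r v => by
        rw [RingHom.id_apply, smul_real_eq, smul_real_eq, smul_comm] }
  have hJ (v : E) : J v = Complex.I • v := rfl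
  have hJJ (v : E) : J (J v) = -v := by
    rw [hJ, hJ, smul_smul, Complex.I_mul_I, neg_one_smul]
  have hJlie (x : hθ.fixed) (v : E) : J ⁅x, v⁆ = ⁅x, J v⁆ := (lie_smul Complex.I (x : L) v).symm
  -- Averaging over 1 and `I` makes multiplication by `I` skew.
  let g : LinearMap.BilinForm ℝ E := g₀ + g₀.compl₁₂ J J
  have hg (v w : E) : g v w = g₀ v w + g₀ (J v) (J w) := rfl
  have hgI : IsInner g := by
    refine ⟨fun v w => ?_, fun v hv => ?_⟩
    · rw [hg, hg, hg₀.symm v, hg₀.symm (J v)]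
    · rw [hg]
      exact add_pos_of_pos_of_nonneg (hg₀.pos v hv) (hg₀.nonneg _)
  have hgJ (v w : E) : g v (J w) = -g (J v) w := by
    rw [hg, hg, hJJ, hJJ, map_neg, map_neg, LinearMap.neg_apply]
    ring
  have hginv (x : hθ.fixed) (v w : E) : g ⁅x, v⁆ w = -g v ⁅x, w⁆ := by
    rw [hg, hg, hJlie, hJlie, hg₀inv, hg₀inv]
    ring
  -- The operator `S` representing `Re B` with respect to `g` is symmetric and injective, commutes
  -- with the compact form and anticommutes with `I`. Its sign `c` inherits the last two properties
  -- and is the required conjugation, with `Re B(v, c v) = g(S v, c v) > 0`.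
  let b : LinearMap.BilinForm ℝ E := LinearMap.mk₂ ℝ (fun v w => (B v w).re)
    (fun x y z => by rw [map_add, LinearMap.add_apply, Complex.add_re])
    (fun c x y => by
      rw [smul_real_eq, map_smul, LinearMap.smul_apply, smul_eq_mul, Complex.re_ofReal_mul,
        smul_eq_mul])
    (fun x y z => by rw [map_add, Complex.add_re])
    (fun c x y => by
      rw [smul_real_eq, map_smul, smul_eq_mul, Complex.re_ofReal_mul, smul_eq_mul])
  have hb (v w : E) : b v w = (B v w).re := rfl
  obtain ⟨S, hS⟩ := hgI.exists_operator b
  have hext {v w : E} (h : ∀ z, g v z = g w z) : v = w := by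
    rw [← sub_eq_zero]
    refine hgI.eq_zero ?_
    rw [LinearMap.map_sub₂, h, sub_self]
  have hSsymm (v w : E) : g (S v) w = g v (S w) := by
    rw [hS, hgI.symm v, hS, hb, hb, hsymm]
  have hSinj (v : E) (hv : S v = 0) : v = 0 := by
    refine hnd v fun w => ?_
    have h1 (w : E) : (B v w).re = 0 := by
      rw [← hb, ← hS, hv, map_zero]; rfl
    refine Complex.ext (h1 w) ?_
    have h2 := h1 (Complex.I • w)
    rw [map_smul, smul_eq_mul, Complex.I_mul_re, neg_eq_zero] at h2
    exact h2
  have hSlie (x : hθ.fixed) (v : E) : S ⁅x, v⁆ = ⁅x, S v⁆ := by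
    refine hext fun w => ?_
    rw [hS, hginv, hS, hb, hb]
    change (B ⁅(x : L), v⁆ w).re = -(B v ⁅(x : L), w⁆).re
    rw [hinv, Complex.neg_re]
  have hSJ (v : E) : J (S v) = -S (J v) := by
    refine hext fun w => ?_
    rw [map_neg, LinearMap.neg_apply, hS, ← neg_inj, ← hgJ, hS, neg_neg, hb, hb, hJ, hJ, map_smul,
      map_smul, LinearMap.smul_apply]
  obtain ⟨c, hcc, hpos, hcomm, hanti⟩ := hgI.exists_sign hSsymm hSinj
  have hclie (x : hθ.fixed) (v : E) : c ⁅x, v⁆ = ⁅x, c v⁆ := by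
    have h1 : Commute (LieModule.toEnd ℝ hθ.fixed E x) S :=
      LinearMap.ext fun v => (hSlie x v).symm
    exact (LinearMap.congr_fun (hcomm _ h1).eq v).symm
  have hcJ (v : E) : c (Complex.I • v) = -(Complex.I • c v) := by
    rw [← hJ, ← hJ, hanti J hSJ, neg_neg]
  refine ⟨c.toAddMonoidHom, fun a v => ?_, fun x v => ?_, hcc, fun v hv => ?_⟩
  · change c (a • v) = (starRingEnd ℂ) a • c v
    have h1 : a • v = a.re • v + a.im • (Complex.I • v) := by
      rw [smul_real_eq, smul_real_eq, smul_smul, ← add_smul, Complex.re_add_im]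
    rw [h1, map_add, map_smul, map_smul, hcJ, smul_real_eq, smul_real_eq, smul_neg, smul_smul,
      ← sub_eq_add_neg, ← sub_smul]
    congr 1
    refine Complex.ext ?_ ?_ <;> simp
  · change c ⁅x, v⁆ = ⁅θ x, c v⁆
    obtain ⟨a, b, h1, h2⟩ := hθ.exists_eq_add x
    have h3 : ⁅x, v⁆ = ⁅a, v⁆ + Complex.I • ⁅b, v⁆ := by
      rw [h1, add_lie, smul_lie]; rfl
    have h4 : ⁅θ x, c v⁆ = ⁅a, c v⁆ - Complex.I • ⁅b, c v⁆ := by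
      rw [h2, sub_lie, smul_lie]; rfl
    rw [h3, h4, map_add, hcJ, hclie, hclie, sub_eq_add_neg]
  · have h1 := hpos v hv
    rw [hS] at h1
    exact h1

end CompactForm

/-! ### Minors and ranks of polynomial families -/

section Minors

theorem exists_linearIndependent_col {K m n : Type*} [Field K] [Fintype n] [Finite m] {r : ℕ}
    {M : Matrix m n K} (h : r ≤ M.rank) :
    ∃ t : Fin r → n, LinearIndependent K fun j => M.col (t j) := by
  rw [Matrix.rank_eq_finrank_span_cols] at h
  obtain ⟨f, hf, -, hli⟩ := Submodule.exists_fun_fin_finrank_span_eq K (Set.range M.col)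
  choose t ht using hf
  refine ⟨t ∘ Fin.castLE h, ?_⟩
  have h1 := hli.comp (Fin.castLE h) (Fin.castLE_injective h)
  have h2 : (fun j => M.col ((t ∘ Fin.castLE h) j)) = f ∘ Fin.castLE h := funext fun j => ht _
  rw [h2]
  exact h1

theorem exists_minor_ne_zero {K m n : Type*} [Field K] [Fintype n] [Fintype m] {r : ℕ}
    {M : Matrix m n K} (h : r ≤ M.rank) :
    ∃ (s : Fin r → m) (t : Fin r → n), (M.submatrix s t).det ≠ 0 := by
  obtain ⟨t, ht⟩ := exists_linearIndependent_col h
  have h1 : r ≤ (M.submatrix id t).transpose.rank := by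
    have h2 : LinearIndependent K (M.submatrix id t).transpose.row := ht
    rw [h2.rank_matrix, Fintype.card_fin]
  obtain ⟨s, hs⟩ := exists_linearIndependent_col h1
  refine ⟨s, t, ?_⟩
  have h2 : LinearIndependent K (M.submatrix s t).row := hs
  rw [Matrix.linearIndependent_rows_iff_isUnit, Matrix.isUnit_iff_isUnit_det] at h2
  exact h2.ne_zero

theorem le_rank_of_minor_ne_zero {K m n : Type*} [Field K] [Fintype n] [Fintype m] {r : ℕ}
    {M : Matrix m n K} {s : Fin r → m} {t : Fin r → n} (h : (M.submatrix s t).det ≠ 0) :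
    r ≤ M.rank := by
  have h1 := Matrix.rank_of_det_ne_zero h
  rw [Fintype.card_fin] at h1
  exact h1.symm.le.trans (M.rank_submatrix_le s t)

theorem det_submatrix_map {R K m n : Type*} [CommRing R] [CommRing K] {r : ℕ} (f : R →+* K)
    (M : Matrix m n R) (s : Fin r → m) (t : Fin r → n) :
    ((M.map f).submatrix s t).det = f (M.submatrix s t).det := by
  rw [RingHom.map_det]
  rfl

end Minors

section PolyMatrix

variable {σ ι : Type*} [Fintype ι] {N N' : Type*} [AddCommGroup N] [Module ℝ N]
  [AddCommGroup N'] [Module ℝ N'] {m n : Type*} [Fintype m] [Fintype n] [DecidableEq m] [DecidableEq n]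

/-- The matrix of the family `∑ pᵢ • Tᵢ` of linear maps, depending polynomially on parameters. -/
def polyMatrix (b : Basis n ℝ N) (b' : Basis m ℝ N') (p : ι → MvPolynomial σ ℝ)
    (T : ι → N →ₗ[ℝ] N') : Matrix m n (MvPolynomial σ ℝ) :=
  ∑ i, p i • (LinearMap.toMatrix b b' (T i)).map MvPolynomial.C

theorem polyMatrix_map_eval (b : Basis n ℝ N) (b' : Basis m ℝ N') (p : ι → MvPolynomial σ ℝ)
    (T : ι → N →ₗ[ℝ] N') (x : σ → ℝ) :
    (polyMatrix b b' p T).map (MvPolynomial.eval x) =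
      LinearMap.toMatrix b b' (∑ i, MvPolynomial.eval x (p i) • T i) := by
  ext j k
  simp [polyMatrix, Matrix.sum_apply]

theorem polyMatrix_map_aeval (b : Basis n ℝ N) (b' : Basis m ℝ N') (p : ι → MvPolynomial σ ℝ)
    (T : ι → N →ₗ[ℝ] N') (z : σ → ℂ) :
    (polyMatrix b b' p T).map (MvPolynomial.aeval z : MvPolynomial σ ℝ →ₐ[ℝ] ℂ).toRingHom =
      LinearMap.toMatrix (Algebra.TensorProduct.basis ℂ b) (Algebra.TensorProduct.basis ℂ b')
        (∑ i, (MvPolynomial.aeval z (p i) : ℂ) • LinearMap.baseChange ℂ (T i)) := by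
  have h1 (i : ι) : LinearMap.toMatrix (Algebra.TensorProduct.basis ℂ b) (Algebra.TensorProduct.basis ℂ b')
      (LinearMap.baseChange ℂ (T i)) = (LinearMap.toMatrix b b' (T i)).map (algebraMap ℝ ℂ) :=
    LinearMap.toMatrix_baseChange ℂ (T i) b b'
  rw [map_sum]
  simp only [map_smul, h1]
  ext j k
  simp [polyMatrix, Matrix.sum_apply]

end PolyMatrix

theorem rank_toMatrix {K N N' m n : Type*} [Field K] [AddCommGroup N] [Module K N]
    [AddCommGroup N'] [Module K N'] [Fintype m] [Fintype n] [DecidableEq n]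
    (b : Basis n K N) (b' : Basis m K N') (T : N →ₗ[K] N') :
    (LinearMap.toMatrix b b' T).rank = finrank K (LinearMap.range T) := by
  rw [Matrix.rank_eq_finrank_range_toLin _ b' b, Matrix.toLin_toMatrix]

theorem aeval_ofReal {σ : Type*} (q : MvPolynomial σ ℝ) (x : σ → ℝ) :
    MvPolynomial.aeval (fun i => (x i : ℂ)) q = ((MvPolynomial.eval x q : ℝ) : ℂ) := by
  have h1 := (MvPolynomial.aeval_algebraMap_apply ℂ x q)
  exact h1

/-- A polynomial not vanishing at `a + I b` does not vanish at some `a + t b` with `t` real. -/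
theorem exists_real_aeval_ne_zero {σ : Type*} (q : MvPolynomial σ ℝ) (a b : σ → ℂ)
    (h : MvPolynomial.aeval (a + Complex.I • b) q ≠ 0) :
    ∃ t : ℝ, MvPolynomial.aeval (a + (t : ℂ) • b) q ≠ 0 := by
  let f : Polynomial ℂ :=
    MvPolynomial.aeval (fun i => Polynomial.C (a i) + Polynomial.X * Polynomial.C (b i)) q
  have hf (t : ℂ) : f.eval t = MvPolynomial.aeval (a + t • b) q := by
    have h1 := MvPolynomial.map_aeval
      (fun i => Polynomial.C (a i) + Polynomial.X * Polynomial.C (b i)) (Polynomial.evalRingHom t) q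
    rw [Polynomial.coe_evalRingHom] at h1
    have h2 : (Polynomial.evalRingHom t).comp (algebraMap ℝ (Polynomial ℂ)) = algebraMap ℝ ℂ :=
      RingHom.ext fun x => by simp
    have h3 (i : σ) : Polynomial.eval t (Polynomial.C (a i) + Polynomial.X * Polynomial.C (b i)) =
        (a + t • b) i := by
      simp only [Polynomial.eval_add, Polynomial.eval_mul, Polynomial.eval_C, Polynomial.eval_X]
      rfl
    rw [h1, h2]
    simp only [h3]
    rfl
  have hf0 : f ≠ 0 := by
    rintro h0
    rw [← hf, h0, Polynomial.eval_zero] at h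
    exact h rfl
  by_contra! hcon
  refine hf0 (Polynomial.eq_zero_of_infinite_isRoot f ?_)
  refine Set.Infinite.mono (s := Set.range fun t : ℝ => (t : ℂ)) ?_
    (Set.infinite_range_of_injective Complex.ofReal_injective)
  rintro _ ⟨t, rfl⟩
  change f.eval (t : ℂ) = 0
  rw [hf, hcon]

/-! ### The moment operator -/

section Moment

variable {K L V : Type*} [Field K] [LieRing L] [LieAlgebra K L] [FiniteDimensional K L]
  [AddCommGroup V] [Module K V] [LieRingModule L V] [LieModule K L V]

variable (K L) in
/-- The infinitesimal orbit map of a vector. -/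
def orbitMap (v : V) : L →ₗ[K] V := (LieModule.toEnd K L V : L →ₗ[K] Module.End K V).flip v

@[simp] theorem orbitMap_apply (v : V) (X : L) : orbitMap K L v X = ⁅X, v⁆ := rfl

theorem orbitMap_sum {ι : Type*} [Fintype ι] (x : ι → K) (e : ι → V) :
    orbitMap K L (∑ i, x i • e i) = ∑ i, x i • orbitMap K L (e i) := by
  rw [orbitMap, map_sum]
  simp only [map_smul]
  rfl

variable [LieAlgebra.IsKilling K L]

theorem killing_ext {X X' : L} (h : ∀ Y, killingForm K L X Y = killingForm K L X' Y) : X = X' := by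
  have h1 := LieAlgebra.IsKilling.killingForm_nondegenerate K L
  refine sub_eq_zero.1 (h1.1 _ fun Y => ?_)
  rw [LinearMap.map_sub₂, h, sub_self]

/-- The operator `Φ` with `κ(Φ X, Y) = B(X v, Y w)`. -/
def momentOp (B : LinearMap.BilinForm K V) (v w : V) : Module.End K L :=
  ((killingForm K L).toDual (LieAlgebra.IsKilling.killingForm_nondegenerate K L)).symm.toLinearMap
    ∘ₗ ((orbitMap K L w).dualMap ∘ₗ B ∘ₗ orbitMap K L v)

theorem killingForm_momentOp (B : LinearMap.BilinForm K V) (v w : V) (X Y : L) :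
    killingForm K L (momentOp B v w X) Y = B ⁅X, v⁆ ⁅Y, w⁆ := by
  rw [← LinearMap.BilinForm.toDual_def (LieAlgebra.IsKilling.killingForm_nondegenerate K L),
    momentOp]
  simp

theorem momentOp_sum {ι : Type*} [Fintype ι] (B : LinearMap.BilinForm K V) (x : ι → K)
    (e : ι → V) : momentOp (L := L) B (∑ i, x i • e i) (∑ i, x i • e i) =
      ∑ p : ι × ι, (x p.1 * x p.2) • momentOp B (e p.1) (e p.2) := by
  refine LinearMap.ext fun X => killing_ext (K := K) fun Y => ?_
  rw [killingForm_momentOp, ← orbitMap_apply (K := K), ← orbitMap_apply (K := K), orbitMap_sum,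
    LinearMap.sum_apply, LinearMap.sum_apply, LinearMap.sum_apply]
  simp only [map_sum, LinearMap.sum_apply, LinearMap.smul_apply, map_smul, killingForm_momentOp,
    orbitMap_apply, smul_eq_mul, Fintype.sum_prod_type, Finset.mul_sum]
  rw [Finset.sum_comm]
  refine Finset.sum_congr rfl fun i _ => Finset.sum_congr rfl fun j _ => by ring

theorem range_eq_of_ker_eq {W W' : Type*} [AddCommGroup W] [Module K W] [AddCommGroup W']
    [Module K W'] {S : L →ₗ[K] W} {T : L →ₗ[K] W'} (h : LinearMap.ker S = LinearMap.ker T) :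
    finrank K (LinearMap.range S) = finrank K (LinearMap.range T) := by
  have h1 := S.finrank_range_add_finrank_ker
  have h2 := T.finrank_range_add_finrank_ker
  rw [h] at h1
  omega

/-- If the square of the moment operator has the rank of the orbit map, the Killing form is
nondegenerate on the stabilizer. -/
theorem eq_zero_of_orthogonal_stab {B : LinearMap.BilinForm K V} {v : V}
    (hsymm : ∀ x y, B x y = B y x)
    (hker : ∀ X : L, momentOp B v v (momentOp B v v X) = 0 → ⁅X, v⁆ = 0) {X : L}
    (hX : ⁅X, v⁆ = 0) (h : ∀ Y : L, ⁅Y, v⁆ = 0 → killingForm K L X Y = 0) : X = 0 := by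
  set φ : Module.End K L := momentOp B v v with hφ
  have hz (Y : L) (hY : ⁅Y, v⁆ = 0) : φ Y = 0 := killing_ext (K := K) fun Z => by
    rw [hφ, killingForm_momentOp, hY, map_zero, LinearMap.zero_apply, map_zero,
      LinearMap.zero_apply]
  have hadj (Y Z : L) : killingForm K L (φ Y) Z = killingForm K L Y (φ Z) := by
    rw [LieModule.traceForm_comm K L L Y, hφ, killingForm_momentOp, killingForm_momentOp, hsymm]
  -- `φ` is self-adjoint for `κ`, so an `X` orthogonal to `ker φ` lies in its range. If `X = φ Z`
  -- also stabilizes `v`, then `φ² Z = 0`, so `Z` stabilizes `v` and `X = φ Z = 0`.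
  have hrange : X ∈ LinearMap.range φ := by
    by_contra hcon
    obtain ⟨f, hf0, hf⟩ := Submodule.exists_dual_map_eq_bot_of_notMem hcon inferInstance
    have hnd := LieAlgebra.IsKilling.killingForm_nondegenerate K L
    obtain ⟨Z, rfl⟩ := ((killingForm K L).toDual hnd).surjective f
    refine hf0 ?_
    rw [LinearMap.BilinForm.toDual_def, LieModule.traceForm_comm]
    refine h Z (hker Z ?_)
    have h1 : φ Z = 0 := killing_ext (K := K) fun Y => by
      rw [hadj, map_zero, LinearMap.zero_apply]
      have h2 : ((killingForm K L).toDual hnd Z) (φ Y) ∈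
          (LinearMap.range φ).map ((killingForm K L).toDual hnd Z) := ⟨φ Y, ⟨Y, rfl⟩, rfl⟩
      rw [hf] at h2
      exact (Submodule.mem_bot K).1 h2
    rw [h1, map_zero]
  obtain ⟨Z, rfl⟩ := hrange
  exact hz Z (hker Z (hz _ hX))

end Moment

/-- At a vector fixed by a compatible conjugation, the moment operator is semisimple with kernel
the stabilizer. -/
theorem lie_eq_zero_of_momentOp_sq {L E : Type*} [LieRing L] [LieAlgebra ℂ L]
    [FiniteDimensional ℂ L] [LieAlgebra.IsKilling ℂ L] [AddCommGroup E] [Module ℂ E]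
    [LieRingModule L E] [LieModule ℂ L E] {θ : L →+ L}
    (hneg : ∀ x, x ≠ 0 → (killingForm ℂ L x (θ x)).re < 0)
    {B : LinearMap.BilinForm ℂ E} {c : E →+ E} (hc : ∀ (x : L) v, c ⁅x, v⁆ = ⁅θ x, c v⁆)
    (hpos : ∀ v, v ≠ 0 → 0 < (B v (c v)).re) {v : E} (hv : c v = v) {φ : Module.End ℂ L}
    (hφ : ∀ X Y, killingForm ℂ L (φ X) Y = B ⁅X, v⁆ ⁅Y, v⁆) {X : L} (hX : φ (φ X) = 0) :
    ⁅X, v⁆ = 0 := by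
  -- As `c v = v`, one has `θ(Y) v = c(Y v)` and hence `κ(φ Y, θ Y) = B(Y v, c(Y v))`, whose real
  -- part is positive unless `Y v = 0`.
  have key (Y : L) (hY : φ Y = 0) : ⁅Y, v⁆ = 0 := by
    by_contra hcon
    have h1 := hφ Y (θ Y)
    have h2 := hpos _ hcon
    rw [hc, hv, ← h1, hY, map_zero, LinearMap.zero_apply] at h2
    exact lt_irrefl _ h2
  refine key X ?_
  -- By `key`, `φ X` annihilates `v`, and so does `θ(φ X)`. Hence `κ(φ X, θ(φ X)) = B(X v, θ(φ X) v)
  -- = 0`, contrary to `hneg`.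
  by_contra hcon
  have h1 := hφ X (θ (φ X))
  have h2 := hneg _ hcon
  have h3 := hc (φ X) v
  rw [key _ hX, map_zero, hv] at h3
  rw [h1, ← h3, map_zero] at h2
  exact lt_irrefl _ h2

/-! ### Genericity of maximal orbits with nondegenerate stabilizers -/

section Generic

variable {L V : Type*} [LieRing L] [LieAlgebra ℝ L] [FiniteDimensional ℝ L]
  [LieAlgebra.IsKilling ℝ L] [AddCommGroup V] [Module ℝ V] [FiniteDimensional ℝ V]
  [LieRingModule L V] [LieModule ℝ L V]

theorem baseChange_invariant {B : LinearMap.BilinForm ℝ V}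
    (hinv : ∀ (x : L) v w, B ⁅x, v⁆ w = -B v ⁅x, w⁆) (x : ℂ ⊗[ℝ] L) (v w : ℂ ⊗[ℝ] V) :
    B.baseChange ℂ ⁅x, v⁆ w = -B.baseChange ℂ v ⁅x, w⁆ := by
  induction x with
  | zero => simp
  | add x y hx hy => simp only [add_lie, map_add, LinearMap.add_apply, hx, hy, neg_add]
  | tmul a x =>
    induction v with
    | zero => simp [lie_zero (a ⊗ₜ[ℝ] x : ℂ ⊗[ℝ] L)]
    | add v v' hv hv' => 
      rw [lie_add (a ⊗ₜ[ℝ] x : ℂ ⊗[ℝ] L) v v', LinearMap.map_add₂, hv, hv', LinearMap.map_add₂,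
        neg_add]
    | tmul b v =>
      induction w with
      | zero => simp [lie_zero (a ⊗ₜ[ℝ] x : ℂ ⊗[ℝ] L)]
      | add w w' hw hw' => 
        rw [lie_add (a ⊗ₜ[ℝ] x : ℂ ⊗[ℝ] L) w w', map_add, hw, hw', map_add, neg_add]
      | tmul c w =>
        simp only [LieAlgebra.ExtendScalars.bracket_tmul, LinearMap.BilinForm.baseChange_tmul, hinv]
        rw [neg_smul]
        congr 2
        ring

theorem baseChange_nondegenerate {B : LinearMap.BilinForm ℝ V}
    (hnd : ∀ v, (∀ w, B v w = 0) → v = 0) {v : ℂ ⊗[ℝ] V}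
    (hv : ∀ w, B.baseChange ℂ v w = 0) : v = 0 := by
  have key (w : V) : B (rePart V v) w = 0 ∧ B (imPart V v) w = 0 := by
    have h1 := hv (1 ⊗ₜ w)
    rw [eq_rePart_add_imPart v, LinearMap.map_add₂] at h1
    simp only [LinearMap.BilinForm.baseChange_tmul] at h1
    have h2 := congrArg Complex.re h1
    have h3 := congrArg Complex.im h1
    simp at h2 h3
    exact ⟨h2, h3⟩
  rw [eq_rePart_add_imPart v, hnd _ fun w => (key w).1, hnd _ fun w => (key w).2]
  simp

theorem killingForm_baseChange_momentOp (B : LinearMap.BilinForm ℝ V) (v w : V) (X Y : ℂ ⊗[ℝ] L) :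
    killingForm ℂ (ℂ ⊗[ℝ] L) (LinearMap.baseChange ℂ (momentOp B v w) X) Y =
      B.baseChange ℂ ⁅X, (1 : ℂ) ⊗ₜ[ℝ] v⁆ ⁅Y, (1 : ℂ) ⊗ₜ[ℝ] w⁆ := by
  have hk : killingForm ℂ (ℂ ⊗[ℝ] L) = (killingForm ℝ L).baseChange ℂ :=
    LieModule.traceForm_baseChange ..
  rw [hk]
  induction X with
  | zero => simp
  | add x y hx hy => rw [map_add, LinearMap.map_add₂, hx, hy, add_lie, LinearMap.map_add₂]
  | tmul a x =>
    induction Y with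
    | zero => simp
    | add x y hx hy => rw [map_add, hx, hy, add_lie, map_add]
    | tmul b y =>
      simp [LieAlgebra.ExtendScalars.bracket_tmul, killingForm_momentOp]

variable (L) in
theorem exists_max_rank (V : Type*) [AddCommGroup V] [Module ℝ V] [LieRingModule L V]
    [LieModule ℝ L V] : ∃ v : V, ∀ w : V, finrank ℝ (LinearMap.range (orbitMap ℝ L w)) ≤
      finrank ℝ (LinearMap.range (orbitMap ℝ L v)) := by
  have hbdd : BddAbove (Set.range fun v : V => finrank ℝ (LinearMap.range (orbitMap ℝ L v))) :=
    ⟨finrank ℝ L, by rintro _ ⟨v, rfl⟩; exact LinearMap.finrank_range_le _⟩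
  obtain ⟨v, hv⟩ := Nat.sSup_mem (Set.range_nonempty _) hbdd
  exact ⟨v, fun w => (le_csSup hbdd ⟨w, rfl⟩).trans hv.ge⟩

/-- For a generic vector of an orthogonal representation the orbit map has maximal rank and the
Killing form is nondegenerate on the stabilizer. -/
theorem exists_generic_polynomial {B : LinearMap.BilinForm ℝ V} (hsymm : ∀ v w, B v w = B w v)
    (hnd : ∀ v, (∀ w, B v w = 0) → v = 0) (hinv : ∀ (x : L) v w, B ⁅x, v⁆ w = -B v ⁅x, w⁆) :
    ∃ q : MvPolynomial (Fin (finrank ℝ V)) ℝ, q ≠ 0 ∧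
      ∀ v : V, MvPolynomial.eval (fun i => (finBasis ℝ V).repr v i) q ≠ 0 →
        (∀ w : V, finrank ℝ (LinearMap.range (orbitMap ℝ L w)) ≤
          finrank ℝ (LinearMap.range (orbitMap ℝ L v))) ∧
        ∀ X : L, ⁅X, v⁆ = 0 → (∀ Y : L, ⁅Y, v⁆ = 0 → killingForm ℝ L X Y = 0) → X = 0 := by
  classical
  obtain ⟨v₀, hv₀⟩ := exists_max_rank L V
  set r := finrank ℝ (LinearMap.range (orbitMap ℝ L v₀)) with hr
  set e := finBasis ℝ V
  set bL := finBasis ℝ L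
  set eC := Algebra.TensorProduct.basis ℂ e
  set bC := Algebra.TensorProduct.basis ℂ bL
  have heC (i) : eC i = 1 ⊗ₜ e i := Algebra.TensorProduct.basis_apply _ _
  -- the orbit maps and the squares of the moment operators as polynomial families
  let σ := Fin (finrank ℝ V)
  let M := polyMatrix bL e (fun i : σ => MvPolynomial.X i) fun i => orbitMap ℝ L (e i)
  let N := polyMatrix bL bL
    (fun p : σ × σ => (MvPolynomial.X p.1 * MvPolynomial.X p.2 : MvPolynomial σ ℝ))
    fun p => momentOp (L := L) B (e p.1) (e p.2)
  have hMr (x : σ → ℝ) : M.map (MvPolynomial.eval x) =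
      LinearMap.toMatrix bL e (orbitMap ℝ L (∑ i, x i • e i)) := by
    rw [polyMatrix_map_eval, orbitMap_sum]
    simp only [MvPolynomial.eval_X]
  have hNr (x : σ → ℝ) : N.map (MvPolynomial.eval x) =
      LinearMap.toMatrix bL bL (momentOp B (∑ i, x i • e i) (∑ i, x i • e i)) := by
    rw [polyMatrix_map_eval, momentOp_sum]
    simp only [MvPolynomial.eval_X, map_mul]
  have hMc (z : σ → ℂ) : M.map (MvPolynomial.aeval z : MvPolynomial σ ℝ →ₐ[ℝ] ℂ).toRingHom =
      LinearMap.toMatrix bC eC (orbitMap ℂ (ℂ ⊗[ℝ] L) (∑ i, z i • eC i)) := by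
    rw [polyMatrix_map_aeval, orbitMap_sum]
    simp only [MvPolynomial.aeval_X]
    congr 1
    refine Finset.sum_congr rfl fun i _ => ?_
    congr 1
    refine LinearMap.ext fun X => ?_
    rw [orbitMap_apply, heC]
    induction X with
    | zero => simp
    | add x y hx hy => rw [map_add, hx, hy, add_lie]
    | tmul a x => simp [LieAlgebra.ExtendScalars.bracket_tmul]
  have hNc (z : σ → ℂ) : ∃ φ : Module.End ℂ (ℂ ⊗[ℝ] L),
      N.map (MvPolynomial.aeval z : MvPolynomial σ ℝ →ₐ[ℝ] ℂ).toRingHom =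
        LinearMap.toMatrix bC bC φ ∧ ∀ X Y, killingForm ℂ (ℂ ⊗[ℝ] L) (φ X) Y =
          B.baseChange ℂ ⁅X, ∑ i, z i • eC i⁆ ⁅Y, ∑ i, z i • eC i⁆ := by
    refine ⟨_, polyMatrix_map_aeval _ _ _ _ z, fun X Y => ?_⟩
    simp only [map_mul, MvPolynomial.aeval_X]
    have hs (Z : ℂ ⊗[ℝ] L) : ⁅Z, ∑ i, z i • eC i⁆ = ∑ i, z i • ⁅Z, (1 : ℂ) ⊗ₜ[ℝ] e i⁆ := by
      have h1 := LinearMap.congr_fun (orbitMap_sum (K := ℂ) (L := ℂ ⊗[ℝ] L) z fun i => eC i) Z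
      rw [LinearMap.sum_apply] at h1
      simp only [heC] at h1 ⊢
      exact h1
    rw [LinearMap.sum_apply, map_sum, LinearMap.sum_apply, hs, hs, LinearMap.map_sum₂,
      Fintype.sum_prod_type]
    refine Finset.sum_congr rfl fun i _ => ?_
    rw [map_sum]
    refine Finset.sum_congr rfl fun j _ => ?_
    rw [LinearMap.smul_apply, LinearMap.map_smul₂, killingForm_baseChange_momentOp,
      LinearMap.map_smul₂, map_smul, smul_smul]
  -- a minor of the orbit map does not vanish at a vector fixed by the compatible conjugation
  obtain ⟨θ, hθ, hneg⟩ := exists_compact_conjugation (ℂ ⊗[ℝ] L)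
  obtain ⟨c, hcs, hcl, hcc, hcpos⟩ := hθ.exists_compatible hneg (B := B.baseChange ℂ)
    (fun v w => (LinearMap.BilinForm.IsSymm.baseChange ℂ ⟨hsymm⟩).eq v w)
    (fun v => baseChange_nondegenerate hnd) (baseChange_invariant hinv)
  have hmin : r ≤ (M.map (MvPolynomial.eval (e.equivFun v₀))).rank := by
    rw [hMr, rank_toMatrix, e.sum_equivFun]
  obtain ⟨s, t, hst⟩ := exists_minor_ne_zero hmin
  rw [det_submatrix_map] at hst
  set z₀ : ℂ ⊗[ℝ] V := 1 ⊗ₜ v₀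
  -- `z₀ = a + I b` with `a` and `b` fixed by `c`. A polynomial that does not vanish there does not
  -- vanish at some `a + τ b` with `τ` real, which is fixed by `c` as well.
  let a : ℂ ⊗[ℝ] V := (1 / 2 : ℂ) • (z₀ + c z₀)
  let b : ℂ ⊗[ℝ] V := (-Complex.I / 2) • (z₀ - c z₀)
  have hca : c a = a := by
    rw [hcs, map_add, hcc, add_comm]
    congr 1
    simp [Complex.conj_ofNat]
  have hcb : c b = b := by
    rw [hcs, map_sub, hcc, ← neg_sub, smul_neg, ← neg_smul]
    congr 1
    simp [neg_div, Complex.conj_ofNat]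
  have hab : z₀ = a + Complex.I • b := by
    rw [smul_smul, show Complex.I * (-Complex.I / 2) = 1 / 2 by
      rw [mul_div_assoc', mul_neg, Complex.I_mul_I, neg_neg], ← smul_add, add_add_sub_cancel,
      ← two_smul ℂ, smul_smul]
    norm_num
  have hz₀ : eC.equivFun z₀ = fun i => ((e.equivFun v₀ i : ℝ) : ℂ) := by
    funext i
    simp [eC, z₀]
  have hne : MvPolynomial.aeval (eC.equivFun a + Complex.I • eC.equivFun b)
      (M.submatrix s t).det ≠ 0 := by
    rw [← map_smul, ← map_add, ← hab, hz₀, aeval_ofReal]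
    exact Complex.ofReal_ne_zero.2 hst
  obtain ⟨τ, hτ⟩ := exists_real_aeval_ne_zero _ _ _ hne
  rw [← map_smul, ← map_add] at hτ
  set u := a + (τ : ℂ) • b
  have hcu : c u = u := by
    rw [map_add, hcs (τ : ℂ) b, hca, hcb, Complex.conj_ofReal]
  have hsum : ∑ i, eC.equivFun u i • eC i = u := eC.sum_equivFun u
  have h1 : r ≤ (M.map
      (MvPolynomial.aeval (eC.equivFun u) : MvPolynomial σ ℝ →ₐ[ℝ] ℂ).toRingHom).rank := by
    refine le_rank_of_minor_ne_zero (s := s) (t := t) ?_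
    rw [det_submatrix_map]
    exact hτ
  rw [hMc, hsum, rank_toMatrix] at h1
  obtain ⟨φ, hφN, hφ⟩ := hNc (eC.equivFun u)
  rw [hsum] at hφ
  have hker : LinearMap.ker (φ * φ) = LinearMap.ker (orbitMap ℂ (ℂ ⊗[ℝ] L) u) := by
    ext X
    refine ⟨fun hX => lie_eq_zero_of_momentOp_sq hneg hcl hcpos hcu hφ hX, fun hX => ?_⟩
    have h2 : φ X = 0 := killing_ext (K := ℂ) fun Y => by
      rw [hφ, show ⁅X, u⁆ = 0 from hX, map_zero, LinearMap.zero_apply, map_zero,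
        LinearMap.zero_apply]
    rw [LinearMap.mem_ker, Module.End.mul_apply, h2, map_zero]
  rw [← range_eq_of_ker_eq hker, ← rank_toMatrix bC bC, LinearMap.toMatrix_mul, ← hφN,
    ← Matrix.map_mul] at h1
  obtain ⟨s', t', hst'⟩ := exists_minor_ne_zero h1
  rw [det_submatrix_map] at hst'
  -- This minor of the squared moment operator has real coefficients; it is a nonzero polynomial
  -- because its value at the complex vector `u` is nonzero.
  refine ⟨((N * N).submatrix s' t').det, fun h0 => hst' (by rw [h0, map_zero]), fun v hv => ?_⟩
  have h2 : r ≤ ((N * N).map (MvPolynomial.eval (e.equivFun v))).rank := by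
    refine le_rank_of_minor_ne_zero (s := s') (t := t') ?_
    rw [det_submatrix_map]
    exact hv
  rw [Matrix.map_mul, hNr, e.sum_equivFun, ← LinearMap.toMatrix_mul, rank_toMatrix] at h2
  set ψ := momentOp (L := L) B v v
  -- The rank of `ψ²` is at least `r` and that of the orbit map at most `r`, so this inclusion of
  -- kernels is an equality.
  have hle : LinearMap.ker (orbitMap ℝ L v) ≤ LinearMap.ker (ψ * ψ) := by
    intro X hX
    have h3 : ψ X = 0 := killing_ext (K := ℝ) fun Y => by
      rw [killingForm_momentOp, show ⁅X, v⁆ = 0 from hX, map_zero, LinearMap.zero_apply, map_zero,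
        LinearMap.zero_apply]
    rw [LinearMap.mem_ker, Module.End.mul_apply, h3, map_zero]
  have h3 := (ψ * ψ).finrank_range_add_finrank_ker
  have h4 := (orbitMap ℝ L v).finrank_range_add_finrank_ker
  have h5 := Submodule.finrank_mono hle
  have h6 := hv₀ v
  have hker' := Submodule.eq_of_le_of_finrank_eq hle (by omega)
  refine ⟨fun w => (hv₀ w).trans (by omega), fun X hX h => ?_⟩
  refine eq_zero_of_orthogonal_stab hsymm (fun Y hY => ?_) hX h
  have h7 : Y ∈ LinearMap.ker (ψ * ψ) := hY
  rw [← hker'] at h7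
  exact h7

end Generic

/-! ### Stabilizers of vectors with maximal orbit dimension -/

section MaxRank

variable {L V : Type*} [LieRing L] [LieAlgebra ℝ L] [FiniteDimensional ℝ L]
  [NormedAddCommGroup V] [NormedSpace ℝ V] [FiniteDimensional ℝ V]
  [LieRingModule L V] [LieModule ℝ L V]

open Filter Topology in
/-- The stabilizer of a vector with orbit of maximal dimension acts trivially on the normal
space of the orbit. -/
theorem exists_lie_eq_of_max_rank {v : V}
    (hmax : ∀ w : V, finrank ℝ (LinearMap.range (orbitMap ℝ L w)) ≤
      finrank ℝ (LinearMap.range (orbitMap ℝ L v))) {X : L} (hX : ⁅X, v⁆ = 0) (w : V) :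
    ⁅X, w⁆ ∈ LinearMap.range (orbitMap ℝ L v) := by
  by_contra hcon
  set R := LinearMap.range (orbitMap ℝ L v)
  let b := finBasis ℝ R
  have hb (i) : ∃ Z : L, orbitMap ℝ L v Z = b i := (b i).2
  choose Z hZ using hb
  -- For `t ≠ 0` these vectors are the images of `t⁻¹ X` and of the `Z i` under the orbit map of `v
  -- + t w`. At `t = 0` they are independent if `[X, w]` is outside `R`, and independence is an open
  -- condition; so nearby orbits would be larger.
  let f : ℝ → Fin (finrank ℝ R + 1) → V := fun t =>
    Fin.cons ⁅X, w⁆ fun i => ⁅Z i, v⁆ + t • ⁅Z i, w⁆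
  have hf : Continuous f := by
    refine continuous_pi fun i => ?_
    refine Fin.cases ?_ (fun i => ?_) i
    · exact continuous_const
    · exact continuous_const.add (continuous_id.smul continuous_const)
  have h0 : LinearIndependent ℝ (f 0) := by
    refine linearIndependent_finCons.2 ⟨?_, fun hmem => hcon ?_⟩
    · have h1 : (fun i => ⁅Z i, v⁆ + (0 : ℝ) • ⁅Z i, w⁆) = fun i => ((b i : R) : V) := by
        funext i
        rw [zero_smul, add_zero, ← hZ]; rfl
      rw [h1]
      exact b.linearIndependent.map' R.subtype R.ker_subtype
    · refine Submodule.span_le.2 ?_ hmem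
      rintro _ ⟨i, rfl⟩
      simp only [zero_smul, add_zero]
      exact ⟨Z i, rfl⟩
  have hopen : ∀ᶠ t in 𝓝 (0 : ℝ), LinearIndependent ℝ (f t) :=
    hf.continuousAt.eventually (isOpen_setOfPred_linearIndependent.mem_nhds h0)
  obtain ⟨t, ht, ht0⟩ := ((hopen.filter_mono nhdsWithin_le_nhds).and
    (self_mem_nhdsWithin : {0}ᶜ ∈ 𝓝[≠] (0 : ℝ))).exists
  have ht0' : t ≠ 0 := ht0
  have h1 : Submodule.span ℝ (Set.range (f t)) ≤ LinearMap.range (orbitMap ℝ L (v + t • w)) := by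
    rw [Submodule.span_le]
    rintro _ ⟨i, rfl⟩
    refine Fin.cases ?_ (fun i => ?_) i
    · refine ⟨t⁻¹ • X, ?_⟩
      rw [orbitMap_apply, smul_lie, lie_add, hX, lie_smul, zero_add, smul_smul,
        inv_mul_cancel₀ ht0', one_smul]
      rfl
    · refine ⟨Z i, ?_⟩
      rw [orbitMap_apply, lie_add, lie_smul]
      rfl
  have h2 := Submodule.finrank_mono h1
  rw [finrank_span_eq_card ht, Fintype.card_fin] at h2
  have h3 := hmax (v + t • w)
  omega

theorem lie_mem_ker_orbitMap {v : V} {X : L} (hX : ⁅X, v⁆ = 0) :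
    ∀ Y ∈ LinearMap.ker (orbitMap ℝ L v),
      LieModule.toEnd ℝ L L X Y ∈ LinearMap.ker (orbitMap ℝ L v) := by
  intro Y hY
  rw [LinearMap.mem_ker, orbitMap_apply] at hY ⊢
  rw [LieModule.toEnd_apply_apply, lie_lie, hY, hX, lie_zero, lie_zero, sub_zero]

/-- `X` acts by zero on the quotient of `V` by the tangent space of the orbit, and that tangent
space is isomorphic to `L` modulo the stabilizer as a module over the stabilizer. -/
theorem charpoly_stab {v : V}
    (hmax : ∀ w : V, finrank ℝ (LinearMap.range (orbitMap ℝ L w)) ≤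
      finrank ℝ (LinearMap.range (orbitMap ℝ L v))) {X : L} (hX : ⁅X, v⁆ = 0) :
    (LieModule.toEnd ℝ L V X).charpoly *
        ((LieModule.toEnd ℝ L L X).restrict (lie_mem_ker_orbitMap hX)).charpoly =
      (LieModule.toEnd ℝ L L X).charpoly *
        Polynomial.X ^ (finrank ℝ V - finrank ℝ (LinearMap.range (orbitMap ℝ L v))) := by
  have hlie (Y : L) : ⁅X, ⁅Y, v⁆⁆ = ⁅⁅X, Y⁆, v⁆ := by
    rw [lie_lie, hX, lie_zero, sub_zero]
  have hR : ∀ x ∈ LinearMap.range (orbitMap ℝ L v),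
      LieModule.toEnd ℝ L V X x ∈ LinearMap.range (orbitMap ℝ L v) := by
    rintro _ ⟨Y, rfl⟩
    exact ⟨⁅X, Y⁆, (hlie Y).symm⟩
  have h1 := charpoly_eq_restrict_mul_mapQ (LieModule.toEnd ℝ L L X) _ (lie_mem_ker_orbitMap hX)
  have h2 := charpoly_eq_restrict_mul_mapQ (LieModule.toEnd ℝ L V X) _ hR
  have h3 : (LinearMap.range (orbitMap ℝ L v)).mapQ
      (LinearMap.range (orbitMap ℝ L v)) (LieModule.toEnd ℝ L V X) hR = 0 := by
    refine LinearMap.ext fun x => ?_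
    obtain ⟨w, rfl⟩ := Submodule.mkQ_surjective _ x
    rw [Submodule.mkQ_apply, Submodule.mapQ_apply, LinearMap.zero_apply,
      Submodule.Quotient.mk_eq_zero]
    exact exists_lie_eq_of_max_rank hmax hX w
  have h4 : LinearMap.charpoly ((LinearMap.ker (orbitMap ℝ L v)).mapQ
      (LinearMap.ker (orbitMap ℝ L v))
      (LieModule.toEnd ℝ L L X) (lie_mem_ker_orbitMap hX)) =
      ((LieModule.toEnd ℝ L V X).restrict hR).charpoly := by
    refine charpoly_conj' (orbitMap ℝ L v).quotKerEquivRange fun x => ?_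
    obtain ⟨Y, rfl⟩ := Submodule.mkQ_surjective _ x
    refine Subtype.ext ?_
    exact (hlie Y).symm
  rw [h1, h2, h3, h4, LinearMap.charpoly_zero, ← Submodule.finrank_quotient]
  ring

/-- The difference of the functions `ρ` of the adjoint representation and of `V` on the
stabilizer of a vector with orbit of maximal dimension. -/
theorem absReRoots_stab {v : V}
    (hmax : ∀ w : V, finrank ℝ (LinearMap.range (orbitMap ℝ L w)) ≤
      finrank ℝ (LinearMap.range (orbitMap ℝ L v))) {X : L} (hX : ⁅X, v⁆ = 0) :
    absReRoots ((LieModule.toEnd ℝ L L X).restrict (lie_mem_ker_orbitMap hX)).charpoly =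
      2 * rho L L X - 2 * rho L V X := by
  have h1 := congrArg absReRoots (charpoly_stab hmax hX)
  rw [absReRoots_mul (LinearMap.charpoly_monic _).ne_zero (LinearMap.charpoly_monic _).ne_zero,
    absReRoots_mul (LinearMap.charpoly_monic _).ne_zero (Polynomial.monic_X_pow _).ne_zero,
    absReRoots_X_pow] at h1
  rw [rho_eq, rho_eq]
  linarith

end MaxRank

/-! ### Invariant complements -/

section Complements

variable {W : Type*} [AddCommGroup W] [Module ℝ W] [FiniteDimensional ℝ W]

/-- A vector that commuting semisimple operators map into a common invariant subspace can be
corrected by an element of this subspace to a vector in their kernels. -/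
theorem exists_forall_apply_eq_zero {ι : Type*} (T : ι → Module.End ℝ W)
    (hss : ∀ i, (T i).IsSemisimple) (hcomm : ∀ i j, Commute (T i) (T j)) (s : Finset ι)
    (M N : Submodule ℝ W) (hM : ∀ i, ∀ x ∈ M, T i x ∈ M) (hN : ∀ i, ∀ x ∈ N, T i x ∈ N)
    {m : W} (hm : m ∈ M) (hmN : ∀ i, T i m ∈ N) :
    ∃ k ∈ M, k - m ∈ N ∧ ∀ i ∈ s, T i k = 0 := by
  classical
  induction s using Finset.induction_on generalizing M with
  | empty => exact ⟨m, hm, by simp, by simp⟩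
  | insert i s hi ih =>
    obtain ⟨k, hk, hkm, hks⟩ := ih M hM hm
    -- On the common kernel `M'` of the operators already treated, semisimplicity gives a `T
    -- i`-invariant complement of `N ∩ M'`. The component `c` of `k` in it satisfies `T i c ∈ N`, so
    -- `T i c = 0`.
    let M' : Submodule ℝ W := M ⊓ ⨅ j ∈ s, LinearMap.ker (T j)
    have hM' {x : W} : x ∈ M' ↔ x ∈ M ∧ ∀ j ∈ s, T j x = 0 := by
      simp [M', Submodule.mem_iInf]
    have hinv : ∀ x ∈ M', T i x ∈ M' := by
      intro x hx
      rw [hM'] at hx ⊢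
      refine ⟨hM i x hx.1, fun j hj => ?_⟩
      have h1 := LinearMap.congr_fun (hcomm j i).eq x
      rw [Module.End.mul_apply, Module.End.mul_apply, hx.2 j hj, map_zero] at h1
      exact h1
    have hss' := Module.End.IsSemisimple.restrict (hf := hss i) (p := M') hinv
    rw [Module.End.isSemisimple_iff] at hss'
    obtain ⟨q, hq, hpq⟩ := hss' (N.comap M'.subtype) (fun x hx => hN i _ hx)
    have hk' : k ∈ M' := hM'.2 ⟨hk, hks⟩
    obtain ⟨a, ha, c, hc, hac⟩ := Submodule.mem_sup.1
      (hpq.sup_eq_top.ge (Submodule.mem_top (x := (⟨k, hk'⟩ : M'))))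
    have hac' : (a : W) + c = k := congrArg Subtype.val hac
    have hTk : T i k ∈ N := by
      have h1 : T i k = T i (k - m) + T i m := by rw [map_sub, sub_add_cancel]
      rw [h1]
      exact N.add_mem (hN i _ hkm) (hmN i)
    have hTc : (T i).restrict hinv c = 0 := by
      refine Submodule.disjoint_def.1 hpq.disjoint _ ?_ (hq hc)
      change T i (c : W) ∈ N
      rw [← sub_eq_of_eq_add' hac'.symm, map_sub]
      exact N.sub_mem hTk (hN i _ ha)
    have hc' := hM'.1 c.2
    refine ⟨c, hc'.1, ?_, fun j hj => ?_⟩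
    · have h1 : (c : W) - m = (k - m) - a := by rw [← hac']; abel
      rw [h1]
      exact N.sub_mem hkm ha
    · rcases Finset.mem_insert.1 hj with rfl | hj
      · exact congrArg Subtype.val hTc
      · exact hc'.2 j hj

end Complements

/-! ### A criterion for amenable reductive subalgebras -/

section Amenable

variable {L : Type*} [LieRing L] [LieAlgebra ℝ L] [FiniteDimensional ℝ L]

/-- The roots of the characteristic polynomial of the adjoint action. -/
def adRoots (X : L) : Multiset ℂ :=
  (LinearMap.baseChange ℂ (LieModule.toEnd ℝ L L X)).charpoly.roots

theorem ofReal_killingForm (X Y : L) : ((killingForm ℝ L X Y : ℝ) : ℂ) =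
    LinearMap.trace ℂ _ (LinearMap.baseChange ℂ (LieModule.toEnd ℝ L L X) *
      LinearMap.baseChange ℂ (LieModule.toEnd ℝ L L Y)) := by
  have h1 : LinearMap.baseChange ℂ (LieModule.toEnd ℝ L L X) *
      LinearMap.baseChange ℂ (LieModule.toEnd ℝ L L Y) =
      LinearMap.baseChange ℂ (LieModule.toEnd ℝ L L X ∘ₗ LieModule.toEnd ℝ L L Y) :=
    (LinearMap.baseChange_comp _ _).symm
  rw [h1, LinearMap.trace_baseChange]
  rfl

/-- The trace of `Re(T) T` is the sum of the `Re(z) z`, and the Killing form is its real part. -/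
theorem killingForm_eq_sum_re {X H : L} (h : ActsAs L reHom X H) :
    killingForm ℝ L H X = ((adRoots X).map fun z => z.re ^ 2).sum := by
  have h1 := congrArg Complex.re (ofReal_killingForm H X)
  rw [show LinearMap.baseChange ℂ (LieModule.toEnd ℝ L L H) = _ from h, trace_spectralMap_mul,
    re_multiset_sum, Complex.ofReal_re] at h1
  rw [h1, adRoots]
  congr 2
  funext z
  simp [sq]

theorem killingForm_self_eq_sum (X : L) :
    killingForm ℝ L X X = ((adRoots X).map fun z => z.re ^ 2 - z.im ^ 2).sum := by
  set T := LinearMap.baseChange ℂ (LieModule.toEnd ℝ L L X) with hT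
  have hc : Commute T (T - spectralMap id T) :=
    (Commute.refl T).sub_right (commute_spectralMap_of_commute id (Commute.refl T))
  have h1 : LinearMap.trace ℂ _ (T * T) = LinearMap.trace ℂ _ (spectralMap id T * T) := by
    have h2 : T * T = spectralMap id T * T + T * (T - spectralMap id T) := by
      rw [mul_sub, (commute_spectralMap_of_commute id (Commute.refl T)).eq]
      abel
    have h3 : IsNilpotent (T * (T - spectralMap id T)) :=
      hc.isNilpotent_mul_left (isNilpotent_sub_spectralMap T)
    have h4 := (LinearMap.isNilpotent_trace_of_isNilpotent h3).eq_zero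
    conv_lhs => rw [h2]
    rw [map_add, h4, add_zero]
  have h2 := congrArg Complex.re (ofReal_killingForm X X)
  rw [h1, trace_spectralMap_mul, re_multiset_sum, Complex.ofReal_re] at h2
  rw [h2, adRoots]
  congr 2
  funext z
  simp [sq]

theorem forall_eq_zero_of_sum_eq_zero {s : Multiset ℂ} {f : ℂ → ℝ} (hf : ∀ z, 0 ≤ f z)
    (h : (s.map f).sum = 0) : ∀ z ∈ s, f z = 0 := by
  induction s using Multiset.induction_on with
  | empty => simp
  | cons a s ih =>
    rw [Multiset.map_cons, Multiset.sum_cons] at h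
    have h1 : 0 ≤ (s.map f).sum := Multiset.sum_nonneg fun x hx => by
      obtain ⟨z, -, rfl⟩ := Multiset.mem_map.1 hx
      exact hf z
    have h2 := hf a
    intro z hz
    rcases Multiset.mem_cons.1 hz with rfl | hz
    · linarith
    · exact ih (by linarith) z hz

theorem isNilpotent_of_adRoots {X : L} (h : ∀ z ∈ adRoots X, z = 0) :
    IsNilpotent (LieModule.toEnd ℝ L L X) := by
  have h1 := (IsAlgClosed.splits
    (LinearMap.baseChange ℂ (LieModule.toEnd ℝ L L X)).charpoly).eq_prod_roots_of_monic
    (LinearMap.charpoly_monic _)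
  have h2 := Multiset.eq_replicate_of_mem h
  rw [adRoots] at h2
  rw [h2, LinearMap.charpoly_baseChange] at h1
  rw [LinearMap.isNilpotent_iff_charpoly]
  have h3 : (LieModule.toEnd ℝ L L X).charpoly =
      Polynomial.X ^ (Multiset.card (adRoots X)) := by
    apply Polynomial.map_injective _ (algebraMap ℝ ℂ).injective
    rw [h1, adRoots]
    simp [LinearMap.charpoly_baseChange]
  have h4 := congrArg Polynomial.natDegree h3
  rw [LinearMap.charpoly_natDegree, Polynomial.natDegree_X_pow] at h4
  rw [h3, ← h4]

theorem killingForm_eq_zero_of_isNilpotent {X Y : L} (h : IsNilpotent (LieModule.toEnd ℝ L L X))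
    (hXY : ⁅X, Y⁆ = 0) : killingForm ℝ L X Y = 0 := by
  have h1 := (commute_toEnd_of_lie_eq_zero (V := L) hXY).isNilpotent_mul_right h
  exact (LinearMap.isNilpotent_trace_of_isNilpotent h1).eq_zero

theorem killingForm_lie_left (X Y Z : L) :
    killingForm ℝ L ⁅X, Y⁆ Z = -killingForm ℝ L Y ⁅X, Z⁆ := by
  rw [← lie_skew, map_neg, LinearMap.neg_apply, LieModule.traceForm_apply_lie_apply]

/-- The span of the brackets of a subalgebra. -/
def bracketSpan (l : LieSubalgebra ℝ L) : Submodule ℝ L :=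
  Submodule.span ℝ {Z : L | ∃ X ∈ l, ∃ Y ∈ l, ⁅X, Y⁆ = Z}

theorem bracketSpan_le (l : LieSubalgebra ℝ L) : bracketSpan l ≤ l.toSubmodule := by
  rw [bracketSpan, Submodule.span_le]
  rintro _ ⟨X, hX, Y, hY, rfl⟩
  exact l.lie_mem hX hY

theorem lie_mem_bracketSpan {l : LieSubalgebra ℝ L} {X Y : L} (hX : X ∈ l) (hY : Y ∈ l) :
    ⁅X, Y⁆ ∈ bracketSpan l := Submodule.subset_span ⟨X, hX, Y, hY, rfl⟩

/-- The bracket span as a subalgebra. -/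
def bracketAlgebra (l : LieSubalgebra ℝ L) : LieSubalgebra ℝ L :=
  { bracketSpan l with
    lie_mem' := fun hX hY => lie_mem_bracketSpan (bracketSpan_le l hX) (bracketSpan_le l hY) }

theorem killingForm_bracketSpan {l : LieSubalgebra ℝ L} {Z X : L} (hZ : ∀ Y ∈ l, ⁅Z, Y⁆ = 0)
    (hX : X ∈ bracketSpan l) : killingForm ℝ L Z X = 0 := by
  have h1 : bracketSpan l ≤ LinearMap.ker (killingForm ℝ L Z) := by
    rw [bracketSpan, Submodule.span_le]
    rintro _ ⟨A, hA, B, hB, rfl⟩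
    change killingForm ℝ L Z ⁅A, B⁆ = 0
    rw [← LieModule.traceForm_apply_lie_apply, hZ A hA, map_zero, LinearMap.zero_apply]
  exact h1 hX

/-- A subalgebra that contains the Jordan components of its elements, on which the Killing form
is nondegenerate and whose elements have no nonzero real eigenvalues on it. -/
structure IsAnisotropic (l : LieSubalgebra ℝ L) : Prop where
  nondeg : ∀ X ∈ l, (∀ Y ∈ l, killingForm ℝ L X Y = 0) → X = 0
  closed : ∀ f : ℂ →+ ℂ, ∀ X ∈ l, ∀ H, ActsAs L f X H → H ∈ l
  real : ∀ H ∈ l, ∀ Y ∈ l, ∀ μ : ℝ, ⁅H, Y⁆ = μ • Y → Y ≠ 0 → μ = 0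

variable {l : LieSubalgebra ℝ L}

theorem IsAnisotropic.lie_eq_zero_of_orthogonal (hl : IsAnisotropic l) {Z : L} (hZ : Z ∈ l)
    (h : ∀ X ∈ bracketSpan l, killingForm ℝ L Z X = 0) : ∀ Y ∈ l, ⁅Z, Y⁆ = 0 := by
  intro Y hY
  refine hl.nondeg _ (l.lie_mem hZ hY) fun W hW => ?_
  rw [LieModule.traceForm_apply_lie_apply]
  exact h _ (lie_mem_bracketSpan hY hW)

theorem IsAnisotropic.eq_zero_of_isNilpotent (hl : IsAnisotropic l) {X : L} (hX : X ∈ l) (hc : ∀ Y ∈ l, ⁅X, Y⁆ = 0)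
    (h : IsNilpotent (LieModule.toEnd ℝ L L X)) : X = 0 :=
  hl.nondeg X hX fun Y hY => killingForm_eq_zero_of_isNilpotent h (hc Y hY)

/-- A diagonalizable element of a subalgebra centralizes it if it has no nonzero eigenvalues
there. -/
theorem lie_eq_zero_of_isDiag {l : Submodule ℝ L} {H : L} (hHl : ∀ Y ∈ l, ⁅H, Y⁆ ∈ l)
    (hH : IsDiag (LieModule.toEnd ℝ L L H))
    (h : ∀ Y ∈ l, ∀ μ : ℝ, ⁅H, Y⁆ = μ • Y → Y ≠ 0 → μ = 0) : ∀ Y ∈ l, ⁅H, Y⁆ = 0 := by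
  have h1 := Submodule.eq_iSup_inf_genEigenspace (p := l) (f := LieModule.toEnd ℝ L L H) 1
    (fun Y hY => hHl Y hY) hH
  have h2 : l ≤ LinearMap.ker (LieModule.toEnd ℝ L L H) := by
    rw [h1, iSup_le_iff]
    rintro μ Y ⟨hY, hYμ⟩
    have hYμ' : ⁅H, Y⁆ = μ • Y := mem_eigenspace_iff.1 hYμ
    rcases eq_or_ne Y 0 with rfl | hY0
    · simp
    · rw [LinearMap.mem_ker, LieModule.toEnd_apply_apply, hYμ', h Y hY μ hYμ' hY0, zero_smul]
  exact fun Y hY => h2 hY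

variable [LieAlgebra.IsKilling ℝ L]

/-- The hyperbolic part `H` of `X` lies in `l` and has no nonzero eigenvalue there, so it
centralizes `l` and is orthogonal to brackets. Thus `κ(H, X) = ∑ (Re z)²` vanishes and `κ(X, X) = -∑
(Im z)² ≤ 0`. In case of equality `X` is ad-nilpotent and, by Cauchy–Schwarz, orthogonal to `[l,
l]`, so it is central in `l`, and such an element is zero. -/
theorem IsAnisotropic.killingForm_neg (hl : IsAnisotropic l) {X : L} (hX : X ∈ bracketSpan l) (hX0 : X ≠ 0) :
    killingForm ℝ L X X < 0 := by
  have key {X : L} (hX : X ∈ bracketSpan l) : ((adRoots X).map fun z => z.re ^ 2).sum = 0 ∧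
      killingForm ℝ L X X = -((adRoots X).map fun z => z.im ^ 2).sum := by
    obtain ⟨H, hH⟩ := exists_actsAs reHom_conj X
    have hHl := hl.closed _ X (bracketSpan_le l hX) H hH
    have h1 := killingForm_bracketSpan (lie_eq_zero_of_isDiag (l := l.toSubmodule)
      (fun Y hY => l.lie_mem hHl hY) hH.isDiag (hl.real H hHl)) hX
    rw [killingForm_eq_sum_re hH] at h1
    refine ⟨h1, ?_⟩
    rw [killingForm_self_eq_sum, Multiset.sum_map_sub, h1, zero_sub]
  have hnonpos {X : L} (hX : X ∈ bracketSpan l) : killingForm ℝ L X X ≤ 0 := by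
    rw [(key hX).2, neg_nonpos]
    refine Multiset.sum_nonneg fun x hx => ?_
    obtain ⟨z, -, rfl⟩ := Multiset.mem_map.1 hx
    exact sq_nonneg _
  refine lt_of_le_of_ne (hnonpos hX) fun h0 => hX0 ?_
  have h1 := (key hX).2
  rw [h0, eq_comm, neg_eq_zero] at h1
  have h2 := forall_eq_zero_of_sum_eq_zero (fun z => sq_nonneg z.im) h1
  have h3 := forall_eq_zero_of_sum_eq_zero (fun z => sq_nonneg z.re) (key hX).1
  have hnil : IsNilpotent (LieModule.toEnd ℝ L L X) := isNilpotent_of_adRoots fun z hz =>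
    Complex.ext (pow_eq_zero_iff two_ne_zero |>.1 (h3 z hz))
      (pow_eq_zero_iff two_ne_zero |>.1 (h2 z hz))
  refine hl.eq_zero_of_isNilpotent (bracketSpan_le l hX)
    (hl.lie_eq_zero_of_orthogonal (bracketSpan_le l hX) fun Y hY => ?_) hnil
  have h4 := eq_zero_of_isotropic (E := bracketAlgebra l)
    (P := -(killingForm ℝ L).restrict (bracketSpan l))
    (fun x y => congrArg Neg.neg (LieModule.traceForm_comm ℝ L L _ _))
    (fun x => neg_nonneg.2 (hnonpos x.2)) (v := ⟨X, hX⟩) (neg_eq_zero.2 h0) ⟨Y, hY⟩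
  exact neg_eq_zero.1 h4

/-- The nilpotent Jordan part is a polynomial `p(T)`. On an eigenvector for `μ` it acts by `p(μ)`,
which is nilpotent and so zero; by hypothesis the eigenvectors over `ℂ` span. -/
theorem isSemisimple_of_baseChange_eq {W : Type*} [AddCommGroup W] [Module ℝ W]
    [FiniteDimensional ℝ W] {T : Module.End ℝ W}
    (h : LinearMap.baseChange ℂ T = spectralMap id (LinearMap.baseChange ℂ T)) :
    T.IsSemisimple := by
  obtain ⟨n, hn, s, -, hnil, hs, hT⟩ := T.exists_isNilpotent_isSemisimple
  have hn0 : n = 0 := by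
    obtain ⟨p, rfl⟩ : ∃ p, Polynomial.aeval T p = n := Algebra.adjoin_singleton_eq_range_aeval ℝ T ▸ hn
    obtain ⟨k, hk⟩ := hnil
    have h1 (q : Polynomial ℝ) (μ : ℂ) (x : ℂ ⊗[ℝ] W)
        (hx : LinearMap.baseChange ℂ T x = μ • x) :
        LinearMap.baseChange ℂ (Polynomial.aeval T q) x = Polynomial.aeval μ q • x := by
      have h2 : LinearMap.baseChange ℂ (Polynomial.aeval T q) =
          Polynomial.aeval (LinearMap.baseChange ℂ T) q :=
        (Polynomial.aeval_algHom_apply (Module.End.baseChangeHom ℝ ℂ W) T q).symm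
      rw [h2]
      induction q using Polynomial.induction_on' with
      | add p q hp hq =>
        rw [map_add, LinearMap.add_apply, hp, hq, map_add, add_smul]
        · exact (Polynomial.aeval_algHom_apply (Module.End.baseChangeHom ℝ ℂ W) T q).symm
        · exact (Polynomial.aeval_algHom_apply (Module.End.baseChangeHom ℝ ℂ W) T p).symm
      | monomial m a =>
        have h3 (m : ℕ) : (LinearMap.baseChange ℂ T ^ m) x = μ ^ m • x := by
          induction m with
          | zero => simp
          | succ m ih => rw [pow_succ, Module.End.mul_apply, hx, map_smul, ih, smul_smul, pow_succ,
              mul_comm]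
        rw [Polynomial.aeval_monomial, Polynomial.aeval_monomial, Module.End.mul_apply, h3,
          mul_smul]
        rw [Module.algebraMap_end_apply, algebraMap_smul]
    have h2 (z : ℂ ⊗[ℝ] W) : LinearMap.baseChange ℂ (Polynomial.aeval T p) z = 0 := by
      refine induction_maxGenEigenspace (LinearMap.baseChange ℂ T)
        (p := fun z => LinearMap.baseChange ℂ (Polynomial.aeval T p) z = 0) (fun μ x hx => ?_)
        (map_zero _) (fun x y hx hy => by rw [map_add, hx, hy, add_zero]) z
      have hμ : LinearMap.baseChange ℂ T x = μ • x := by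
        rw [h, spectralMap_apply id hx, id]
      have h3 := h1 (p ^ k) μ x hμ
      rw [map_pow, hk, LinearMap.baseChange_zero, LinearMap.zero_apply, map_pow, eq_comm,
        smul_eq_zero] at h3
      rw [h1 p μ x hμ]
      rcases h3 with h3 | h3
      · rw [IsNilpotent.eq_zero ⟨k, h3⟩, zero_smul]
      · rw [h3, smul_zero]
    refine LinearMap.ext fun w => tmul_injective ?_
    have h3 := h2 (1 ⊗ₜ w)
    rw [LinearMap.baseChange_tmul] at h3
    rw [h3, LinearMap.zero_apply, TensorProduct.tmul_zero]
  rw [hT, hn0, zero_add]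
  exact hs

theorem isNilpotent_of_baseChange {W : Type*} [AddCommGroup W] [Module ℝ W]
    {T : Module.End ℝ W} (h : IsNilpotent (LinearMap.baseChange ℂ T)) : IsNilpotent T := by
  obtain ⟨k, hk⟩ := h
  refine ⟨k, LinearMap.ext fun w => tmul_injective ?_⟩
  have h1 : LinearMap.baseChange ℂ (T ^ k) = LinearMap.baseChange ℂ T ^ k :=
    map_pow (Module.End.baseChangeHom ℝ ℂ W) T k
  have h2 := LinearMap.congr_fun (h1.trans hk) (1 ⊗ₜ w)
  rw [LinearMap.baseChange_tmul] at h2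
  rw [h2, LinearMap.zero_apply, LinearMap.zero_apply, TensorProduct.tmul_zero]

/-- The nilpotent Jordan component of `Z` lies in `l` and centralizes it, so it is zero. -/
theorem IsAnisotropic.isSemisimple_of_central (hl : IsAnisotropic l) {Z : L} (hZ : Z ∈ l)
    (hc : ∀ Y ∈ l, ⁅Z, Y⁆ = 0) : (LieModule.toEnd ℝ L L Z).IsSemisimple := by
  obtain ⟨S, hS⟩ := exists_actsAs (f := AddMonoidHom.id ℂ) (fun _ => rfl) Z
  have hSl := hl.closed _ Z hZ S hS
  have h1 : Z - S = 0 := by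
    refine hl.eq_zero_of_isNilpotent (l.sub_mem hZ hSl) (fun Y hY => ?_) ?_
    · rw [sub_lie, hc Y hY, hS.lie_eq_zero (hc Y hY), sub_zero]
    · refine isNilpotent_of_baseChange ?_
      rw [map_sub, LinearMap.baseChange_sub]
      rw [show LinearMap.baseChange ℂ (LieModule.toEnd ℝ L L S) = _ from hS]
      exact isNilpotent_sub_spectralMap _
  have h2 : ActsAs L (AddMonoidHom.id ℂ) Z Z := by
    have h3 := sub_eq_zero.1 h1
    rw [← h3] at hS
    exact hS
  exact isSemisimple_of_baseChange_eq h2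

/-- The Killing form is definite on `[l, l]`, which therefore has an orthogonal complement; its
elements in `l` are central in `l`. -/
theorem IsAnisotropic.exists_eq_add (hl : IsAnisotropic l) {Y : L} (hY : Y ∈ l) :
    ∃ X ∈ bracketSpan l, ∃ Z ∈ l, (∀ W ∈ l, ⁅Z, W⁆ = 0) ∧ X + Z = Y := by
  have hr : (killingForm ℝ L).IsRefl := (LieModule.traceForm_isSymm ℝ L L).isRefl
  have h1 : IsCompl (bracketSpan l) ((killingForm ℝ L).orthogonal (bracketSpan l)) := by
    rw [LinearMap.BilinForm.isCompl_orthogonal_iff_disjoint hr, Submodule.disjoint_def]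
    intro X hX hX'
    by_contra h0
    exact (hl.killingForm_neg hX h0).ne (hX' X hX)
  obtain ⟨X, hX, Z, hZ, rfl⟩ := Submodule.mem_sup.1 (h1.sup_eq_top.ge (Submodule.mem_top (x := Y)))
  have hZl : Z ∈ l := by
    have := l.sub_mem hY (bracketSpan_le l hX)
    rwa [add_sub_cancel_left] at this
  refine ⟨X, hX, Z, hZl, hl.lie_eq_zero_of_orthogonal hZl fun W hW => ?_, rfl⟩
  rw [LieModule.traceForm_comm]
  exact hZ W hW

attribute [local instance 100] LieRing.ofAssociativeRing

theorem isKilling_of_inner {s : Type*} [LieRing s] [LieAlgebra ℝ s] [FiniteDimensional ℝ s]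
    {g : LinearMap.BilinForm ℝ s} (hg : IsInner g) (hinv : ∀ x y z : s, g ⁅x, y⁆ z = -g y ⁅x, z⁆)
    (hc : ∀ x : s, (∀ y : s, ⁅x, y⁆ = 0) → x = 0) : LieAlgebra.IsKilling ℝ s where
  killingCompl_top_eq_bot := by
    rw [eq_bot_iff]
    intro x hx
    have hx' : killingForm ℝ s x x = 0 := by
      rw [LieIdeal.mem_killingCompl] at hx
      exact hx x trivial
    obtain ⟨b, hb⟩ := hg.exists_orthonormal
    rw [killingForm_apply_apply, trace_eq_of_orthonormal hb] at hx'
    have h1 (i) : g (b i) ((LieAlgebra.ad ℝ s x ∘ₗ LieAlgebra.ad ℝ s x) (b i)) =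
        -g ⁅x, b i⁆ ⁅x, b i⁆ := by
      rw [hg.symm, LinearMap.comp_apply, LieAlgebra.ad_apply, LieAlgebra.ad_apply, hinv]
    simp only [h1, Finset.sum_neg_distrib, neg_eq_zero] at hx'
    rw [Finset.sum_eq_zero_iff_of_nonneg fun i _ => hg.nonneg _] at hx'
    have h2 : LieAlgebra.ad ℝ s x = 0 := b.ext fun i => hg.eq_zero (hx' i (Finset.mem_univ i))
    rw [LieSubmodule.mem_bot]
    exact hc x fun y => LinearMap.congr_fun h2 y

/-- If `x ∈ [l, l]` commutes with `[l, l]` and `Y ∈ l`, then `κ([x, Y], [x, Y]) = -κ(Y, [x, [x, Y]])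
= 0`, so `x` is central in `l`, hence orthogonal to itself and zero. -/
theorem IsAnisotropic.isKilling (hl : IsAnisotropic l) :
    LieAlgebra.IsKilling ℝ (bracketAlgebra l) := by
  have hβ : IsInner (E := bracketAlgebra l) (-(killingForm ℝ L).restrict (bracketSpan l)) :=
    ⟨fun x y => congrArg Neg.neg (LieModule.traceForm_comm ℝ L L _ _), fun x hx =>
      neg_pos.2 (hl.killingForm_neg x.2 fun h0 => hx (Subtype.ext h0))⟩
  refine isKilling_of_inner hβ
    (fun x y z => congrArg Neg.neg (killingForm_lie_left (x : L) y z)) fun x hx => ?_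
  have h1 : ∀ Y ∈ l, ⁅(x : L), Y⁆ = 0 := by
    intro Y hY
    have hZ := lie_mem_bracketSpan (bracketSpan_le l x.2) hY
    by_contra h0
    refine (hl.killingForm_neg hZ h0).ne ?_
    rw [killingForm_lie_left, show ⁅(x : L), ⁅(x : L), Y⁆⁆ = 0 from
      congrArg Subtype.val (hx ⟨_, hZ⟩), map_zero, neg_zero]
  by_contra h0
  exact (hl.killingForm_neg x.2 fun h => h0 (Subtype.ext h)).ne (killingForm_bracketSpan h1 x.2)

/-- Weyl's theorem handles the semisimple part `[l, l]`. The center of `l` acts on `End L` by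
commuting semisimple operators, and `exists_forall_apply_eq_zero` moves the projection into their
common kernel without changing it on `U`. -/
theorem IsAnisotropic.exists_projection (hl : IsAnisotropic l) (U : Submodule ℝ L)
    (hU : ∀ X ∈ l, ∀ u ∈ U, ⁅X, u⁆ ∈ U) : ∃ p : Module.End ℝ L, (∀ x, p x ∈ U) ∧
      (∀ u ∈ U, p u = u) ∧ ∀ X ∈ l, ∀ x, p ⁅X, x⁆ = ⁅X, p x⁆ := by
  -- a projection commuting with the commutator algebra
  have := hl.isKilling
  obtain ⟨π, hπ⟩ := exists_equivariant_projection (K := ℝ) (L := bracketAlgebra l) (M := L)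
    { U with lie_mem := fun {x u} hu => hU x (bracketSpan_le l x.2) u hu }
  let p₀ : Module.End ℝ L := U.subtype ∘ₗ (π : L →ₗ[ℝ] U)
  have hp₀U (x : L) : p₀ x ∈ U := (π x).2
  have hp₀ (u : L) (hu : u ∈ U) : p₀ u = u := congrArg Subtype.val (hπ ⟨u, hu⟩)
  have hp₀s (X : L) (hX : X ∈ bracketSpan l) (x : L) : p₀ ⁅X, x⁆ = ⁅X, p₀ x⁆ :=
    congrArg Subtype.val (π.map_lie ⟨X, hX⟩ x)
  -- correct it to commute with the center
  let z : Submodule ℝ L :=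
    { carrier := {Z | Z ∈ l ∧ ∀ Y ∈ l, ⁅Z, Y⁆ = 0}
      zero_mem' := ⟨l.zero_mem, fun Y _ => zero_lie Y⟩
      add_mem' := fun {A B} hA hB => ⟨l.add_mem hA.1 hB.1, fun Y hY => by
        rw [add_lie, hA.2 Y hY, hB.2 Y hY, add_zero]⟩
      smul_mem' := fun c A hA => ⟨l.smul_mem c hA.1, fun Y hY => by
        rw [smul_lie, hA.2 Y hY, smul_zero]⟩ }
  let T : z → Module.End ℝ (Module.End ℝ L) := fun Z =>
    LieAlgebra.ad ℝ (Module.End ℝ L) (LieModule.toEnd ℝ L L (Z : L))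
  have hT (Z : z) (p : Module.End ℝ L) (x : L) : T Z p x = ⁅(Z : L), p x⁆ - p ⁅(Z : L), x⁆ := rfl
  let M : Submodule ℝ (Module.End ℝ L) :=
    { carrier := {p | (∀ x, p x ∈ U) ∧ ∀ X ∈ bracketSpan l, ∀ x, p ⁅X, x⁆ = ⁅X, p x⁆}
      zero_mem' := ⟨fun x => U.zero_mem, fun X _ x => by simp⟩
      add_mem' := fun {p q} hp hq => ⟨fun x => U.add_mem (hp.1 x) (hq.1 x), fun X hX x => by
        rw [LinearMap.add_apply, LinearMap.add_apply, lie_add, hp.2 X hX, hq.2 X hX]⟩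
      smul_mem' := fun c p hp => ⟨fun x => U.smul_mem c (hp.1 x), fun X hX x => by
        rw [LinearMap.smul_apply, LinearMap.smul_apply, lie_smul, hp.2 X hX]⟩ }
  let N : Submodule ℝ (Module.End ℝ L) :=
    { carrier := {p | (∀ x, p x ∈ U) ∧ ∀ u ∈ U, p u = 0}
      zero_mem' := ⟨fun x => U.zero_mem, fun u _ => by simp⟩
      add_mem' := fun {p q} hp hq => ⟨fun x => U.add_mem (hp.1 x) (hq.1 x), fun u hu => by
        rw [LinearMap.add_apply, hp.2 u hu, hq.2 u hu, add_zero]⟩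
      smul_mem' := fun c p hp => ⟨fun x => U.smul_mem c (hp.1 x), fun u hu => by
        rw [LinearMap.smul_apply, hp.2 u hu, smul_zero]⟩ }
  have hTU (Z : z) (p : Module.End ℝ L) (hp : ∀ x, p x ∈ U) (x : L) : T Z p x ∈ U := by
    rw [hT]
    exact U.sub_mem (hU Z Z.2.1 _ (hp x)) (hp _)
  obtain ⟨t, ht⟩ := (IsNoetherian.noetherian (⊤ : Submodule ℝ z))
  obtain ⟨p, hpM, hpN, hpt⟩ := exists_forall_apply_eq_zero T
    (fun Z => LieAlgebra.ad_isSemisimple_of_isSemisimple (hl.isSemisimple_of_central Z.2.1 Z.2.2))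
    (fun Z Z' => commute_toEnd_of_lie_eq_zero (L := Module.End ℝ L) (V := Module.End ℝ L) (by
      rw [← LieHom.map_lie, Z.2.2 _ Z'.2.1, map_zero])) t M N
    (fun Z p hp => ⟨hTU Z p hp.1, fun X hX x => by
      have h1 : ⁅(Z : L), X⁆ = 0 := Z.2.2 X (bracketSpan_le l hX)
      have h2 (w : L) : ⁅(Z : L), ⁅X, w⁆⁆ = ⁅X, ⁅(Z : L), w⁆⁆ := by
        rw [leibniz_lie, h1, zero_lie, zero_add]
      rw [hT, hT, hp.2 X hX, h2, h2, hp.2 X hX, lie_sub]⟩)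
    (fun Z p hp => ⟨hTU Z p hp.1, fun u hu => by
      rw [hT, hp.2 u hu, hp.2 _ (hU Z Z.2.1 u hu), lie_zero, sub_zero]⟩)
    (m := p₀) ⟨hp₀U, hp₀s⟩ (fun Z => ⟨hTU Z p₀ hp₀U, fun u hu => by
      rw [hT, hp₀ u hu, hp₀ _ (hU Z Z.2.1 u hu), sub_self]⟩)
  refine ⟨p, hpM.1, fun u hu => ?_, fun X hX x => ?_⟩
  · rw [← sub_eq_zero, ← hp₀ u hu, hp₀ u hu]
    have := hpN.2 u hu
    rwa [LinearMap.sub_apply, hp₀ u hu] at this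
  · have hz : ∀ Z : z, p ⁅(Z : L), x⁆ = ⁅(Z : L), p x⁆ := by
      intro Z
      have h1 : Z ∈ Submodule.span ℝ (t : Set z) := by rw [ht]; trivial
      induction h1 using Submodule.span_induction with
      | mem Z hZ =>
        have h2 := LinearMap.congr_fun (hpt Z hZ) x
        rw [hT, LinearMap.zero_apply, sub_eq_zero] at h2
        exact h2.symm
      | zero => simp
      | add A B _ _ hA hB =>
        rw [Submodule.coe_add, add_lie, map_add, hA, hB, add_lie]
      | smul c A _ hA => rw [Submodule.coe_smul, smul_lie, map_smul, hA, smul_lie]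
    obtain ⟨Y, hY, Z, hZ, hZc, rfl⟩ := hl.exists_eq_add hX
    rw [add_lie, map_add, hpM.2 Y hY, hz ⟨Z, hZ, hZc⟩, add_lie]

/-- A subalgebra with Jordan components, nondegenerate Killing form and imaginary spectrum is
amenable reductive. -/
theorem IsAnisotropic.isAmenableReductive (hl : IsAnisotropic l) : IsAmenableReductive l := by
  refine ⟨⟨fun U => ?_⟩, fun Z hZ hZ0 => hl.killingForm_neg hZ hZ0⟩
  obtain ⟨p, hpU, hp, hpl⟩ := hl.exists_projection U.toSubmodule
    fun X hX u hu => U.lie_mem (x := (⟨X, hX⟩ : l)) hu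
  refine ⟨{ LinearMap.ker p with
    lie_mem := fun {x m} hm => ?_ }, ?_⟩
  · have hm' : p m = 0 := hm
    change p ⁅(x : L), m⁆ = 0
    rw [hpl x x.2, hm', lie_zero]
  · rw [← LieSubmodule.isCompl_toSubmodule]
    have h1 := LinearMap.isCompl_of_proj (p := U.toSubmodule) (f := p.codRestrict U.toSubmodule hpU)
      fun u => Subtype.ext (hp u u.2)
    rw [LinearMap.ker_codRestrict] at h1
    exact h1

end Amenable

/-! ### Operators with imaginary spectrum -/

section Imaginary

/-- Each factor satisfies `|μ - z| ≥ |μ|` when `z` is imaginary. The inequality is closed in the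
coefficients and excludes nonzero real roots, which makes it suitable for passing to limits. -/
theorem abs_pow_le_abs_eval {p : Polynomial ℝ} (hp : p.Monic) (h : absReRoots p = 0) (μ : ℝ) :
    |μ| ^ p.natDegree ≤ |p.eval μ| := by
  have key (s : Multiset ℂ) (hs : ∀ z ∈ s, z.re = 0) :
      |μ| ^ Multiset.card s ≤ ‖(s.map fun z => (μ : ℂ) - z).prod‖ := by
    induction s using Multiset.induction_on with
    | empty => simp
    | cons a s ih =>
      rw [Multiset.card_cons, Multiset.map_cons, Multiset.prod_cons, norm_mul, pow_succ']
      refine mul_le_mul ?_ (ih fun z hz => hs z (Multiset.mem_cons_of_mem hz))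
        (pow_nonneg (abs_nonneg _) _) (norm_nonneg _)
      have h1 := Complex.abs_re_le_norm ((μ : ℂ) - a)
      rwa [Complex.sub_re, Complex.ofReal_re, hs a (Multiset.mem_cons_self a s), sub_zero] at h1
  have hsplit := IsAlgClosed.splits (p.map (algebraMap ℝ ℂ))
  have h1 := hsplit.eq_prod_roots_of_monic (hp.map _)
  have h2 := key _ (absReRoots_eq_zero_iff.1 h)
  have h3 : (p.map (algebraMap ℝ ℂ)).eval (μ : ℂ) = ((p.eval μ : ℝ) : ℂ) :=
    Polynomial.eval_map_apply (algebraMap ℝ ℂ) μ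
  have h4 : (((p.map (algebraMap ℝ ℂ)).roots.map fun z => (μ : ℂ) - z)).prod =
      ((p.eval μ : ℝ) : ℂ) := by
    rw [← h3]
    conv_rhs => rw [h1]
    rw [Polynomial.eval_multiset_prod, Multiset.map_map]
    simp
  rw [h4, Complex.norm_real, ← hsplit.natDegree_eq_card_roots, Polynomial.natDegree_map] at h2
  exact h2

/-- For an eigenvector with real part `a` and imaginary part `b`, adding `g(a, S a) = 0` and `g(b, S
b) = 0` gives `Re z · (g(a, a) + g(b, b)) = 0`. -/
theorem absReRoots_of_skew {W : Type*} [AddCommGroup W] [Module ℝ W] [FiniteDimensional ℝ W]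
    {g : LinearMap.BilinForm ℝ W} (hg : IsInner g) {S : Module.End ℝ W}
    (hS : ∀ x y, g (S x) y = -g x (S y)) : absReRoots S.charpoly = 0 := by
  rw [absReRoots_eq_zero_iff]
  intro z hz
  rw [← LinearMap.charpoly_baseChange, Polynomial.mem_roots (LinearMap.charpoly_monic _).ne_zero,
    ← Module.End.hasEigenvalue_iff_isRoot_charpoly] at hz
  obtain ⟨w, hw⟩ := hz.exists_hasEigenvector
  have h1 := hw.apply_eq_smul
  rw [eq_rePart_add_imPart w, map_add, LinearMap.baseChange_tmul, LinearMap.baseChange_tmul] at h1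
  have h2 := congrArg (rePart W) h1
  have h3 := congrArg (imPart W) h1
  simp [TensorProduct.smul_tmul'] at h2 h3
  set a := rePart W w
  set b := imPart W w
  have hskew (x : W) : g x (S x) = 0 := by
    have h4 := hS x x
    rw [hg.symm] at h4
    linarith
  have h4 := hskew a
  have h5 := hskew b
  rw [h2] at h4
  rw [h3] at h5
  simp only [map_add, map_neg, map_smul, smul_eq_mul, hg.symm b a] at h4 h5
  have h6 : z.re * (g a a + g b b) = 0 := by linarith
  rcases mul_eq_zero.1 h6 with h7 | h7
  · exact h7
  · exfalso
    have ha := hg.nonneg a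
    have hb := hg.nonneg b
    refine hw.2 ?_
    rw [eq_rePart_add_imPart w, show rePart W w = 0 from hg.eq_zero (by linarith),
      show imPart W w = 0 from hg.eq_zero (by linarith)]
    simp

end Imaginary

/-! ### Spectra of stabilizers and density of generic vectors -/

section Stabilizers

variable {L V : Type*} [LieRing L] [LieAlgebra ℝ L] [FiniteDimensional ℝ L]
  [NormedAddCommGroup V] [NormedSpace ℝ V] [FiniteDimensional ℝ V]
  [LieRingModule L V] [LieModule ℝ L V]

theorem isRoot_of_lie_eq_smul {v : V} {H Y : L} (hH : ⁅H, v⁆ = 0) (hY : ⁅Y, v⁆ = 0) (hY0 : Y ≠ 0)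
    {μ : ℝ} (hμ : ⁅H, Y⁆ = μ • Y) :
    ((LieModule.toEnd ℝ L L H).restrict (lie_mem_ker_orbitMap hH)).charpoly.IsRoot μ := by
  rw [← Module.End.hasEigenvalue_iff_isRoot_charpoly]
  refine Module.End.hasEigenvalue_of_hasEigenvector (x := ⟨Y, hY⟩)
    ⟨mem_eigenspace_iff.2 (Subtype.ext hμ), fun h => hY0 (congrArg Subtype.val h)⟩

theorem isAnisotropic_stab [LieAlgebra.IsKilling ℝ L] {v : V}
    (hnd : ∀ X : L, ⁅X, v⁆ = 0 → (∀ Y : L, ⁅Y, v⁆ = 0 → killingForm ℝ L X Y = 0) → X = 0)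
    (h0 : ∀ (X : L) (hX : ⁅X, v⁆ = 0),
      absReRoots ((LieModule.toEnd ℝ L L X).restrict (lie_mem_ker_orbitMap hX)).charpoly = 0) :
    IsAnisotropic (stab L v) where
  nondeg X hX h := hnd X hX h
  closed f X hX H hH := (hH.rep (V := V)).lie_eq_zero hX
  real H hH Y hY μ hμ hY0 := by
    have h1 := (isRoot_of_lie_eq_smul hH hY hY0 hμ).map (f := algebraMap ℝ ℂ)
    exact absReRoots_eq_zero_iff.1 (h0 H hH) _
      ((Polynomial.mem_roots ((LinearMap.charpoly_monic _).map _).ne_zero).2 h1)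

/-- `X` acts by zero on the stabilizer modulo its brackets, and skew-symmetrically for `-κ` on the
span of the brackets. -/
theorem absReRoots_of_isAmenableReductive {v : V} (h : IsAmenableReductive (stab L v)) {X : L}
    (hX : ⁅X, v⁆ = 0) :
    absReRoots ((LieModule.toEnd ℝ L L X).restrict (lie_mem_ker_orbitMap hX)).charpoly = 0 := by
  set f := (LieModule.toEnd ℝ L L X).restrict (lie_mem_ker_orbitMap hX)
  let D := (bracketSpan (stab L v)).comap (LinearMap.ker (orbitMap ℝ L v)).subtype
  have hD (Y : LinearMap.ker (orbitMap ℝ L v)) : f Y ∈ D :=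
    lie_mem_bracketSpan (l := stab L v) hX Y.2
  have h1 := charpoly_eq_restrict_mul_mapQ f D fun Y _ => hD Y
  have h2 : D.mapQ D f (fun Y _ => hD Y) = 0 := by
    refine LinearMap.ext fun x => ?_
    obtain ⟨Y, rfl⟩ := Submodule.mkQ_surjective _ x
    rw [Submodule.mkQ_apply, Submodule.mapQ_apply, LinearMap.zero_apply,
      Submodule.Quotient.mk_eq_zero]
    exact hD Y
  rw [h1, h2, LinearMap.charpoly_zero, absReRoots_mul (LinearMap.charpoly_monic _).ne_zero
    (Polynomial.monic_X_pow _).ne_zero, absReRoots_X_pow, add_zero]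
  let ι : D →ₗ[ℝ] L := (LinearMap.ker (orbitMap ℝ L v)).subtype ∘ₗ D.subtype
  refine absReRoots_of_skew (g := -(killingForm ℝ L).compl₁₂ ι ι) ⟨fun x y => ?_, fun x hx => ?_⟩
    fun x y => ?_
  · exact congrArg Neg.neg (LieModule.traceForm_comm ℝ L L _ _)
  · exact neg_pos.2 (h.2 _ x.2 fun h0 => hx (Subtype.ext (Subtype.ext h0)))
  · exact congrArg Neg.neg (killingForm_lie_left X _ _)

/-- If `ρ_h ≤ ρ_V`, generic stabilizers are amenable reductive. -/
theorem isAmenableReductive_stab_of_rho_le [LieAlgebra.IsKilling ℝ L] {a : LieSubalgebra ℝ L}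
    (ha : Maximal IsSplitAbelian a) (hρ : ∀ Y ∈ a, rho L L Y ≤ rho L V Y) {v : V}
    (hmax : ∀ w : V, finrank ℝ (LinearMap.range (orbitMap ℝ L w)) ≤
      finrank ℝ (LinearMap.range (orbitMap ℝ L v)))
    (hnd : ∀ X : L, ⁅X, v⁆ = 0 → (∀ Y : L, ⁅Y, v⁆ = 0 → killingForm ℝ L X Y = 0) → X = 0) :
    IsAmenableReductive (stab L v) := by
  refine (isAnisotropic_stab hnd fun X hX => le_antisymm ?_
    (absReRoots_nonneg _)).isAmenableReductive
  obtain ⟨Y, hY, h1, h2⟩ := exists_mem_rho_eq (V := V) ha X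
  rw [absReRoots_stab hmax hX, ← h1, ← h2]
  linarith [hρ Y hY]

-- On the line from `v` to a point where `q` does not vanish, `q` is a nonzero polynomial in one
-- variable and has finitely many zeros.
open Filter Topology in
theorem dense_eval_ne_zero {q : MvPolynomial (Fin (finrank ℝ V)) ℝ} (hq : q ≠ 0) :
    Dense {v : V | MvPolynomial.eval (fun i => (finBasis ℝ V).repr v i) q ≠ 0} := by
  set e := finBasis ℝ V
  obtain ⟨x, hx⟩ : ∃ x, MvPolynomial.eval x q ≠ 0 := by
    by_contra! hcon
    exact hq (MvPolynomial.funext fun x => by rw [hcon, map_zero])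
  intro v
  let a := e.equivFun v
  let f : Polynomial ℝ := MvPolynomial.aeval
    (fun i => Polynomial.C (a i) + Polynomial.X * Polynomial.C (x i - a i)) q
  have hf (t : ℝ) : f.eval t = MvPolynomial.eval (e.equivFun (v + t • (e.equivFun.symm x - v))) q := by
    have h1 := MvPolynomial.map_aeval
      (fun i => Polynomial.C (a i) + Polynomial.X * Polynomial.C (x i - a i))
      (Polynomial.evalRingHom t) q
    rw [Polynomial.coe_evalRingHom] at h1
    have h2 : (Polynomial.evalRingHom t).comp (algebraMap ℝ (Polynomial ℝ)) = RingHom.id ℝ :=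
      RingHom.ext fun x => by simp
    rw [h1, h2]
    have h3 : (fun i => Polynomial.eval t
        (Polynomial.C (a i) + Polynomial.X * Polynomial.C (x i - a i))) =
        e.equivFun (v + t • (e.equivFun.symm x - v)) := by
      rw [map_add, map_smul, map_sub, LinearEquiv.apply_symm_apply]
      funext i
      simp only [Polynomial.eval_add, Polynomial.eval_mul, Polynomial.eval_C, Polynomial.eval_X]
      rfl
    rw [← h3]
    rfl
  have hf0 : f ≠ 0 := by
    intro h0
    have h1 := hf 1
    rw [h0, Polynomial.eval_zero, one_smul, add_sub_cancel, LinearEquiv.apply_symm_apply] at h1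
    exact hx h1.symm
  have hdense : Dense ({t : ℝ | f.IsRoot t}ᶜ) :=
    Set.Countable.dense_compl ℝ (Polynomial.finite_setOfPred_isRoot hf0).countable
  have hcont : Continuous fun t : ℝ => v + t • (e.equivFun.symm x - v) := by fun_prop
  have h1 : (fun t : ℝ => v + t • (e.equivFun.symm x - v)) 0 ∈
      closure ((fun t : ℝ => v + t • (e.equivFun.symm x - v)) '' {t : ℝ | f.IsRoot t}ᶜ) :=
    image_closure_subset_closure_image hcont ⟨0, hdense 0, rfl⟩
  simp only [zero_smul, add_zero] at h1
  refine closure_mono ?_ h1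
  rintro _ ⟨t, ht, rfl⟩
  have h2 : f.eval t ≠ 0 := ht
  rw [hf] at h2
  exact h2

end Stabilizers

/-! ### Limits of stabilizers -/

section Limit

variable {L V : Type*} [LieRing L] [LieAlgebra ℝ L] [FiniteDimensional ℝ L]
  [NormedAddCommGroup V] [NormedSpace ℝ V] [FiniteDimensional ℝ V]
  [LieRingModule L V] [LieModule ℝ L V]

open Filter Topology

/-- Near a vector with orbit of maximal dimension the stabilizers vary continuously. -/
theorem exists_local_section {w : V}
    (hmax : ∀ v : V, finrank ℝ (LinearMap.range (orbitMap ℝ L v)) ≤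
      finrank ℝ (LinearMap.range (orbitMap ℝ L w))) {X : L} (hX : ⁅X, w⁆ = 0) :
    ∃ (g : LinearMap.range (orbitMap ℝ L w) →ₗ[ℝ] L) (y : V → LinearMap.range (orbitMap ℝ L w)),
      Tendsto y (𝓝 w) (𝓝 0) ∧ ∀ᶠ v in 𝓝 w, ⁅X - g (y v), v⁆ = 0 ∧
        finrank ℝ (LinearMap.range (orbitMap ℝ L v)) =
          finrank ℝ (LinearMap.range (orbitMap ℝ L w)) := by
  set R := LinearMap.range (orbitMap ℝ L w)
  obtain ⟨g, hg⟩ := (orbitMap ℝ L w).rangeRestrict.exists_rightInverse_of_surjective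
    (orbitMap ℝ L w).range_rangeRestrict
  obtain ⟨P, hP⟩ := R.subtype.exists_leftInverse_of_injective R.ker_subtype
  let A : V →ₗ[ℝ] L →ₗ[ℝ] V := (LieModule.toEnd ℝ L V : L →ₗ[ℝ] Module.End ℝ V).flip
  -- `T v` is the orbit map of `v` preceded by the section `g` and followed by the projection `P`.
  -- It is the identity at `w`, so it is invertible nearby, and `y` solves `P [X - g y, v] = 0`.
  -- Since the orbit of `v` has no larger dimension, `P` is injective on its tangent space, and `X -
  -- g y` stabilizes `v`.
  let T : V →ₗ[ℝ] (R →L[ℝ] R) := (Module.End.toContinuousLinearMap (𝕜 := ℝ) R).toLinearMap ∘ₗ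
    (LinearMap.llcomp ℝ R V R P) ∘ₗ LinearMap.lcomp ℝ V g ∘ₗ A
  have hT (v : V) (r : R) : T v r = P ⁅g r, v⁆ := rfl
  have hTw : T w = 1 := by
    refine ContinuousLinearMap.ext fun r => ?_
    have h1 : ⁅g r, w⁆ = (r : V) := congrArg Subtype.val (LinearMap.congr_fun hg r)
    rw [hT, h1]
    exact LinearMap.congr_fun hP r
  have hTcont : Continuous T := LinearMap.continuous_of_finiteDimensional T
  let S : V →ₗ[ℝ] R := P ∘ₗ (LieModule.toEnd ℝ L V X)
  have hScont : Continuous S := LinearMap.continuous_of_finiteDimensional S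
  refine ⟨g, fun v => Ring.inverse (T v) (S v), ?_, ?_⟩
  · have h1 : Tendsto (fun v => Ring.inverse (T v)) (𝓝 w) (𝓝 1) := by
      have h2 := (NormedRing.inverse_continuousAt (R := R →L[ℝ] R) 1).tendsto
      rw [Units.val_one, Ring.inverse_one, ← hTw] at h2
      rw [← hTw]
      exact h2.comp hTcont.continuousAt
    have h2 : Tendsto S (𝓝 w) (𝓝 0) := by
      have h3 : S w = 0 := by
        change P ⁅X, w⁆ = 0
        rw [hX, map_zero]
      rw [← h3]
      exact hScont.continuousAt
    have h3 := ((isBoundedBilinearMap_apply (𝕜 := ℝ) (E := R) (F := R)).continuous.tendsto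
      (1, 0)).comp (h1.prodMk_nhds h2)
    rw [map_zero] at h3
    exact h3
  · have hunit : ∀ᶠ v in 𝓝 w, IsUnit (T v) := by
      have hopen : IsOpen {f : R →L[ℝ] R | IsUnit f} := Units.isOpen (R := R →L[ℝ] R)
      refine hTcont.continuousAt.preimage_mem_nhds (hopen.mem_nhds ?_)
      change IsUnit (T w)
      rw [hTw]
      exact isUnit_one
    filter_upwards [hunit] with v hv
    have hinj (r : R) (hr : T v r = 0) : r = 0 := by
      obtain ⟨u, hu⟩ := hv
      have h1 := DFunLike.congr_fun u.inv_mul r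
      rw [hu] at h1
      change (u⁻¹ : (R →L[ℝ] R)ˣ).val (T v r) = r at h1
      rw [← h1, hr, map_zero]
    let Q := orbitMap ℝ L v ∘ₗ g
    have hQinj : Function.Injective Q := by
      refine (injective_iff_map_eq_zero Q).2 fun r hr => hinj r ?_
      rw [hT, show ⁅g r, v⁆ = 0 from hr, map_zero]
    have hQr := LinearMap.finrank_range_of_inj hQinj
    have hQle : LinearMap.range Q ≤ LinearMap.range (orbitMap ℝ L v) :=
      LinearMap.range_comp_le_range _ _
    have h1 := Submodule.finrank_mono hQle
    have h2 := hmax v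
    have hR : finrank ℝ R = finrank ℝ (LinearMap.range (orbitMap ℝ L w)) := rfl
    have heq : LinearMap.range Q = LinearMap.range (orbitMap ℝ L v) :=
      Submodule.eq_of_le_of_finrank_le hQle (by omega)
    refine ⟨?_, by omega⟩
    set y := Ring.inverse (T v) (S v)
    have hy : T v y = S v := by
      have h3 := DFunLike.congr_fun (Ring.mul_inverse_cancel (T v) hv) (S v)
      exact h3
    obtain ⟨r, hr⟩ : ⁅X - g y, v⁆ ∈ LinearMap.range Q := by
      rw [heq]
      exact ⟨_, rfl⟩
    have h3 : T v r = 0 := by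
      rw [hT, show ⁅g r, v⁆ = _ from hr, sub_lie, map_sub, ← hT, hy]
      exact sub_self _
    rw [← hr, hinj r h3, map_zero]

theorem continuous_eval_charpoly {R W : Type*} [AddCommGroup W] [Module ℝ W]
    [FiniteDimensional ℝ W] [NormedAddCommGroup R] [NormedSpace ℝ R] [FiniteDimensional ℝ R]
    (A : Module.End ℝ W) (B : R →ₗ[ℝ] Module.End ℝ W) (μ : ℝ) :
    Continuous fun y => (A - B y).charpoly.eval μ := by
  let b := finBasis ℝ W
  have h1 (y : R) : (A - B y).charpoly.eval μ =
      (Matrix.scalar _ μ - (LinearMap.toMatrix b b A - LinearMap.toMatrix b b (B y))).det := by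
    rw [← LinearMap.charpoly_toMatrix _ b, Matrix.eval_charpoly, map_sub]
  simp only [h1]
  have h2 : Continuous fun y => LinearMap.toMatrix b b (B y) :=
    LinearMap.continuous_of_finiteDimensional ((LinearMap.toMatrix b b).toLinearMap ∘ₗ B)
  exact (continuous_const.sub (continuous_const.sub h2)).matrix_det

/-- At a limit, with orbit of maximal dimension, of vectors with amenable reductive stabilizers
the stabilizer has no nonzero real eigenvalues. -/
theorem eq_zero_of_mem_closure {w : V}
    (hmax : ∀ v : V, finrank ℝ (LinearMap.range (orbitMap ℝ L v)) ≤
      finrank ℝ (LinearMap.range (orbitMap ℝ L w)))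
    (hw : w ∈ closure {v : V | IsAmenableReductive (stab L v)}) {X Y : L} (hX : ⁅X, w⁆ = 0)
    (hY : ⁅Y, w⁆ = 0) (hY0 : Y ≠ 0) {μ : ℝ} (hμ : ⁅X, Y⁆ = μ • Y) : μ = 0 := by
  set R := LinearMap.range (orbitMap ℝ L w)
  set d := finrank ℝ (LinearMap.ker (orbitMap ℝ L w))
  obtain ⟨g, y, hy, hev⟩ := exists_local_section hmax hX
  -- The bound `|ν|^d ≤ |χ(ν)|` on the varying stabilizer is multiplied by the polynomial on `V`. By
  -- `charpoly_stab` only polynomials on the fixed spaces `L` and `V` remain, and these are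
  -- continuous in the element.
  have key (ν : ℝ) : |(LieModule.toEnd ℝ L V X).charpoly.eval ν| * |ν| ^ d ≤
      |(LieModule.toEnd ℝ L L X).charpoly.eval ν| * |ν| ^ (finrank ℝ V - finrank ℝ R) := by
    let F : R → ℝ := fun r =>
      |(LieModule.toEnd ℝ L L X - LieModule.toEnd ℝ L L (g r)).charpoly.eval ν| *
          |ν| ^ (finrank ℝ V - finrank ℝ R) -
        |(LieModule.toEnd ℝ L V X - LieModule.toEnd ℝ L V (g r)).charpoly.eval ν| * |ν| ^ d
    have hF : Continuous F := by
      have h1 := continuous_eval_charpoly (LieModule.toEnd ℝ L L X)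
        ((LieModule.toEnd ℝ L L : L →ₗ[ℝ] Module.End ℝ L) ∘ₗ g) ν
      have h2 := continuous_eval_charpoly (LieModule.toEnd ℝ L V X)
        ((LieModule.toEnd ℝ L V : L →ₗ[ℝ] Module.End ℝ V) ∘ₗ g) ν
      exact (h1.abs.mul continuous_const).sub (h2.abs.mul continuous_const)
    have hF0 : Tendsto (fun v => F (y v)) (𝓝 w) (𝓝 (F 0)) := (hF.tendsto 0).comp hy
    have h0 := ge_of_tendsto_of_frequently (b := 0) hF0
      (((mem_closure_iff_frequently.1 hw).and_eventually hev).mono ?_)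
    · simp only [F, map_zero, sub_zero] at h0
      exact sub_nonneg.1 h0
    · rintro v ⟨hv, hlie, hrank⟩
      have hmaxv : ∀ u : V, finrank ℝ (LinearMap.range (orbitMap ℝ L u)) ≤
          finrank ℝ (LinearMap.range (orbitMap ℝ L v)) := fun u => (hmax u).trans hrank.ge
      have h1 := congrArg (Polynomial.eval ν) (charpoly_stab hmaxv hlie)
      have h2 := abs_pow_le_abs_eval (LinearMap.charpoly_monic _)
        (absReRoots_of_isAmenableReductive hv hlie) ν
      rw [LinearMap.charpoly_natDegree] at h2
      have h3 : finrank ℝ (LinearMap.ker (orbitMap ℝ L v)) = d := by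
        have h4 := (orbitMap ℝ L v).finrank_range_add_finrank_ker
        have h5 := (orbitMap ℝ L w).finrank_range_add_finrank_ker
        change finrank ℝ R + d = _ at h5
        change _ = finrank ℝ R at hrank
        omega
      rw [h3] at h2
      rw [Polynomial.eval_mul, Polynomial.eval_mul, Polynomial.eval_pow, Polynomial.eval_X,
        show finrank ℝ (LinearMap.range (orbitMap ℝ L v)) = finrank ℝ R from hrank] at h1
      have h4 := congrArg abs h1
      rw [abs_mul, abs_mul, abs_pow] at h4
      simp only [F, ← map_sub]
      rw [← h4, ← mul_sub]
      exact mul_nonneg (abs_nonneg _) (sub_nonneg.2 h2)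
  set p := (LieModule.toEnd ℝ L V X).charpoly with hp
  set k := ((LieModule.toEnd ℝ L L X).restrict (lie_mem_ker_orbitMap hX)).charpoly with hk
  have hp0 : p ≠ 0 := (LinearMap.charpoly_monic _).ne_zero
  -- At `w` itself the factor from `V` is cancelled where it is nonzero. Continuity fills in its
  -- finitely many roots, and `ν = μ` is a root of `k`.
  have h1 : ∀ ν ∈ {ν : ℝ | p.IsRoot ν}ᶜ, |ν| ^ d ≤ |k.eval ν| := by
    intro ν hν
    have h2 := congrArg abs (congrArg (Polynomial.eval ν) (charpoly_stab hmax hX))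
    rw [Polynomial.eval_mul, Polynomial.eval_mul, Polynomial.eval_pow, Polynomial.eval_X, abs_mul,
      abs_mul, abs_pow] at h2
    have h3 := key ν
    rw [← h2] at h3
    exact le_of_mul_le_mul_left h3 (abs_pos.2 hν)
  have hdense : Dense ({ν : ℝ | p.IsRoot ν}ᶜ) :=
    Set.Countable.dense_compl ℝ (Polynomial.finite_setOfPred_isRoot hp0).countable
  have hclosed : IsClosed {ν : ℝ | |ν| ^ d ≤ |k.eval ν|} :=
    isClosed_le (by fun_prop) (by fun_prop)
  have h2 : μ ∈ {ν : ℝ | |ν| ^ d ≤ |k.eval ν|} :=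
    closure_minimal h1 hclosed (hdense μ)
  have h3 : k.eval μ = 0 := isRoot_of_lie_eq_smul hX hY hY0 hμ
  rw [Set.mem_ofPred_eq, h3, abs_zero] at h2
  exact abs_eq_zero.1 (IsNilpotent.eq_zero ⟨d, le_antisymm h2 (by positivity)⟩)

end Limit

/-! ### The adjoint group acts by automorphisms -/

section Exp

open NormedSpace in
/-- The exponential of a derivation of a bilinear product is an automorphism. -/
theorem exp_derivation {E : Type*} [NormedAddCommGroup E] [NormedSpace ℝ E] [CompleteSpace E]
    (D : E →L[ℝ] E) (b : E →L[ℝ] E →L[ℝ] E) (hD : ∀ u w, D (b u w) = b (D u) w + b u (D w))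
    (u w : E) : exp D (b u w) = b (exp D u) (exp D w) := by
  -- The Leibniz rule makes `F` constant; its values at 1 and 0 are compared.
  let F : ℝ → E := fun t => exp (t • (-D)) (b (exp (t • D) u) (exp (t • D) w))
  have hF (t : ℝ) : HasDerivAt F 0 t := by
    have h1 := hasDerivAt_exp_smul_const (𝕂 := ℝ) (-D) t
    have h2 (x : E) := (hasDerivAt_exp_smul_const' (𝕂 := ℝ) D t).clm_apply (hasDerivAt_const t x)
    have h3 := (b.hasFDerivAt.comp_hasDerivAt t (h2 u)).clm_apply (h2 w)
    have h4 := h1.clm_apply h3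
    refine (h4 : HasDerivAt F _ t).congr_deriv ?_
    symm
    rw [map_zero, add_zero, add_zero]
    change 0 = exp (t • -D) (-(D (b (exp (t • D) u) (exp (t • D) w)))) +
      exp (t • -D) (b (D (exp (t • D) u)) (exp (t • D) w) +
        b (exp (t • D) u) (D (exp (t • D) w)))
    rw [hD, map_neg, neg_add_cancel]
  have hconst := is_const_of_deriv_eq_zero (fun t => (hF t).differentiableAt)
    (fun t => (hF t).deriv) 1 0
  simp only [F, one_smul, zero_smul, exp_zero, one_apply_eq_self] at hconst
  have hinv : exp D * exp (-D) = 1 := by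
    let _ : NormedAlgebra ℚ (E →L[ℝ] E) := NormedAlgebra.restrictScalars ℚ ℝ _
    rw [← exp_add_of_commute (Commute.refl D).neg_right, add_neg_cancel, exp_zero]
  rw [← hconst, ← mul_apply_eq_comp, hinv, one_apply_eq_self]

variable {L : Type*} [LieRing L] [LieAlgebra ℝ L] [FiniteDimensional ℝ L]

-- `exp_derivation` in coordinates: `f` is a continuous algebra homomorphism, so it carries the
-- matrix exponential to the exponential of operators.
attribute [local instance] Matrix.linftyOpNormedRing Matrix.linftyOpNormedAlgebra in
theorem expEnd_lie (X x y : L) : expEnd (LieAlgebra.ad ℝ L X) ⁅x, y⁆ =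
    ⁅expEnd (LieAlgebra.ad ℝ L X) x, expEnd (LieAlgebra.ad ℝ L X) y⁆ := by
  let β := finBasis ℝ L
  let E := Fin (finrank ℝ L) → ℝ
  let c : L ≃ₗ[ℝ] E := β.equivFun
  let M := LinearMap.toMatrix β β (LieAlgebra.ad ℝ L X)
  let f : Matrix (Fin (finrank ℝ L)) (Fin (finrank ℝ L)) ℝ →ₐ[ℝ] (E →L[ℝ] E) :=
    (Module.End.toContinuousLinearMap (𝕜 := ℝ) E).toAlgHom.comp
      (Matrix.toLinAlgEquiv' (R := ℝ)).toAlgHom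
  have hf (A) (u : E) : f A u = Matrix.mulVec A u := rfl
  have hfc : Continuous f := LinearMap.continuous_of_finiteDimensional f.toLinearMap
  have hexp : f (NormedSpace.exp M) = NormedSpace.exp (f M) := by
    let _ : NormedAlgebra ℚ (Matrix (Fin (finrank ℝ L)) (Fin (finrank ℝ L)) ℝ) :=
      NormedAlgebra.restrictScalars ℚ ℝ _
    exact NormedSpace.map_exp f hfc M
  have hMc (T : Module.End ℝ L) (x : L) :
      Matrix.mulVec (LinearMap.toMatrix β β T) (c x) = c (T x) :=
    LinearMap.toMatrix_mulVec_repr β β T x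
  have hexpc (x : L) : NormedSpace.exp (f M) (c x) = c (expEnd (LieAlgebra.ad ℝ L X) x) := by
    rw [← hexp, hf, ← hMc, expEnd, LinearMap.toMatrix_toLin]
  let b₀ : E →ₗ[ℝ] E →ₗ[ℝ] E :=
    ((LieModule.toEnd ℝ L L : L →ₗ[ℝ] Module.End ℝ L).compl₁₂ c.symm.toLinearMap
      c.symm.toLinearMap).compr₂ c.toLinearMap
  let b : E →L[ℝ] E →L[ℝ] E := LinearMap.toContinuousLinearMap
    ((LinearMap.toContinuousLinearMap (𝕜 := ℝ) (E := E) (F' := E)).toLinearMap ∘ₗ b₀)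
  have hb (x y : L) : b (c x) (c y) = c ⁅x, y⁆ := by
    change c ⁅c.symm (c x), c.symm (c y)⁆ = _
    rw [c.symm_apply_apply, c.symm_apply_apply]
  have hD (u w : E) : f M (b u w) = b (f M u) w + b u (f M w) := by
    obtain ⟨x, rfl⟩ := c.surjective u
    obtain ⟨y, rfl⟩ := c.surjective w
    rw [hb, hf, hf, hf, hMc, hMc, hMc, hb, hb, ← map_add]
    simp only [LieAlgebra.ad_apply]
    rw [leibniz_lie]
  have h1 := exp_derivation (f M) b hD (c x) (c y)
  rw [hb, hexpc, hexpc, hexpc, hb] at h1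
  exact c.injective h1

theorem lie_of_mem_adjointGroup {g : L ≃ₗ[ℝ] L} (hg : g ∈ adjointGroup L) (x y : L) :
    g ⁅x, y⁆ = ⁅g x, g y⁆ := by
  induction hg using Subgroup.closure_induction generalizing x y with
  | mem g hg =>
    obtain ⟨X, hX⟩ := hg
    have h1 (z : L) : g z = expEnd (LieAlgebra.ad ℝ L X) z := LinearMap.congr_fun hX z
    rw [h1, h1, h1, expEnd_lie]
  | one => rfl
  | mul g h _ _ hg hh =>
    change g (h ⁅x, y⁆) = ⁅g (h x), g (h y)⁆
    rw [hh, hg]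
  | inv g _ hg =>
    change g.symm ⁅x, y⁆ = ⁅g.symm x, g.symm y⁆
    rw [LinearEquiv.symm_apply_eq, hg, g.apply_symm_apply, g.apply_symm_apply]

end Exp

/-! ### The real rank -/

section RealRank

variable {L : Type*} [LieRing L] [LieAlgebra ℝ L] [FiniteDimensional ℝ L]

theorem IsSplitAbelian.map {a : LieSubalgebra ℝ L} (ha : IsSplitAbelian a) (g : L ≃ₗ⁅ℝ⁆ L) :
    IsSplitAbelian (a.map g.toLieHom) := by
  refine ⟨⟨?_⟩, ?_⟩
  · rintro ⟨_, x, hx, rfl⟩ ⟨_, y, hy, rfl⟩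
    refine Subtype.ext ?_
    change ⁅g x, g y⁆ = 0
    rw [← g.map_lie, show ⁅x, y⁆ = 0 from congrArg Subtype.val (ha.1.trivial ⟨x, hx⟩ ⟨y, hy⟩),
      map_zero]
  · rintro _ ⟨Y, hY, rfl⟩
    rw [eq_top_iff]
    rintro z -
    have h1 : (⨆ μ : ℝ, eigenspace (LieAlgebra.ad ℝ L Y) μ) ≤
        (⨆ μ : ℝ, eigenspace (LieAlgebra.ad ℝ L (g Y)) μ).comap (g : L →ₗ[ℝ] L) := by
      refine iSup_le fun μ x hx => Submodule.mem_iSup_of_mem μ ?_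
      rw [mem_eigenspace_iff, LieAlgebra.ad_apply] at hx ⊢
      change ⁅g Y, g x⁆ = μ • g x
      rw [← g.map_lie, hx, map_smul]
    have h2 := h1 (ha.2 Y hY ▸ Submodule.mem_top (x := g.symm z))
    have h3 : g (g.symm z) ∈ ⨆ μ : ℝ, eigenspace (LieAlgebra.ad ℝ L (g Y)) μ := h2
    rwa [g.apply_symm_apply] at h3

theorem isSplitAbelian_bot : IsSplitAbelian (⊥ : LieSubalgebra ℝ L) := by
  refine ⟨⟨fun x y => Subtype.ext (by
    rw [LieSubalgebra.coe_bracket, (LieSubalgebra.mem_bot _).1 x.2, zero_lie]; rfl)⟩, fun Y hY => ?_⟩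
  rw [(LieSubalgebra.mem_bot Y).1 hY, eq_top_iff]
  exact fun z _ => Submodule.mem_iSup_of_mem 0 (mem_eigenspace_iff.2 (by simp))

/-- Needed because `sSup` of an unbounded set of natural numbers is 0 by default. -/
theorem realRank_bddAbove (l : LieSubalgebra ℝ L) : BddAbove {n : ℕ | ∃ a : LieSubalgebra ℝ L,
    a ≤ l ∧ IsSplitAbelian a ∧ finrank ℝ a = n} :=
  ⟨finrank ℝ L, by rintro _ ⟨a, -, -, rfl⟩; exact Submodule.finrank_le a.toSubmodule⟩

theorem exists_finrank_eq_realRank (l : LieSubalgebra ℝ L) :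
    ∃ a : LieSubalgebra ℝ L, a ≤ l ∧ IsSplitAbelian a ∧ finrank ℝ a = realRank l :=
  Nat.sSup_mem (s := {n : ℕ | ∃ a : LieSubalgebra ℝ L,
    a ≤ l ∧ IsSplitAbelian a ∧ finrank ℝ a = n}) ⟨_, ⊥, bot_le, isSplitAbelian_bot, rfl⟩
    (realRank_bddAbove l)

theorem IsSplitAbelian.maximal {a : LieSubalgebra ℝ L} (ha : IsSplitAbelian a)
    (h : finrank ℝ a = realRank (⊤ : LieSubalgebra ℝ L)) : Maximal IsSplitAbelian a := by
  refine ⟨ha, fun c hc hac => ?_⟩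
  have h1 : finrank ℝ c ≤ realRank (⊤ : LieSubalgebra ℝ L) :=
    le_csSup (realRank_bddAbove ⊤) ⟨c, le_top, hc, rfl⟩
  have h2 : a.toSubmodule = c.toSubmodule :=
    Submodule.eq_of_le_of_finrank_le (S₁ := a.toSubmodule) (S₂ := c.toSubmodule) hac
      (h1.trans h.ge)
  exact fun x hx => h2.ge hx

/-- If `l` is conjugate to a subalgebra of full real rank then `l` contains a maximal split
abelian subalgebra. -/
theorem AreConjugate.exists_maximal {l m : LieSubalgebra ℝ L} (h : AreConjugate l m)
    (hm : realRank m = realRank (⊤ : LieSubalgebra ℝ L)) :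
    ∃ a : LieSubalgebra ℝ L, a ≤ l ∧ Maximal IsSplitAbelian a := by
  obtain ⟨g, hg, hgm⟩ := h
  obtain ⟨a, ham, ha, har⟩ := exists_finrank_eq_realRank m
  let e : L ≃ₗ⁅ℝ⁆ L := { g with map_lie' := fun {x y} => lie_of_mem_adjointGroup hg x y }
  refine ⟨a.map e.symm.toLieHom, ?_, (ha.map e.symm).maximal ?_⟩
  · rintro _ ⟨x, hx, rfl⟩
    have h1 : x ∈ m.toSubmodule := ham hx
    rw [← hgm] at h1
    obtain ⟨y, hy, rfl⟩ := h1
    have h2 : e.symm (e y) = y := e.symm_apply_apply y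
    change e.symm (e y) ∈ l
    rw [h2]
    exact hy
  · rw [← hm, ← har]
    exact (LinearEquiv.finrank_map_eq g.symm a.toSubmodule)

end RealRank

/-! ### Generic stabilizers and the converse inequality -/

section Final

variable {L V : Type*} [LieRing L] [LieAlgebra ℝ L] [FiniteDimensional ℝ L]
  [NormedAddCommGroup V] [NormedSpace ℝ V] [FiniteDimensional ℝ V]
  [LieRingModule L V] [LieModule ℝ L V]

/-- Otherwise the covering open set, intersected with the nonvanishing set of `q`, would be a
nonempty Zariski open set covered without `m`, contrary to irredundancy. -/
theorem IsGenericStabilizer.exists_conjugate {m : LieSubalgebra ℝ L}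
    (hm : IsGenericStabilizer L V m) {q : MvPolynomial (Fin (finrank ℝ V)) ℝ} (hq : q ≠ 0) :
    ∃ w : V, MvPolynomial.eval (fun i => (finBasis ℝ V).repr w i) q ≠ 0 ∧
      AreConjugate (stab L w) m := by
  obtain ⟨S, -, -, ⟨U, ⟨P, hP⟩, ⟨u, hu⟩, hcov⟩, hrem, hmS⟩ := hm
  by_contra! hcon
  refine hrem m hmS ⟨_, ⟨(fun p => p * q) '' P, rfl⟩, ?_, ?_⟩
  · rw [hP] at hu
    obtain ⟨p, hp, hpu⟩ := hu
    have hp0 : p ≠ 0 := by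
      rintro rfl
      exact hpu (map_zero _)
    obtain ⟨v, hv⟩ := (dense_eval_ne_zero (V := V) (mul_ne_zero hp0 hq)).nonempty
    exact ⟨v, p * q, ⟨p, hp, rfl⟩, hv⟩
  · rintro v ⟨_, ⟨p, hp, rfl⟩, hv⟩
    rw [map_mul] at hv
    obtain ⟨k, hk, hvk⟩ := hcov v (hP ▸ ⟨p, hp, left_ne_zero_of_mul hv⟩)
    refine ⟨k, ⟨hk, ?_⟩, hvk⟩
    rintro rfl
    exact hcon v (right_ne_zero_of_mul hv) hvk

/-- By the limit argument a split `H` has only the eigenvalue 0 on the stabilizer, and being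
diagonalizable it acts there by zero. -/
theorem absReRoots_stab_eq_zero {w : V}
    (hmax : ∀ v : V, finrank ℝ (LinearMap.range (orbitMap ℝ L v)) ≤
      finrank ℝ (LinearMap.range (orbitMap ℝ L w)))
    (hw : w ∈ closure {v : V | IsAmenableReductive (stab L v)}) {H : L} (hH : ⁅H, w⁆ = 0)
    (hd : IsDiag (LieModule.toEnd ℝ L L H)) :
    absReRoots ((LieModule.toEnd ℝ L L H).restrict (lie_mem_ker_orbitMap hH)).charpoly = 0 := by
  have h1 : (LieModule.toEnd ℝ L L H).restrict (lie_mem_ker_orbitMap hH) = 0 :=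
    LinearMap.ext fun Y => Subtype.ext (lie_eq_zero_of_isDiag (lie_mem_ker_orbitMap hH) hd
      (fun Y hY μ hμ hY0 => eq_zero_of_mem_closure hmax hw hH hY hY0 hμ) Y Y.2)
  rw [h1, LinearMap.charpoly_zero, absReRoots_X_pow]

end Final

end

end LieRep

theorem proposition2p8 {h V : Type*} [LieRing h] [LieAlgebra ℝ h] [FiniteDimensional ℝ h]
    [LieAlgebra.IsSemisimple ℝ h]
    [NormedAddCommGroup V] [NormedSpace ℝ V] [FiniteDimensional ℝ V]
    [LieRingModule h V] [LieModule ℝ h V]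
    (hV : LieRep.IsOrthogonalRep h V)
    (a : LieSubalgebra ℝ h) (ha : Maximal LieRep.IsSplitAbelian a) :
    ((∀ Y ∈ a, LieRep.rho h h Y ≤ LieRep.rho h V Y) → LieRep.HasAmGS h V) ∧
    (∀ m : LieSubalgebra ℝ h, LieRep.IsGenericStabilizer h V m →
      LieRep.realRank m = LieRep.realRank (⊤ : LieSubalgebra ℝ h) →
      LieRep.HasAmGS h V → ∀ Y ∈ a, LieRep.rho h h Y ≤ LieRep.rho h V Y) := by
  obtain ⟨B, hnd, hsymm, hinv⟩ := hV
  obtain ⟨q, hq, hgen⟩ := LieRep.exists_generic_polynomial (L := h) (B := B) hsymm.eq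
    (fun v hv => hnd.1 v hv) hinv
  refine ⟨fun hρ => ?_, fun m hm hrank hAmGS Y hY => ?_⟩
  · refine (LieRep.dense_eval_ne_zero hq).mono fun v hv => ?_
    exact LieRep.isAmenableReductive_stab_of_rho_le ha hρ (hgen v hv).1 (hgen v hv).2
  · obtain ⟨w, hw, hconj⟩ := hm.exists_conjugate hq
    obtain ⟨b, hbw, hb⟩ := hconj.exists_maximal hrank
    -- `b` need not be `a`, so `Y` is replaced by an element `H` of `b` with the same `ρ`-values.
    -- Since `H` stabilizes `w`, the difference formula yields even the equality of the two
    -- `ρ`-values.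
    obtain ⟨H, hH, h1, h2⟩ := LieRep.exists_mem_rho_eq (V := V) hb Y
    have hHw : ⁅H, w⁆ = 0 := hbw hH
    have h3 := LieRep.absReRoots_stab_eq_zero (hgen w hw).1 (hAmGS w) hHw (hb.prop.isDiag hH)
    rw [LieRep.absReRoots_stab (hgen w hw).1 hHw, h1, h2] at h3
    linarith
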